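/- **Setting.** Fix integers $1\le d\le D-1$ and $K$, and constants $\kappa\ge 1$, $v_0>0$. Let $\mathcal S_d^2(\kappa)$ be the class of connected $d$-dimensional embedded $C^2$ submanifolds without boundary $S\subset(0,1)^D$ with $1/\kappa\le\operatorname{diam}(S)\le\kappa$ and $\operatorname{reach}(S)\ge 1/\kappa$, where $\operatorname{reach}(S)$ is the supremum of the $t>0$ such that every point of $\mathbb R^D$ at distance less than $t$ from $S$ has a unique nearest point in $S$. Write $B(S,t)=\{x\in(0,1)^D:\operatorname{dist}(x,S)<t\}$. *Data.* Given $S_1,\dots,S_K\in\mathcal S_d^2(\kappa)$, a jitter level $0<\tau<1/\kappa$ and $\delta_0$, the data $x_1,\dots,x_N$ are independent; for each $k$, $N_k$ of them (cluster $k$) are uniform on $B(S_k,\tau)$, and the remaining $N_0=N-\sum_k N_k$ (the outliers) are uniform on $(0,1)^D\setminus\bigcup_k B(S_k,\delta_0)$. If $N_0>0$, the latter region is assumed to have volume at least $v_0$. *Degrees.* For $\varepsilon,\eta>0$ and points $y_1,\dots,y_m$, let $\Lambda_d(y_1,\dots,y_m)=\min_L\max_j\operatorname{dist}(y_j,L)$,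 with $L$ ranging over the $d$-dimensional affine subspaces of $\mathbb R^D$. Let $\alpha_d(y_1,\dots,y_m)=1$ if the $y_j$ are distinct, $\operatorname{diam}\{y_1,\dots,y_m\}<\varepsilon$ and $\Lambda_d(y_1,\dots,y_m)<\eta$, and $\alpha_d(y_1,\dots,y_m)=0$ otherwise. Put $$W_{ij}=\sum_{i_1,\dots,i_{m-2}}\alpha_d(x_i,x_j,x_{i_1},\dots,x_{i_{m-2}}),\qquad D_i=\sum_{j}W_{ij},$$ all indices ranging over $\{1,\dots,N\}$. **Proposition.** Let $\rho_N\to\infty$ slowly, in the sense that $\rho_N=o\big((\log N)^{d/(2(D-d))}\big)$ (e.g. $\rho_N=\log\log N$). There is $\bar N$, depending only on $D,d,K,\kappa,v_0$ and the sequence $(\rho_N)$, such that the following holds for every $N\ge\bar N$ and all $S_1,\dots,S_K,\tau,\delta_0,N_1,\dots,N_K,m$ as above. Assume $$\log N\ \ge\ m\ \ge\ \frac{\log N}{\sqrt{\log\rho_N}},\qquad \varepsilon=\Big(\frac{\rho_N\log N}{N}\Big)^{1/(2D-d)},\qquad \eta=\Big(\frac{\rho_N\log N}{N}\Big)^{2/(2D-d)},$$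 $\delta_0-\tau>\varepsilon$, and $$N_k\ \ge\ \rho_N\log(N)\,\max\big(N^{d/(2D-d)},\,N\tau^{D-d}\big)\qquad\text{for all }k=1,\dots,K.$$ Then, with probability at least $1-N^{-\rho_N}$, rule (O2) identifies outliers without error: for every $i$, the point $x_i$ is an outlier if and only if $$D_i^{1/(m-1)}\le\rho_N\,N\,\varepsilon^d\,\eta^{D-d}.$$ -/

import Mathlib

open Filter Topology MeasureTheory

noncomputable section

namespace HOSC

/-- The ambient Euclidean space `ℝ^D`. -/
abbrev Amb (D : ℕ) : Type := EuclideanSpace ℝ (Fin D)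

/-- The open unit hypercube `(0,1)^D`. -/
def unitCube (D : ℕ) : Set (Amb D) := {x | ∀ j, x j ∈ Set.Ioo (0 : ℝ) 1}

/-- `B(S, t)`: the `t`-neighborhood of `S` inside the open unit hypercube. -/
def tube {D : ℕ} (S : Set (Amb D)) (t : ℝ) : Set (Amb D) :=
  {x | x ∈ unitCube D ∧ Metric.infDist x S < t}

/-- Federer's reach of `S ⊆ ℝ^D`: the supremum of the `t > 0` such that every point of `ℝ^D` at
distance less than `t` from `S` has a unique nearest point in `S`. -/
def reach {D : ℕ} (S : Set (Amb D)) : ENNReal :=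
  ⨆ t ∈ {t : ℝ | 0 < t ∧ ∀ x : Amb D, Metric.infDist x S < t →
    ∃! s, s ∈ S ∧ dist x s = Metric.infDist x S}, ENNReal.ofReal t

/-- `S` is a `d`-dimensional embedded `C²` submanifold (without boundary) of `ℝ^D`: near each of
its points, some `C²` diffeomorphism between open sets straightens `S` to `ℝ^d × {0}`. -/
def IsC2Submanifold {D : ℕ} (d : ℕ) (S : Set (Amb D)) : Prop :=
  ∀ p ∈ S, ∃ Φ : OpenPartialHomeomorph (Amb D) (Amb d × Amb (D - d)),
    p ∈ Φ.source ∧ ContDiffOn ℝ 2 Φ Φ.source ∧ ContDiffOn ℝ 2 Φ.symm Φ.target ∧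
      ∀ x ∈ Φ.source, (x ∈ S ↔ (Φ x).2 = 0)

/-- The class `𝒮_d²(κ)` of surfaces without boundary. -/
structure IsSurface {D : ℕ} (d : ℕ) (κ : ℝ) (S : Set (Amb D)) : Prop where
  subset_cube : S ⊆ unitCube D
  connected : IsConnected S
  submanifold : IsC2Submanifold d S
  le_diam : 1 / κ ≤ Metric.diam S
  diam_le : Metric.diam S ≤ κ
  le_reach : ENNReal.ofReal (1 / κ) ≤ reach S

/-- `Λ_d(x_1, …, x_n)`: half-width of the thinnest tube around a `d`-dimensional affine subspace
that contains the given points. -/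
def flatness {D n : ℕ} (d : ℕ) (x : Fin n → Amb D) : ℝ :=
  ⨅ L : {L : AffineSubspace ℝ (Amb D) //
      (L : Set (Amb D)).Nonempty ∧ Module.finrank ℝ L.direction = d},
    ⨆ j, Metric.infDist (x j) (L.1 : Set (Amb D))

open Classical in
/-- The simple kernel `φ(s) = 1_{|s| < 1}`. -/
def simpleKernel (s : ℝ) : ℝ := if |s| < 1 then 1 else 0

open Classical in
/-- The multiway affinity `α_d(x_1, …, x_n)` with scales `ε, η` and the simple kernel. -/
def affinity {D n : ℕ} (d : ℕ) (ε η : ℝ) (x : Fin n → Amb D) : ℝ :=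
  if Function.Injective x then
    simpleKernel (Metric.diam (Set.range x) / ε) * simpleKernel (flatness d x / η)
  else 0

/-- The pairwise similarity
`W_ij = ∑_{i_1, …, i_{m-2}} α_d(x_i, x_j, x_{i_1}, …, x_{i_{m-2}})`. -/
def similarity {D N : ℕ} (d m : ℕ) (ε η : ℝ) (x : Fin N → Amb D) (i j : Fin N) : ℝ :=
  ∑ q : Fin (m - 2) → Fin N,
    affinity d ε η (Matrix.vecCons (x i) (Matrix.vecCons (x j) (fun t => x (q t))))

/-- The degree `D_i = ∑_j W_ij`. -/
def degree {D N : ℕ} (d m : ℕ) (ε η : ℝ) (x : Fin N → Amb D) (i : Fin N) : ℝ :=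
  ∑ j, similarity d m ε η x i j

/-- The region `(0,1)^D \ ⋃_k B(S_k, δ₀)` in which outliers are sampled. -/
def outlierRegion {D K : ℕ} (S : Fin K → Set (Amb D)) (δ₀ : ℝ) : Set (Amb D) :=
  unitCube D \ ⋃ k, tube (S k) δ₀

/-- The region in which a point with a given label is sampled: label `some k` means that the point
belongs to cluster `k`, label `none` that it is an outlier. -/
def samplingRegion {D K : ℕ} (S : Fin K → Set (Amb D)) (τ δ₀ : ℝ) :
    Option (Fin K) → Set (Amb D)
  | some k => tube (S k) τ
  | none => outlierRegion S δ₀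

/-- The joint law of the data `x_1, …, x_N`: the points are independent, and each is uniformly
distributed on the region given by its label. -/
def sampleLaw {D K N : ℕ} (S : Fin K → Set (Amb D)) (τ δ₀ : ℝ)
    (label : Fin N → Option (Fin K)) : Measure (Fin N → Amb D) :=
  Measure.pi fun i => ProbabilityTheory.cond volume (samplingRegion S τ δ₀ (label i))

/-- `N_k`, the number of data points in cluster `k`. -/
def clusterSize {K N : ℕ} (label : Fin N → Option (Fin K)) (k : Fin K) : ℕ :=
  (Finset.univ.filter fun i => label i = some k).card

end HOSC

end

/-! The scales satisfy η = ε² and N ε^d η^(D-d) = ρ log N (`scales`), so the threshold is ρ² log N.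
Both directions count sample points in sets of tangential size ε and normal size η. A union bound
over polynomially many such sets is affordable, since Chernoff failure probabilities are
superpolynomially small.

Outliers. Since ε < δ₀ - τ, a tuple contributing to the degree of an outlier consists of outliers
only, and it lies in one of at most N^a boxes, a = 2(d+1)D (`exists_flat_net`). Outliers have
density at most 1/v₀, so with high probability every box holds fewer than √ρ · ρ log N of them.
Hence the degree is at most N^a (√ρ · ρ log N)^(m-1), and the lower bound on m makes N^(a/(m-1)) ≤
√ρ (`mul_log_le_of_div_sqrt_le`).

Inliers. Around each point of a tube there is a region inside the tube, nearly coplanar with that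
point, of volume at least c ε^d min(τ, ε²)^(D-d) (`exists_hasLocalRegion`), whereas the tube has
volume at most C τ^(D-d) (`exists_volume_tube_le`). The lower bound on N_k makes the expected count
at least 16 ρ² log N (`mul_mass_ge`); the growth exponent allowed for ρ is what settles the case τ ≤
ε². With high probability all counts attached to a net of centres exceed 4 ρ² log N, and requiring
distinct indices costs only m - 1 ≤ log N.

Geometry. Constants may depend on κ, d, D but not on the surface. The reach gives Federer's
inequality (`UniqueNearest.inner_le`) and a 2-Lipschitz projection
(`UniqueNearest.dist_nearest_le`). Charts give tangent spaces with surface-dependent constants; that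
dependence is removed by the reach for normals and by a doubling argument for tangential steps
(`TangentField.stepApprox`). -/

noncomputable section
namespace HOSC

/-! ### Sets of positive reach: normal rays, Federer's inequality, projection. -/

section Reach

variable {E : Type*} [NormedAddCommGroup E]

/-- Every point at distance less than `r` from `S` has a unique nearest point in `S`. -/
def UniqueNearest (S : Set E) (r : ℝ) : Prop :=
  ∀ x : E, Metric.infDist x S < r → ∃! s, s ∈ S ∧ dist x s = Metric.infDist x S

/-- Any cluster point of the nearest points is again nearest to x, by continuity of the distance, so
uniqueness and compactness give convergence. -/
lemma UniqueNearest.tendsto_nearest {S : Set E} {r : ℝ} (hS : IsCompact S)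
    (hr : UniqueNearest S r) {x a : E} (hx : Metric.infDist x S < r) (ha : a ∈ S)
    (hxa : dist x a = Metric.infDist x S) {y p : ℕ → E} (hy : Tendsto y atTop (𝓝 x))
    (hp : ∀ n, p n ∈ S) (hyp : ∀ n, dist (y n) (p n) = Metric.infDist (y n) S) :
    Tendsto p atTop (𝓝 a) := by
  refine hS.tendsto_nhds_of_unique_mapClusterPt (Eventually.of_forall hp) fun b hb hcl => ?_
  obtain ⟨ψ, hψ, hlim⟩ := hcl.tendsto_subseq
  have h1 : Tendsto (fun n => dist (y (ψ n)) (p (ψ n))) atTop (𝓝 (dist x b)) :=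
    (hy.comp hψ.tendsto_atTop).dist hlim
  have h2 : Tendsto (fun n => Metric.infDist (y (ψ n)) S) atTop (𝓝 (Metric.infDist x S)) :=
    ((Metric.continuous_infDist_pt S).tendsto x).comp (hy.comp hψ.tendsto_atTop)
  simp only [hyp] at h1
  exact (hr x hx).unique ⟨hb, tendsto_nhds_unique h1 h2⟩ ⟨ha, hxa⟩

variable [InnerProductSpace ℝ E]

/-- Moving away from the nearest point increases the distance to `S` at unit rate. -/
lemma UniqueNearest.exists_steep {S : Set E} {r c : ℝ} (hS : IsCompact S) (hne : S.Nonempty)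
    (hr : UniqueNearest S r) (hc : c < 1) {y : E} (hy0 : 0 < Metric.infDist y S)
    (hyr : Metric.infDist y S < r) {η : ℝ} (hη : 0 < η) :
    ∃ z, z ≠ y ∧ dist z y < η ∧ Metric.infDist y S + c * dist z y < Metric.infDist z S := by
  obtain ⟨p, hp, hyp⟩ := hS.exists_infDist_eq_dist hne y
  set δ := Metric.infDist y S with hδ
  set u : E := (1 / δ) • (y - p) with hu
  have hnu : ‖u‖ = 1 := by
    rw [hu, norm_smul, ← dist_eq_norm, ← hyp, Real.norm_of_nonneg (by positivity)]
    field_simp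
  -- Test z = y + t u with t → 0. A growth rate of at most c forces ⟨u, y - q⟩ ≤ c ‖y - q‖ for the
  -- nearest point q of z. Since q → p, the limit reads δ ≤ c δ.
  by_contra! hcon
  set t : ℕ → ℝ := fun n => η / 2 / ((n : ℝ) + 1) with ht
  have ht0 : ∀ n, 0 < t n := fun n => by positivity
  have htη : ∀ n, t n < η := fun n => by
    have : t n ≤ η / 2 := div_le_self (by positivity) (by linarith [Nat.cast_nonneg (α := ℝ) n])
    linarith
  have htl : Tendsto t atTop (𝓝 0) := by
    have := (tendsto_one_div_add_atTop_nhds_zero_nat (𝕜 := ℝ)).const_mul (η / 2)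
    simpa [ht, div_eq_mul_inv] using this
  have hzl : Tendsto (fun n => y + t n • u) atTop (𝓝 y) := by
    simpa using (htl.smul_const u).const_add y
  choose q hq hzq using fun n => hS.exists_infDist_eq_dist hne (y + t n • u)
  have hql := hr.tendsto_nearest hS hyr hp hyp.symm hzl hq fun n => (hzq n).symm
  have hdz : ∀ n, dist (y + t n • u) y = t n := fun n => by
    simp [dist_eq_norm, norm_smul, hnu, abs_of_pos (ht0 n)]
  have hkey : ∀ n, inner ℝ u (y - q n) ≤ c * ‖y - q n‖ := by
    intro n
    have h1 := hcon (y + t n • u) (by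
      intro h
      have := hdz n
      rw [h, dist_self] at this
      exact (ht0 n).ne this) (by rw [hdz]; exact htη n)
    rw [hdz, hzq n, dist_eq_norm] at h1
    have h2 : δ ≤ ‖y - q n‖ := by
      rw [← dist_eq_norm]; exact Metric.infDist_le_dist_of_mem (hq n)
    have h3 : 0 < ‖y - q n‖ := hy0.trans_le h2
    have h4 : ‖y - q n‖ * ‖y - q n‖ + t n * inner ℝ u (y - q n)
        ≤ ‖y + t n • u - q n‖ * ‖y - q n‖ := by
      have := real_inner_le_norm (y + t n • u - q n) (y - q n)
      have e : y + t n • u - q n = (y - q n) + t n • u := by abel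
      rw [e] at this ⊢
      rwa [inner_add_left, real_inner_self_eq_norm_mul_norm, real_inner_smul_left] at this
    have h5 : ‖y + t n • u - q n‖ ≤ ‖y - q n‖ + c * t n := by linarith
    have h6 : t n * inner ℝ u (y - q n) ≤ t n * (c * ‖y - q n‖) := by
      nlinarith [mul_le_mul_of_nonneg_right h5 h3.le]
    exact le_of_mul_le_mul_left h6 (ht0 n)
  have hlim1 : Tendsto (fun n => inner ℝ u (y - q n)) atTop (𝓝 (inner ℝ u (y - p))) :=
    tendsto_const_nhds.inner (hql.const_sub y)
  have hlim2 : Tendsto (fun n => c * ‖y - q n‖) atTop (𝓝 (c * ‖y - p‖)) :=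
    ((hql.const_sub y).norm).const_mul c
  have hfin := le_of_tendsto_of_tendsto' hlim1 hlim2 hkey
  have hyp' : ‖y - p‖ = δ := by rw [← dist_eq_norm, ← hyp]
  rw [hu, real_inner_smul_left, real_inner_self_eq_norm_mul_norm, hyp'] at hfin
  have : 1 / δ * (δ * δ) = δ := by field_simp
  rw [this] at hfin
  nlinarith

variable [FiniteDimensional ℝ E]

/-- An Ekeland-type argument: for c < 1, maximise the distance to S minus c times the distance to x
over the closed h-ball. By `exists_steep` an interior point cannot be a maximiser, so the maximum
lies on the sphere; then c tends to 1. -/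
lemma UniqueNearest.exists_infDist_add_le {S : Set E} {r h : ℝ} (hS : IsCompact S)
    (hne : S.Nonempty) (hr : UniqueNearest S r) {x : E} (hx : 0 < Metric.infDist x S)
    (hh : 0 ≤ h) (hxr : Metric.infDist x S + h < r) :
    ∃ y, dist y x ≤ h ∧ Metric.infDist x S + h ≤ Metric.infDist y S := by
  have hK : IsCompact (Metric.closedBall x h) := isCompact_closedBall x h
  have hKne : (Metric.closedBall x h).Nonempty := ⟨x, by simpa using hh⟩
  obtain ⟨y, hy, hmax⟩ := hK.exists_isMaxOn hKne (Metric.continuous_infDist_pt S).continuousOn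
  refine ⟨y, hy, ?_⟩
  have key : ∀ c : ℝ, 0 ≤ c → c < 1 → Metric.infDist x S + c * h ≤ Metric.infDist y S := by
    intro c hc0 hc
    obtain ⟨z, hz, hzmax⟩ := hK.exists_isMaxOn hKne
      (f := fun w => Metric.infDist w S - c * dist w x)
      ((Metric.continuous_infDist_pt S).sub
        (continuous_const.mul (continuous_id.dist continuous_const))).continuousOn
    have hzx : Metric.infDist x S ≤ Metric.infDist z S - c * dist z x := by
      simpa using hzmax (show x ∈ Metric.closedBall x h by simpa using hh)
    have hz' : dist z x ≤ h := hz
    have hzy : Metric.infDist z S ≤ Metric.infDist y S := hmax hz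
    rcases hz'.eq_or_lt with he | hlt
    · rw [he] at hzx; linarith
    · exfalso
      have hzr : Metric.infDist z S < r := by
        have := Metric.infDist_le_infDist_add_dist (s := S) (x := z) (y := x)
        linarith
      obtain ⟨w, -, hwz, hw⟩ := hr.exists_steep hS hne hc
        (hx.trans_le (by nlinarith [dist_nonneg (x := z) (y := x)])) hzr (sub_pos.2 hlt)
      have hwx : dist w x ≤ dist w z + dist z x := dist_triangle _ _ _
      have := hzmax (show w ∈ Metric.closedBall x h by
        rw [Metric.mem_closedBall]; linarith)
      simp only [Set.mem_ofPred_eq] at this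
      nlinarith
  refine le_of_forall_pos_le_add fun e he => ?_
  rcases hh.eq_or_lt with h0 | h0
  · have := key 0 le_rfl one_pos
    rw [← h0]; linarith
  · have hm : min (e / h) (1 / 2) ≤ e / h := min_le_left _ _
    have hm0 : 0 < min (e / h) (1 / 2) := by positivity
    have hm2 : min (e / h) (1 / 2) ≤ 1 / 2 := min_le_right _ _
    have := key (1 - min (e / h) (1 / 2)) (by linarith) (by linarith)
    have h3 : min (e / h) (1 / 2) * h ≤ e := by
      calc _ ≤ e / h * h := by gcongr
        _ = e := by field_simp
    nlinarith

/-- The normal ray at a nearest point keeps that nearest point up to the reach. -/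
lemma UniqueNearest.infDist_ray {S : Set E} {r h : ℝ} (hS : IsCompact S)
    (hr : UniqueNearest S r) {x a : E} (ha : a ∈ S) (hxa : dist x a = Metric.infDist x S)
    (hx : 0 < Metric.infDist x S) (hh : 0 ≤ h) (hxr : Metric.infDist x S + h < r) :
    Metric.infDist x S + h
      ≤ Metric.infDist (x + (h / Metric.infDist x S) • (x - a)) S := by
  obtain ⟨y, hyx, hy⟩ := hr.exists_infDist_add_le hS ⟨a, ha⟩ hx hh hxr
  set δ := Metric.infDist x S with hδ
  have h1 : Metric.infDist y S ≤ ‖y - a‖ := by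
    rw [← dist_eq_norm]; exact Metric.infDist_le_dist_of_mem ha
  rw [dist_eq_norm] at hyx hxa
  have h2 : ‖y - a‖ ^ 2 = ‖y - x‖ ^ 2 + 2 * inner ℝ (y - x) (x - a) + ‖x - a‖ ^ 2 := by
    rw [← norm_add_sq_real]; congr 2; abel
  -- ‖y - a‖ ≥ δ + h, ‖y - x‖ ≤ h and ‖x - a‖ = δ: this is equality in the triangle inequality,
  -- which forces y onto the ray from a through x.
  have h3 : h * δ ≤ inner ℝ (y - x) (x - a) := by
    have : (δ + h) ^ 2 ≤ ‖y - a‖ ^ 2 := by gcongr; linarith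
    have : ‖y - x‖ ^ 2 ≤ h ^ 2 := by gcongr
    rw [hxa] at h2
    nlinarith
  have h4 : ‖y - x - (h / δ) • (x - a)‖ ^ 2 ≤ 0 := by
    rw [norm_sub_sq_real, norm_smul, real_inner_smul_right, hxa, Real.norm_of_nonneg (by positivity)]
    have e1 : (h / δ * δ) ^ 2 = h ^ 2 := by field_simp
    have e2 : h / δ * (h * δ) ≤ h / δ * inner ℝ (y - x) (x - a) := by gcongr
    have e3 : h / δ * (h * δ) = h ^ 2 := by field_simp
    have : ‖y - x‖ ^ 2 ≤ h ^ 2 := by gcongr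
    rw [e1]; nlinarith
  have h5 : y - x - (h / δ) • (x - a) = 0 := by
    have := le_antisymm h4 (sq_nonneg _)
    simpa using this
  have h6 : y = x + (h / δ) • (x - a) := by
    rw [sub_sub, sub_eq_zero] at h5; exact h5
  rwa [← h6]

/-- Federer's inequality for vectors pointing from a nearest point. -/
lemma UniqueNearest.inner_le {S : Set E} {r : ℝ} (hS : IsCompact S)
    (hr : UniqueNearest S r) {x a b : E} (ha : a ∈ S) (hxa : dist x a = Metric.infDist x S)
    (hxr : Metric.infDist x S < r) (hb : b ∈ S) :
    2 * r * inner ℝ (b - a) (x - a) ≤ ‖x - a‖ * ‖b - a‖ ^ 2 := by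
  set δ := Metric.infDist x S with hδ
  have hxa' : ‖x - a‖ = δ := by rw [← dist_eq_norm, hxa]
  rcases (Metric.infDist_nonneg (x := x) (s := S)).eq_or_lt with h0 | h0
  · have : x - a = 0 := by rw [← norm_eq_zero, hxa', hδ, ← h0]
    simp [this]
  rw [← hδ] at h0
  -- The point at distance R from a on the normal ray is at distance at least R from b. Expanding
  -- the square gives the inequality with R, and R increases to r.
  have key : ∀ R, δ < R → R < r → 2 * R * inner ℝ (b - a) (x - a) ≤ ‖x - a‖ * ‖b - a‖ ^ 2 := by
    intro R h1 h2
    have := hr.infDist_ray hS ha hxa h0 (h := R - δ) (by linarith) (by linarith)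
    rw [← hδ] at this
    have hle := Metric.infDist_le_dist_of_mem (x := x + ((R - δ) / δ) • (x - a)) hb
    have e : x + ((R - δ) / δ) • (x - a) = a + (R / δ) • (x - a) := by
      have : (R - δ) / δ = R / δ - 1 := by field_simp
      rw [this, sub_smul, one_smul]; abel
    rw [e, dist_eq_norm] at hle
    have h3 : R ≤ ‖(R / δ) • (x - a) - (b - a)‖ := by
      have e' : (R / δ) • (x - a) - (b - a) = a + (R / δ) • (x - a) - b := by abel
      rw [e']; rw [e] at this; linarith
    have hR0 : 0 < R := h0.trans h1
    have h4 : R ^ 2 ≤ ‖(R / δ) • (x - a) - (b - a)‖ ^ 2 := by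
      gcongr
    rw [norm_sub_sq_real, norm_smul, hxa', Real.norm_of_nonneg (by positivity),
      real_inner_smul_left, real_inner_comm] at h4
    have e1 : R / δ * δ = R := by field_simp
    rw [e1] at h4
    have h5 : 2 * (R / δ * inner ℝ (b - a) (x - a)) ≤ ‖b - a‖ ^ 2 := by linarith
    rw [hxa']
    calc 2 * R * inner ℝ (b - a) (x - a)
        = δ * (2 * (R / δ * inner ℝ (b - a) (x - a))) := by field_simp
      _ ≤ _ := by gcongr
  have hlim : Tendsto (fun R : ℝ => 2 * R * inner ℝ (b - a) (x - a)) (𝓝[<] r)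
      (𝓝 (2 * r * inner ℝ (b - a) (x - a))) :=
    (Continuous.tendsto (by fun_prop) r).mono_left nhdsWithin_le_nhds
  refine le_of_tendsto hlim ?_
  filter_upwards [Ioo_mem_nhdsLT hxr] with R hR
  exact key R hR.1 hR.2

/-- The nearest-point projection is `2`-Lipschitz up to half the reach. -/
lemma UniqueNearest.dist_nearest_le {S : Set E} {r : ℝ} (hS : IsCompact S) (hr0 : 0 < r)
    (hr : UniqueNearest S r) {x y a b : E} (ha : a ∈ S) (hxa : dist x a = Metric.infDist x S)
    (hx : Metric.infDist x S ≤ r / 2) (hb : b ∈ S) (hyb : dist y b = Metric.infDist y S)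
    (hy : Metric.infDist y S ≤ r / 2) : ‖b - a‖ ≤ 2 * ‖y - x‖ := by
  -- Federer's inequality at a and at b. As both distances are at most r / 2, the two right-hand
  -- sides together absorb only half of the term 2r ‖b - a‖².
  have h1 := hr.inner_le hS ha hxa (by linarith) hb
  have h2 := hr.inner_le hS hb hyb (by linarith) ha
  have e1 : ‖x - a‖ ≤ r / 2 := by rw [← dist_eq_norm, hxa]; exact hx
  have e2 : ‖y - b‖ ≤ r / 2 := by rw [← dist_eq_norm, hyb]; exact hy
  have e3 : ‖a - b‖ = ‖b - a‖ := norm_sub_rev _ _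
  have e4 : inner ℝ (a - b) (y - b) = - inner ℝ (b - a) (y - b) := by
    rw [← inner_neg_left]; congr 1; abel
  have e5 : inner ℝ (b - a) (y - b)
      = inner ℝ (b - a) (y - x) + inner ℝ (b - a) (x - a) - ‖b - a‖ ^ 2 := by
    rw [← real_inner_self_eq_norm_sq, ← inner_add_right, ← inner_sub_right]; congr 1; abel
  have e6 := real_inner_le_norm (b - a) (y - x)
  rw [e3, e4, e5] at h2
  have h3 : ‖x - a‖ * ‖b - a‖ ^ 2 ≤ r / 2 * ‖b - a‖ ^ 2 := by gcongr
  have h4 : ‖y - b‖ * ‖b - a‖ ^ 2 ≤ r / 2 * ‖b - a‖ ^ 2 := by gcongr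
  have h5 : r * ‖b - a‖ ^ 2 ≤ r * (2 * (‖b - a‖ * ‖y - x‖)) := by nlinarith
  have h6 : ‖b - a‖ ^ 2 ≤ 2 * (‖b - a‖ * ‖y - x‖) := le_of_mul_le_mul_left h5 hr0
  by_contra! hlt
  nlinarith [norm_nonneg (b - a), norm_nonneg (y - x)]

end Reach
end HOSC
end

noncomputable section
namespace HOSC

/-! ### Tangent fields: estimates depending on the curvature bound only. -/

section Tangent

variable {E : Type*} [NormedAddCommGroup E] [InnerProductSpace ℝ E]

/-- From every point of `S`, every tangential step of length at most `h` stays within `e * h`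
of `S`. -/
def StepApprox (S : Set E) (T : E → Submodule ℝ E) (h e : ℝ) : Prop :=
  ∀ a ∈ S, ∀ v ∈ T a, ‖v‖ ≤ 1 → ∃ b ∈ S, ‖b - a - h • v‖ ≤ e * h

/-- `T` is a field of tangent spaces of `S`, whose normals satisfy Federer's inequality with
curvature bound `κ`. -/
structure TangentField (S : Set E) (κ : ℝ) (T : E → Submodule ℝ E) : Prop where
  inner_normal_le : ∀ a ∈ S, ∀ b ∈ S, ∀ n ∈ (T a)ᗮ,
    inner ℝ (b - a) n ≤ κ / 2 * ‖b - a‖ ^ 2 * ‖n‖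
  exists_step : ∀ θ > 0, ∃ h₀ > 0, ∀ h, 0 < h → h ≤ h₀ → StepApprox S T h θ

variable {S : Set E} {κ : ℝ} {T : E → Submodule ℝ E}

/-- A vector satisfying Federer's inequality that is shorter than the reach has its base point as
nearest point. -/
lemma infDist_add_eq_norm {a n : E} (ha : a ∈ S)
    (hn : ∀ b ∈ S, inner ℝ (b - a) n ≤ κ / 2 * ‖b - a‖ ^ 2 * ‖n‖) (hκn : κ * ‖n‖ ≤ 1) :
    Metric.infDist (a + n) S = ‖n‖ := by
  refine le_antisymm ?_ ?_
  · have := Metric.infDist_le_dist_of_mem (x := a + n) ha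
    simpa [dist_eq_norm] using this
  · refine (Metric.le_infDist ⟨a, ha⟩).2 fun b hb => ?_
    rw [dist_eq_norm]
    have h1 := hn b hb
    have h2 : ‖a + n - b‖ ^ 2 = ‖n‖ ^ 2 - 2 * inner ℝ (b - a) n + ‖b - a‖ ^ 2 := by
      rw [real_inner_comm, ← norm_sub_sq_real]; congr 2; abel
    have h3 : ‖n‖ ^ 2 ≤ ‖a + n - b‖ ^ 2 := by
      nlinarith [sq_nonneg ‖b - a‖]
    exact le_of_sq_le_sq h3 (norm_nonneg _)

variable [FiniteDimensional ℝ E]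

lemma norm_sub_starProjection_le_of_inner_le {U : Submodule ℝ E} {x : E} {c : ℝ} (hc : 0 ≤ c)
    (h : ∀ n ∈ Uᗮ, inner ℝ x n ≤ c * ‖n‖) : ‖x - U.starProjection x‖ ≤ c := by
  set n := x - U.starProjection x with hn
  have hmem : n ∈ Uᗮ := U.sub_starProjection_mem_orthogonal x
  have h1 := h n hmem
  have h2 : inner ℝ x n = ‖n‖ ^ 2 := by
    have : x = n + U.starProjection x := by rw [hn]; abel
    conv_lhs => rw [this]
    rw [inner_add_left, real_inner_self_eq_norm_sq,
      Submodule.inner_right_of_mem_orthogonal (U.starProjection_apply_mem x) hmem, add_zero]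
  rw [h2] at h1
  by_contra! hlt
  nlinarith

lemma TangentField.norm_sub_proj_le (hT : TangentField S κ T) (hκ : 0 ≤ κ) {a b : E}
    (ha : a ∈ S) (hb : b ∈ S) :
    ‖b - a - (T a).starProjection (b - a)‖ ≤ κ / 2 * ‖b - a‖ ^ 2 :=
  norm_sub_starProjection_le_of_inner_le (by positivity) (hT.inner_normal_le a ha b hb)

lemma inner_eq_inner_starProjection {U : Submodule ℝ E} {w : E} (hw : w ∈ U) (n : E) :
    inner ℝ w n = inner ℝ w (U.starProjection n) := by
  have h := Submodule.inner_right_of_mem_orthogonal hw (U.sub_starProjection_mem_orthogonal n)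
  rw [inner_sub_right] at h
  linarith

/-- Normals at `b` are almost normal at nearby points `a`. -/
lemma TangentField.norm_proj_normal_le (hT : TangentField S κ T) (hκ : 0 ≤ κ) {h e : ℝ}
    (hh : 0 < h) (he : e ≤ 1 / 2) (hstep : StepApprox S T h e) {a b : E} (ha : a ∈ S)
    (hb : b ∈ S) (hab : ‖a - b‖ ≤ 2 * h) {n : E} (hn : n ∈ (T b)ᗮ) :
    ‖(T a).starProjection n‖ ≤ 20 * κ * h * ‖n‖ := by
  set P := (T a).starProjection with hP
  rcases (norm_nonneg (P n)).eq_or_lt with h0 | h0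
  · rw [← h0]; positivity
  set M := ‖P n‖ with hM
  set v : E := (1 / M) • P n with hv
  have hvT : v ∈ T a := (T a).smul_mem _ ((T a).starProjection_apply_mem n)
  have hv1 : ‖v‖ = 1 := by
    rw [hv, norm_smul, Real.norm_of_nonneg (by positivity), ← hM]
    field_simp
  -- Stepping along v, the direction of P n, reaches c in S with ⟨c - a, n⟩ ≈ h ‖P n‖. Federer's
  -- inequality at b, applied to both a and c, makes this O(κ h² ‖n‖). The quadratic errors sum to
  -- 9.25 κ h² ‖n‖ against h ‖P n‖ / 2, hence the constant 20.
  obtain ⟨c, hc, hcv⟩ := hstep a ha v hvT hv1.le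
  have hhv : ‖h • v‖ = h := by rw [norm_smul, hv1, Real.norm_of_nonneg hh.le, mul_one]
  have hca : ‖c - a‖ ≤ 3 / 2 * h := by
    have : c - a = (c - a - h • v) + h • v := by abel
    rw [this]
    refine (norm_add_le _ _).trans ?_
    rw [hhv]; nlinarith
  have hcb : ‖c - b‖ ≤ 7 / 2 * h := by
    have : c - b = (c - a) + (a - b) := by abel
    rw [this]
    refine (norm_add_le _ _).trans ?_
    linarith
  have i1 : inner ℝ (c - b) n ≤ κ / 2 * (7 / 2 * h) ^ 2 * ‖n‖ :=
    (hT.inner_normal_le b hb c hc n hn).trans (by gcongr)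
  have i2 : inner ℝ (a - b) (-n) ≤ κ / 2 * (2 * h) ^ 2 * ‖n‖ := by
    refine (hT.inner_normal_le b hb a ha (-n) ((T b)ᗮ.neg_mem hn)).trans ?_
    rw [norm_neg]; gcongr
  have i3 : ‖c - a - P (c - a)‖ ≤ κ / 2 * (3 / 2 * h) ^ 2 :=
    (hT.norm_sub_proj_le hκ ha hc).trans (by gcongr)
  have i4 : inner ℝ (P (c - a)) n ≤ inner ℝ (c - a) n + κ / 2 * (3 / 2 * h) ^ 2 * ‖n‖ := by
    have e1 : inner ℝ (P (c - a)) n = inner ℝ (c - a) n - inner ℝ (c - a - P (c - a)) n := by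
      rw [← inner_sub_left]; congr 1; abel
    have e2 := abs_real_inner_le_norm (c - a - P (c - a)) n
    have e3 : ‖c - a - P (c - a)‖ * ‖n‖ ≤ κ / 2 * (3 / 2 * h) ^ 2 * ‖n‖ := by gcongr
    have e4 := neg_abs_le (inner ℝ (c - a - P (c - a)) n)
    linarith
  have i5 : inner ℝ (c - a) n = inner ℝ (c - b) n + inner ℝ (a - b) (-n) := by
    rw [inner_neg_right, ← sub_eq_add_neg, ← inner_sub_left]; congr 1; abel
  have i6 : inner ℝ (P (c - a)) n = inner ℝ (P (c - a)) (P n) :=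
    inner_eq_inner_starProjection ((T a).starProjection_apply_mem _) n
  have i7 : inner ℝ (h • v) (P n) = h * M := by
    rw [hv, smul_smul, real_inner_smul_left, real_inner_self_eq_norm_sq, ← hM]
    field_simp
  have i8 : ‖P (c - a) - h • v‖ ≤ e * h := by
    have : P (c - a) - h • v = P (c - a - h • v) := by
      rw [map_sub P (c - a), (T a).starProjection_eq_self_iff.2 ((T a).smul_mem h hvT)]
    rw [this]
    exact ((T a).norm_starProjection_apply_le _).trans hcv
  have i9 : h * M - e * h * M ≤ inner ℝ (P (c - a)) (P n) := by
    have e1 : inner ℝ (P (c - a)) (P n) = h * M + inner ℝ (P (c - a) - h • v) (P n) := by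
      rw [← i7, ← inner_add_left]; congr 1; abel
    have e2 := neg_abs_le (inner ℝ (P (c - a) - h • v) (P n))
    have e3 := abs_real_inner_le_norm (P (c - a) - h • v) (P n)
    have e4 : ‖P (c - a) - h • v‖ * ‖P n‖ ≤ e * h * M := by gcongr
    linarith
  have i10 : e * h * M ≤ 1 / 2 * h * M := by gcongr
  have i11 : h * M ≤ h * (20 * κ * h * ‖n‖) := by
    have : 0 ≤ κ * h ^ 2 * ‖n‖ := by positivity
    nlinarith
  exact le_of_mul_le_mul_left i11 hh

/-- The dual of `norm_proj_normal_le`: for v tangent at a and n normal at b, ⟨v, n⟩ sees only the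
projection of n to the tangent space at a. -/
lemma TangentField.norm_sub_proj_tangent_le (hT : TangentField S κ T) (hκ : 0 ≤ κ) {h e : ℝ}
    (hh : 0 < h) (he : e ≤ 1 / 2) (hstep : StepApprox S T h e) {a b : E} (ha : a ∈ S)
    (hb : b ∈ S) (hab : ‖a - b‖ ≤ 2 * h) {v : E} (hv : v ∈ T a) (hv1 : ‖v‖ ≤ 1) :
    ‖v - (T b).starProjection v‖ ≤ 20 * κ * h := by
  refine norm_sub_starProjection_le_of_inner_le (by positivity) fun n hn => ?_
  rw [inner_eq_inner_starProjection hv n]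
  refine (real_inner_le_norm _ _).trans ?_
  have := hT.norm_proj_normal_le hκ hh he hstep ha hb hab hn
  nlinarith [norm_nonneg ((T a).starProjection n)]

/-- Take two steps of length h, the second along the projection of v to the tangent space at the
first landing point. That projection moves v by at most 20 κ h, which relative to 2h adds 10 κ h to
the error. -/
lemma TangentField.stepApprox_two_mul (hT : TangentField S κ T) (hκ : 0 ≤ κ) {h e : ℝ}
    (hh : 0 < h) (he : e ≤ 1 / 2) (hstep : StepApprox S T h e) :
    StepApprox S T (2 * h) (e + 10 * κ * h) := by
  intro a ha v hv hv1
  obtain ⟨b, hb, hbv⟩ := hstep a ha v hv hv1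
  have hhv : ‖h • v‖ ≤ h := by
    rw [norm_smul, Real.norm_of_nonneg hh.le]; nlinarith
  have hba : ‖a - b‖ ≤ 2 * h := by
    have : a - b = -((b - a - h • v) + h • v) := by abel
    rw [this, norm_neg]
    refine (norm_add_le _ _).trans ?_
    nlinarith
  have hw := hT.norm_sub_proj_tangent_le hκ hh he hstep ha hb hba hv hv1
  set w := (T b).starProjection v with hwdef
  obtain ⟨c, hc, hcw⟩ := hstep b hb w ((T b).starProjection_apply_mem v)
    (((T b).norm_starProjection_apply_le v).trans hv1)
  refine ⟨c, hc, ?_⟩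
  have e1 : c - a - (2 * h) • v = (c - b - h • w) + (b - a - h • v) - h • (v - w) := by
    rw [smul_sub, mul_smul, two_smul]; abel
  rw [e1]
  refine (norm_sub_le _ _).trans ?_
  have e2 : ‖h • (v - w)‖ ≤ h * (20 * κ * h) := by
    rw [norm_smul, Real.norm_of_nonneg hh.le]; gcongr
  have e3 := norm_add_le (c - b - h • w) (b - a - h • v)
  nlinarith

/-- The errors of successive doublings form a geometric series, dominated by the last scale; k does
not enter the bound otherwise. -/
lemma TangentField.stepApprox_pow (hT : TangentField S κ T) (hκ : 0 ≤ κ) {h θ : ℝ} (k : ℕ)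
    (hh : 0 < h) (hb : θ + 10 * κ * (2 ^ k * h) ≤ 1 / 2) (hstep : StepApprox S T h θ) :
    StepApprox S T (2 ^ k * h) (θ + 10 * κ * (2 ^ k * h)) := by
  induction k with
  | zero =>
    intro a ha v hv hv1
    obtain ⟨b, hb, h1⟩ := hstep a ha v hv hv1
    refine ⟨b, hb, ?_⟩
    simp only [pow_zero, one_mul]
    have : 0 ≤ 10 * κ * h * h := by positivity
    nlinarith
  | succ k ih =>
    have hpos : 0 ≤ κ * (2 ^ k * h) := by positivity
    have hb' : θ + 10 * κ * (2 ^ k * h) ≤ 1 / 2 := by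
      rw [pow_succ] at hb; nlinarith
    have := hT.stepApprox_two_mul hκ (by positivity) hb' (ih hb')
    have e1 : 2 * (2 ^ k * h) = 2 ^ (k + 1) * h := by ring
    have e2 : θ + 10 * κ * (2 ^ k * h) + 10 * κ * (2 ^ k * h)
        = θ + 10 * κ * (2 ^ (k + 1) * h) := by ring
    rwa [e1, e2] at this

/-- The tangential step property holds up to a scale that depends only on the curvature bound. -/
lemma TangentField.stepApprox (hT : TangentField S κ T) (hκ : 0 < κ) {h : ℝ} (hh : 0 < h)
    (hκh : 40 * κ * h ≤ 1) : StepApprox S T h (20 * κ * h) := by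
  -- The threshold h₀ depends on the surface. Doubling up from h / 2 ^ k ≤ h₀ to h costs 10 κ h on
  -- top of the initial 10 κ h, and h₀ disappears from the conclusion.
  obtain ⟨h₀, hh₀, hst⟩ := hT.exists_step (10 * κ * h) (by positivity)
  obtain ⟨k, hk⟩ := pow_unbounded_of_one_lt (h / h₀) (one_lt_two : (1 : ℝ) < 2)
  have hle : h / 2 ^ k ≤ h₀ := by
    rw [div_lt_iff₀ hh₀] at hk
    rw [div_le_iff₀ (by positivity)]; linarith
  have e1 : 2 ^ k * (h / 2 ^ k) = h := by field_simp
  have := hT.stepApprox_pow hκ.le k (by positivity) (by rw [e1]; linarith)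
    (hst (h / 2 ^ k) (by positivity) hle)
  rw [e1] at this
  have e2 : 10 * κ * h + 10 * κ * h = 20 * κ * h := by ring
  rwa [e2] at this

/-- `S` follows its tangent spaces to second order. -/
lemma TangentField.exists_near (hT : TangentField S κ T) (hκ : 0 < κ) {a t : E} (ha : a ∈ S)
    (ht : t ∈ T a) (hκt : 40 * κ * ‖t‖ ≤ 1) : ∃ b ∈ S, ‖b - a - t‖ ≤ 20 * κ * ‖t‖ ^ 2 := by
  rcases (norm_nonneg t).eq_or_lt with h0 | h0
  · have : t = 0 := norm_eq_zero.1 h0.symm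
    exact ⟨a, ha, by simp [this]⟩
  · obtain ⟨b, hb, h1⟩ := hT.stepApprox hκ h0 hκt a ha ((1 / ‖t‖) • t) ((T a).smul_mem _ ht)
      (by rw [norm_smul, Real.norm_of_nonneg (by positivity)]; field_simp; exact le_rfl)
    refine ⟨b, hb, ?_⟩
    have e1 : ‖t‖ • (1 / ‖t‖) • t = t := by rw [smul_smul]; field_simp; simp
    rw [e1] at h1
    linarith [h1]

lemma TangentField.norm_proj_normal_le' (hT : TangentField S κ T) (hκ : 0 < κ) {a b n : E}
    {h : ℝ} (hh : 0 < h) (hκh : 40 * κ * h ≤ 1) (ha : a ∈ S) (hb : b ∈ S) (hab : ‖a - b‖ ≤ h)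
    (hn : n ∈ (T b)ᗮ) : ‖(T a).starProjection n‖ ≤ 20 * κ * h * ‖n‖ :=
  hT.norm_proj_normal_le hκ.le hh (by linarith) (hT.stepApprox hκ hh hκh) ha hb (by linarith) hn

/-- Vectors pointing from a nearest point are normal. -/
lemma TangentField.sub_nearest_mem_orthogonal (hT : TangentField S κ T) (hκ : 0 < κ) {r : ℝ}
    (hS : IsCompact S) (hr0 : 0 < r) (hr : UniqueNearest S r) {x a : E} (ha : a ∈ S)
    (hxa : dist x a = Metric.infDist x S) (hxr : Metric.infDist x S < r) : x - a ∈ (T a)ᗮ := by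
  rw [Submodule.mem_orthogonal]
  suffices h : ∀ v ∈ T a, inner ℝ v (x - a) ≤ 0 by
    intro v hv
    refine le_antisymm (h v hv) ?_
    have := h (-v) ((T a).neg_mem hv)
    rw [inner_neg_left] at this
    linarith
  intro v hv
  -- Federer's inequality at a point of S within O(h²) of a + h v, divided by h; then h tends to 0.
  have key : ∀ h : ℝ, 0 < h → 40 * κ * (h * ‖v‖) ≤ 1 → inner ℝ v (x - a)
      ≤ h * (20 * κ * ‖v‖ ^ 2 * ‖x - a‖ + 2 / r * ‖x - a‖ * ‖v‖ ^ 2) := by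
    intro h hh hsm
    have hhv : ‖h • v‖ = h * ‖v‖ := by rw [norm_smul, Real.norm_of_nonneg hh.le]
    obtain ⟨b, hb, h1⟩ := hT.exists_near hκ ha ((T a).smul_mem h hv) (by rw [hhv]; exact hsm)
    rw [hhv] at h1
    have h2 : ‖b - a‖ ≤ 2 * (h * ‖v‖) := by
      have : b - a = (b - a - h • v) + h • v := by abel
      rw [this]
      refine (norm_add_le _ _).trans ?_
      rw [hhv]
      have : 0 ≤ h * ‖v‖ := by positivity
      nlinarith
    have h3 := hr.inner_le hS ha hxa hxr hb
    have h4 : ‖x - a‖ * ‖b - a‖ ^ 2 ≤ ‖x - a‖ * (2 * (h * ‖v‖)) ^ 2 := by gcongr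
    have h5 : inner ℝ (b - a) (x - a) ≤ 1 / (2 * r) * (‖x - a‖ * (2 * (h * ‖v‖)) ^ 2) := by
      rw [div_mul_eq_mul_div, one_mul, le_div_iff₀ (by positivity)]; linarith
    have h6 : h * inner ℝ v (x - a)
        = inner ℝ (b - a) (x - a) - inner ℝ (b - a - h • v) (x - a) := by
      rw [← inner_sub_left, ← real_inner_smul_left]; congr 1; abel
    have h7 := neg_abs_le (inner ℝ (b - a - h • v) (x - a))
    have h8 := abs_real_inner_le_norm (b - a - h • v) (x - a)
    have h9 : ‖b - a - h • v‖ * ‖x - a‖ ≤ 20 * κ * (h * ‖v‖) ^ 2 * ‖x - a‖ := by gcongr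
    have h10 : h * inner ℝ v (x - a) ≤ h * (h * (20 * κ * ‖v‖ ^ 2 * ‖x - a‖
        + 2 / r * ‖x - a‖ * ‖v‖ ^ 2)) := by
      have : 1 / (2 * r) * (‖x - a‖ * (2 * (h * ‖v‖)) ^ 2)
        = h * (h * (2 / r * ‖x - a‖ * ‖v‖ ^ 2)) := by field_simp
      nlinarith
    exact le_of_mul_le_mul_left h10 hh
  set C := 20 * κ * ‖v‖ ^ 2 * ‖x - a‖ + 2 / r * ‖x - a‖ * ‖v‖ ^ 2 with hC
  have hlim : Tendsto (fun h : ℝ => h * C) (𝓝[>] 0) (𝓝 0) := by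
    have : Tendsto (fun h : ℝ => h * C) (𝓝 0) (𝓝 (0 * C)) := by
      exact Continuous.tendsto (by fun_prop) 0
    rw [zero_mul] at this
    exact this.mono_left nhdsWithin_le_nhds
  have hlim2 : Tendsto (fun h : ℝ => 40 * κ * (h * ‖v‖)) (𝓝[>] 0) (𝓝 0) := by
    have : Tendsto (fun h : ℝ => 40 * κ * (h * ‖v‖)) (𝓝 0) (𝓝 (40 * κ * (0 * ‖v‖))) :=
      Continuous.tendsto (by fun_prop) 0
    rw [zero_mul, mul_zero] at this
    exact this.mono_left nhdsWithin_le_nhds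
  refine ge_of_tendsto hlim ?_
  filter_upwards [self_mem_nhdsWithin, hlim2.eventually (gt_mem_nhds one_pos)] with h hh hsm
  exact key h hh hsm.le

end Tangent
end HOSC
end

noncomputable section
namespace HOSC

/-! ### Second-order tangency from a straightening chart. -/

section Chart

/-- Uniform second-order Taylor expansion near a point. -/
lemma _root_.ContDiffAt.exists_taylor_two {F G : Type*} [NormedAddCommGroup F] [NormedSpace ℝ F]
    [NormedAddCommGroup G] [NormedSpace ℝ G] {f : F → G} {z₀ : F} (hf : ContDiffAt ℝ 2 f z₀) :
    ∃ ρ > 0, ∃ K : ℝ, 0 ≤ K ∧ ∀ z ∈ Metric.ball z₀ ρ, ∀ z' ∈ Metric.ball z₀ ρ,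
      ‖f z' - f z - fderiv ℝ f z (z' - z)‖ ≤ K * ‖z' - z‖ ^ 2 := by
  have h1 : ContDiffAt ℝ 1 (fderiv ℝ f) z₀ := hf.fderiv_right (by norm_num)
  obtain ⟨K, t, ht, hK⟩ := h1.exists_lipschitzOnWith
  have h2 : ∀ᶠ z in 𝓝 z₀, DifferentiableAt ℝ f z := by
    filter_upwards [hf.eventually (by simp)] with z hz
    exact hz.differentiableAt (by norm_num)
  obtain ⟨ρ, hρ, hball⟩ := Metric.eventually_nhds_iff_ball.1 (h2.and ht)
  refine ⟨ρ, hρ, K, K.2, fun z hz z' hz' => ?_⟩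
  have hseg : segment ℝ z z' ⊆ Metric.ball z₀ ρ := (convex_ball z₀ ρ).segment_subset hz hz'
  have := (convex_segment z z').norm_image_sub_le_of_norm_fderiv_le' (f := f)
    (φ := fderiv ℝ f z) (C := K * ‖z' - z‖) (fun w hw => (hball w (hseg hw)).1)
    (fun w hw => by
      have e1 := hK.dist_le_mul w (hball w (hseg hw)).2 z (hball z hz).2
      rw [dist_eq_norm, dist_eq_norm] at e1
      refine e1.trans ?_
      gcongr
      obtain ⟨c, hc, rfl⟩ := (segment_eq_image' ℝ z z' ▸ hw : w ∈ _)
      simp only [add_sub_cancel_left, norm_smul, Real.norm_of_nonneg hc.1]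
      exact mul_le_of_le_one_left (norm_nonneg _) hc.2)
    (left_mem_segment ℝ z z') (right_mem_segment ℝ z z')
  calc _ ≤ K * ‖z' - z‖ * ‖z' - z‖ := this
    _ = _ := by ring

/-- The subspace is the image of ℝ^d × 0 under the derivative of the inverse chart. Both estimates
are its second-order Taylor expansion: moving within ℝ^d × 0 stays in S, and two points of S differ
in the chart by a vector of ℝ^d × 0, whose linear image is orthogonal to n. The constants depend on
the chart. -/
lemma IsC2Submanifold.exists_local_tangent {D d : ℕ} {S : Set (Amb D)}
    (h : IsC2Submanifold d S) {p : Amb D} (hp : p ∈ S) :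
    ∃ r > 0, ∃ C : ℝ, 0 ≤ C ∧ ∀ b ∈ S, dist b p < r → ∃ U : Submodule ℝ (Amb D),
      Module.finrank ℝ U = d ∧
      (∀ v ∈ U, ‖v‖ ≤ 1 → ∀ t, 0 ≤ t → t ≤ r → ∃ s ∈ S, ‖s - b - t • v‖ ≤ C * t ^ 2) ∧
      ∀ c ∈ S, dist c p < r → ∀ n ∈ Uᗮ, inner ℝ (c - b) n ≤ C * ‖c - b‖ ^ 2 * ‖n‖ := by
  obtain ⟨Φ, hpΦ, hΦ, hψ, hmem⟩ := h p hp
  set z₀ := Φ p with hz₀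
  have hz₀t : z₀ ∈ Φ.target := Φ.map_source hpΦ
  have hψ0 : ContDiffAt ℝ 2 Φ.symm z₀ := hψ.contDiffAt (Φ.open_target.mem_nhds hz₀t)
  have hΦ0 : ContDiffAt ℝ 2 Φ p := hΦ.contDiffAt (Φ.open_source.mem_nhds hpΦ)
  obtain ⟨ρ₁, hρ₁, K, hK0, hK⟩ := hψ0.exists_taylor_two
  obtain ⟨L, s, hs, hL⟩ := (hΦ0.of_le (by norm_num : (1 : WithTop ℕ∞) ≤ 2)).exists_lipschitzOnWith
  have hψp : Φ.symm z₀ = p := Φ.left_inv hpΦ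
  have htend : Tendsto Φ.symm (𝓝 z₀) (𝓝 p) := by
    have := hψ0.continuousAt.tendsto
    rwa [hψp] at this
  have hs' : ∀ᶠ x in 𝓝 p, s ∈ 𝓝 x := eventually_mem_nhds_iff.2 hs
  -- near `z₀`, the derivative of the inverse chart is bounded below
  have hev : ∀ᶠ z in 𝓝 z₀, z ∈ Φ.target ∧ ∀ w, ‖w‖ ≤ L * ‖fderiv ℝ Φ.symm z w‖ := by
    filter_upwards [Φ.open_target.mem_nhds hz₀t, htend.eventually hs'] with z hz hzs
    refine ⟨hz, fun w => ?_⟩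
    have d1 : DifferentiableAt ℝ Φ.symm z :=
      (hψ.contDiffAt (Φ.open_target.mem_nhds hz)).differentiableAt (by norm_num)
    have d2 : DifferentiableAt ℝ Φ (Φ.symm z) :=
      (hΦ.contDiffAt (Φ.open_source.mem_nhds (Φ.map_target hz))).differentiableAt (by norm_num)
    have d3 : HasFDerivAt (Φ ∘ Φ.symm) ((fderiv ℝ Φ (Φ.symm z)).comp (fderiv ℝ Φ.symm z)) z :=
      d2.hasFDerivAt.comp z d1.hasFDerivAt
    have d4 : HasFDerivAt (Φ ∘ Φ.symm) (ContinuousLinearMap.id ℝ _) z := by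
      refine (hasFDerivAt_id z).congr_of_eventuallyEq ?_
      filter_upwards [Φ.open_target.mem_nhds hz] with y hy
      exact Φ.right_inv hy
    have d5 := DFunLike.congr_fun (d3.unique d4) w
    simp only [ContinuousLinearMap.comp_apply, ContinuousLinearMap.id_apply] at d5
    have d6 : ‖fderiv ℝ Φ (Φ.symm z)‖ ≤ L := norm_fderiv_le_of_lipschitzOn ℝ hzs hL
    calc ‖w‖ = ‖fderiv ℝ Φ (Φ.symm z) (fderiv ℝ Φ.symm z w)‖ := by rw [d5]
      _ ≤ ‖fderiv ℝ Φ (Φ.symm z)‖ * ‖fderiv ℝ Φ.symm z w‖ := ContinuousLinearMap.le_opNorm _ _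
      _ ≤ _ := by gcongr
  obtain ⟨ρ₂, hρ₂, hball⟩ := Metric.eventually_nhds_iff_ball.1 hev
  set ρ := min ρ₁ ρ₂ with hρ
  have hρ0 : 0 < ρ := lt_min hρ₁ hρ₂
  have hev2 : ∀ᶠ x in 𝓝 p, x ∈ Φ.source ∧ x ∈ s ∧ Φ x ∈ Metric.ball z₀ (ρ / 2) := by
    filter_upwards [Φ.open_source.mem_nhds hpΦ, hs,
      hΦ0.continuousAt.tendsto.eventually (Metric.ball_mem_nhds z₀ (half_pos hρ0))] with x h1 h2 h3
    exact ⟨h1, h2, h3⟩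
  obtain ⟨r₁, hr₁, hx⟩ := Metric.eventually_nhds_iff_ball.1 hev2
  -- A tangential step of length at most r has chart length at most r L ≤ ρ / 2, so it stays in the
  -- Taylor ball.
  set r := min r₁ (ρ / (2 * (L + 1))) with hr
  have hr0 : 0 < r := by positivity
  refine ⟨r, hr0, K * L ^ 2, by positivity, fun b hb hbr => ?_⟩
  obtain ⟨hbs, hbL, hbz⟩ := hx b (lt_of_lt_of_le hbr (min_le_left _ _))
  set z := Φ b with hz
  have hz2 : z.2 = 0 := (hmem b hbs).1 hb
  have hψz : Φ.symm z = b := Φ.left_inv hbs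
  have hzρ : z ∈ Metric.ball z₀ ρ := Metric.ball_subset_ball (by linarith) hbz
  have hz1 : z ∈ Metric.ball z₀ ρ₁ := Metric.ball_subset_ball (min_le_left _ _) hzρ
  have hz2' : z ∈ Metric.ball z₀ ρ₂ := Metric.ball_subset_ball (min_le_right _ _) hzρ
  set A : Amb d →ₗ[ℝ] Amb D :=
    (fderiv ℝ Φ.symm z).toLinearMap.comp (LinearMap.inl ℝ (Amb d) (Amb (D - d))) with hA
  have hAapp : ∀ w, A w = fderiv ℝ Φ.symm z (w, 0) := fun w => rfl
  have hAinj : Function.Injective A := by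
    rw [injective_iff_map_eq_zero]
    intro w hw
    have := (hball z hz2').2 (w, 0)
    rw [← hAapp, hw, norm_zero, mul_zero] at this
    have h0 := norm_le_zero_iff.1 this
    exact congrArg Prod.fst h0
  refine ⟨LinearMap.range A, ?_, ?_, ?_⟩
  · rw [LinearMap.finrank_range_of_inj hAinj]; simp
  · rintro _ ⟨w, rfl⟩ hv t ht0 htr
    have hw : ‖((w, 0) : Amb d × Amb (D - d))‖ ≤ L := by
      refine ((hball z hz2').2 (w, 0)).trans ?_
      rw [← hAapp]
      exact mul_le_of_le_one_right L.2 hv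
    set z' := z + t • ((w, 0) : Amb d × Amb (D - d)) with hz'
    have hzz : z' - z = t • ((w, 0) : Amb d × Amb (D - d)) := by rw [hz']; abel
    have hn : ‖z' - z‖ ≤ t * L := by
      rw [hzz, norm_smul, Real.norm_of_nonneg ht0]; gcongr
    have hz'ρ : z' ∈ Metric.ball z₀ ρ := by
      rw [Metric.mem_ball] at hbz ⊢
      have h1 := dist_triangle z' z z₀
      rw [dist_eq_norm z' z] at h1
      have h2 : t * L ≤ ρ / 2 := by
        have : t ≤ ρ / (2 * (L + 1)) := htr.trans (min_le_right _ _)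
        have hL0 : (0 : ℝ) ≤ L := L.2
        rw [le_div_iff₀ (by positivity)] at this
        nlinarith
      linarith
    have hz't := (hball z' (Metric.ball_subset_ball (min_le_right _ _) hz'ρ)).1
    refine ⟨Φ.symm z', ?_, ?_⟩
    · rw [hmem _ (Φ.map_target hz't), Φ.right_inv hz't]
      simp [hz', hz2]
    · have := hK z hz1 z' (Metric.ball_subset_ball (min_le_left _ _) hz'ρ)
      rw [hψz, hzz, map_smul, ← hAapp, ← hzz] at this
      refine this.trans ?_
      calc K * ‖z' - z‖ ^ 2 ≤ K * (t * L) ^ 2 := by gcongr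
        _ = _ := by ring
  · intro c hc hcr n hn
    obtain ⟨hcs, hcL, hcz⟩ := hx c (lt_of_lt_of_le hcr (min_le_left _ _))
    have hc2 : (Φ c).2 = 0 := (hmem c hcs).1 hc
    have hcρ : Φ c ∈ Metric.ball z₀ ρ := Metric.ball_subset_ball (by linarith) hcz
    have h1 := hK z hz1 (Φ c) (Metric.ball_subset_ball (min_le_left _ _) hcρ)
    rw [hψz, Φ.left_inv hcs] at h1
    have h2 : ‖Φ c - z‖ ≤ L * ‖c - b‖ := by
      have := hL.dist_le_mul c hcL b hbL
      rwa [dist_eq_norm, dist_eq_norm] at this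
    have h3 : Φ c - z = ((Φ c - z).1, 0) := by
      ext1
      · rfl
      · simp [hc2, hz2]
    have h4 : inner ℝ (fderiv ℝ Φ.symm z (Φ c - z)) n = 0 := by
      rw [h3, ← hAapp]
      exact Submodule.inner_right_of_mem_orthogonal (LinearMap.mem_range_self A _) hn
    calc inner ℝ (c - b) n = inner ℝ (c - b - fderiv ℝ Φ.symm z (Φ c - z)) n := by
          rw [inner_sub_left (c - b) _ n, h4, sub_zero]
      _ ≤ ‖c - b - fderiv ℝ Φ.symm z (Φ c - z)‖ * ‖n‖ := real_inner_le_norm _ _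
      _ ≤ K * (L * ‖c - b‖) ^ 2 * ‖n‖ := by
          gcongr
          exact h1.trans (by gcongr)
      _ = _ := by ring

end Chart
end HOSC
end

noncomputable section
namespace HOSC

/-! ### Surfaces of the class carry a tangent field with curvature bound κ. -/

section Surface

variable {D d : ℕ} {κ : ℝ} {S : Set (Amb D)}

lemma exists_uniqueNearest_of_lt_reach {t : ℝ} (h : ENNReal.ofReal t < reach S) :
    UniqueNearest S t := by
  unfold reach at h
  obtain ⟨r, hr⟩ := lt_iSup_iff.1 h
  obtain ⟨hr', hlt⟩ := lt_iSup_iff.1 hr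
  have htr : t < r := (ENNReal.ofReal_lt_ofReal_iff hr'.1).1 hlt
  exact fun x hx => hr'.2 x (hx.trans htr)

lemma IsSurface.uniqueNearest (h : IsSurface d κ S) (hκ : 0 < κ) : UniqueNearest S (1 / κ) := by
  intro x hx
  obtain ⟨t, ht, ht'⟩ := exists_between hx
  refine exists_uniqueNearest_of_lt_reach (t := t) (lt_of_lt_of_le ?_ h.le_reach) x ht
  exact (ENNReal.ofReal_lt_ofReal_iff (by positivity)).2 ht'

lemma norm_le_of_mem_unitCube {x : Amb D} (hx : x ∈ unitCube D) : ‖x‖ ≤ D := by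
  have h1 : ‖x‖ ^ 2 ≤ D := by
    rw [EuclideanSpace.norm_sq_eq]
    calc ∑ i, ‖x i‖ ^ 2 ≤ ∑ _i : Fin D, (1 : ℝ) := by
          refine Finset.sum_le_sum fun i _ => ?_
          rw [Real.norm_of_nonneg (hx i).1.le]
          exact pow_le_one₀ (hx i).1.le (hx i).2.le
      _ = D := by simp
  rcases Nat.eq_zero_or_pos D with h0 | h0
  · subst h0
    simp only [Nat.cast_zero] at h1 ⊢
    nlinarith [norm_nonneg x]
  · have : (1 : ℝ) ≤ D := by exact_mod_cast h0
    nlinarith [norm_nonneg x]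

/-- Closedness comes from the reach: a point of the closure is at distance 0 from S, hence has a
nearest point in S, which is itself. -/
lemma IsSurface.isCompact (h : IsSurface d κ S) (hκ : 0 < κ) : IsCompact S := by
  refine Metric.isCompact_of_isClosed_isBounded ?_ ?_
  · refine isClosed_of_closure_subset fun x hx => ?_
    have h0 : Metric.infDist x S = 0 :=
      (Metric.mem_closure_iff_infDist_zero h.connected.nonempty).1 hx
    obtain ⟨s, ⟨hs, hxs⟩, -⟩ := h.uniqueNearest hκ x (by rw [h0]; positivity)
    rw [h0, dist_eq_zero] at hxs
    rwa [hxs]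
  · refine (Metric.isBounded_closedBall (x := (0 : Amb D)) (r := D)).subset fun x hx => ?_
    simpa using norm_le_of_mem_unitCube (h.subset_cube hx)

/-- `U` is the tangent space of `S` at `a`, with Federer's inequality for its normals. -/
structure IsTangentSpace (d : ℕ) (κ : ℝ) (S : Set (Amb D)) (a : Amb D)
    (U : Submodule ℝ (Amb D)) : Prop where
  finrank_eq : Module.finrank ℝ U = d
  inner_normal_le : ∀ b ∈ S, ∀ n ∈ Uᗮ, inner ℝ (b - a) n ≤ κ / 2 * ‖b - a‖ ^ 2 * ‖n‖
  exists_step : ∃ r > 0, ∃ C, 0 ≤ C ∧ ∀ v ∈ U, ‖v‖ ≤ 1 → ∀ t, 0 ≤ t → t ≤ r →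
    ∃ s ∈ S, ‖s - a - t • v‖ ≤ C * t ^ 2

/-- Points of S reached along V satisfy the normal inequality of U, so ⟨v, n⟩ ≤ O(t) for every n
normal to U. This identifies a pointwise choice of tangent spaces with the locally uniform one
coming from charts. -/
lemma IsTangentSpace.le {a : Amb D} {U V : Submodule ℝ (Amb D)} (hκ : 0 ≤ κ)
    (hU : IsTangentSpace d κ S a U) (hV : IsTangentSpace d κ S a V) : V ≤ U := by
  suffices h : ∀ v ∈ V, ‖v‖ ≤ 1 → v ∈ U by
    intro v hv
    by_cases h0 : v = 0
    · rw [h0]; exact U.zero_mem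
    · have hn : 0 < ‖v‖ := norm_pos_iff.2 h0
      have := h ((1 / ‖v‖) • v) (V.smul_mem _ hv)
        (by rw [norm_smul, Real.norm_of_nonneg (by positivity)]; field_simp; exact le_rfl)
      have h2 := U.smul_mem ‖v‖ this
      rwa [smul_smul, mul_one_div_cancel hn.ne', one_smul] at h2
  intro v hv hv1
  obtain ⟨r, hr, C, hC, hstep⟩ := hV.exists_step
  rw [← Submodule.orthogonal_orthogonal U, Submodule.mem_orthogonal']
  suffices h : ∀ n ∈ Uᗮ, inner ℝ v n ≤ 0 by
    intro n hn
    refine le_antisymm (h n hn) ?_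
    have := h (-n) (Uᗮ.neg_mem hn)
    rw [inner_neg_right] at this
    linarith
  intro n hn
  have key : ∀ t, 0 < t → t ≤ r →
      inner ℝ v n ≤ t * (κ / 2 * (C * r + 1) ^ 2 * ‖n‖ + C * ‖n‖) := by
    intro t ht htr
    obtain ⟨s, hs, h1⟩ := hstep v hv hv1 t ht.le htr
    have h2 : ‖s - a‖ ≤ t * (C * r + 1) := by
      have : s - a = (s - a - t • v) + t • v := by abel
      rw [this]
      refine (norm_add_le _ _).trans ?_
      rw [norm_smul, Real.norm_of_nonneg ht.le]
      have e1 : t * ‖v‖ ≤ t := by nlinarith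
      have e2 : C * t ^ 2 ≤ C * (t * r) := by rw [sq]; gcongr
      linarith
    have h3 := hU.inner_normal_le s hs n hn
    have h4 : κ / 2 * ‖s - a‖ ^ 2 * ‖n‖ ≤ κ / 2 * (t * (C * r + 1)) ^ 2 * ‖n‖ := by gcongr
    have h5 : t * inner ℝ v n = inner ℝ (s - a) n - inner ℝ (s - a - t • v) n := by
      rw [← inner_sub_left, ← real_inner_smul_left]; congr 1; abel
    have h6 := neg_abs_le (inner ℝ (s - a - t • v) n)
    have h7 := abs_real_inner_le_norm (s - a - t • v) n
    have h8 : ‖s - a - t • v‖ * ‖n‖ ≤ C * t ^ 2 * ‖n‖ := by gcongr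
    have h9 : t * inner ℝ v n ≤ t * (t * (κ / 2 * (C * r + 1) ^ 2 * ‖n‖ + C * ‖n‖)) := by
      nlinarith
    exact le_of_mul_le_mul_left h9 ht
  set M := κ / 2 * (C * r + 1) ^ 2 * ‖n‖ + C * ‖n‖
  have hlim : Tendsto (fun t : ℝ => t * M) (𝓝[>] 0) (𝓝 0) := by
    have : Tendsto (fun t : ℝ => t * M) (𝓝 0) (𝓝 (0 * M)) :=
      Continuous.tendsto (by fun_prop) 0
    rw [zero_mul] at this
    exact this.mono_left nhdsWithin_le_nhds
  refine ge_of_tendsto hlim ?_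
  filter_upwards [Ioc_mem_nhdsGT hr] with t ht
  exact key t ht.1 ht.2

/-- With any constant in the normal inequality, b is the nearest point of b + σ n for small σ. Then
Federer's inequality applies at radius 1 / κ, and homogeneity in n removes σ: the reach replaces the
chart constant by κ / 2. -/
lemma IsSurface.exists_uniform_tangent (h : IsSurface d κ S) (hκ : 0 < κ) {p : Amb D}
    (hp : p ∈ S) : ∃ r > 0, ∃ C : ℝ, 0 ≤ C ∧ ∀ b ∈ S, dist b p < r →
      ∃ U, IsTangentSpace d κ S b U ∧ ∀ v ∈ U, ‖v‖ ≤ 1 → ∀ t, 0 ≤ t → t ≤ r →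
        ∃ s ∈ S, ‖s - b - t • v‖ ≤ C * t ^ 2 := by
  obtain ⟨r, hr, C, hC, hloc⟩ := h.submanifold.exists_local_tangent hp
  refine ⟨r / 2, by positivity, C, hC, fun b hb hbp => ?_⟩
  obtain ⟨U, hU, hstep, hnorm⟩ := hloc b hb (by linarith)
  refine ⟨U, ⟨hU, ?_, ⟨r, hr, C, hC, hstep⟩⟩, fun v hv hv1 t ht0 htr =>
    hstep v hv hv1 t ht0 (by linarith)⟩
  -- a crude bound with some constant, improved by the reach
  set M := 2 * (C + 2 / r) with hM
  have hM0 : 0 < M := by positivity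
  have hcrude : ∀ c ∈ S, ∀ n ∈ Uᗮ, inner ℝ (c - b) n ≤ M / 2 * ‖c - b‖ ^ 2 * ‖n‖ := by
    intro c hc n hn
    have hM2 : M / 2 = C + 2 / r := by rw [hM]; ring
    rw [hM2]
    have hnn : 0 ≤ ‖c - b‖ ^ 2 * ‖n‖ := by positivity
    rcases lt_or_ge (dist c p) r with hcr | hcr
    · refine (hnorm c hc hcr n hn).trans ?_
      gcongr
      have : 0 ≤ 2 / r := by positivity
      linarith
    · have h1 : r / 2 ≤ ‖c - b‖ := by
        rw [← dist_eq_norm]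
        have := dist_triangle c b p
        linarith
      refine (real_inner_le_norm _ _).trans ?_
      have h2 : ‖c - b‖ ≤ (2 / r) * ‖c - b‖ ^ 2 := by
        rw [div_mul_eq_mul_div, le_div_iff₀ hr]; nlinarith [norm_nonneg (c - b)]
      gcongr
      have : 0 ≤ C * ‖c - b‖ ^ 2 := by positivity
      linarith
  intro c hc n hn
  rcases (norm_nonneg n).eq_or_lt with h0 | h0
  · have : n = 0 := norm_eq_zero.1 h0.symm
    simp [this]
  -- The first bound is for `infDist_add_eq_norm` with constant M, the second keeps b + σ n within
  -- the reach.
  set σ := min (1 / (M * ‖n‖)) (1 / (2 * κ * ‖n‖)) with hσ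
  have hσ0 : 0 < σ := by positivity
  have hσn : ‖σ • n‖ = σ * ‖n‖ := by rw [norm_smul, Real.norm_of_nonneg hσ0.le]
  have e1 : Metric.infDist (b + σ • n) S = ‖σ • n‖ := by
    refine infDist_add_eq_norm (κ := M) hb (fun c hc => hcrude c hc _ (Uᗮ.smul_mem _ hn)) ?_
    rw [hσn]
    have : σ ≤ 1 / (M * ‖n‖) := min_le_left _ _
    rw [le_div_iff₀ (by positivity)] at this
    linarith
  have e2 : σ * ‖n‖ < 1 / κ := by
    have : σ ≤ 1 / (2 * κ * ‖n‖) := min_le_right _ _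
    rw [le_div_iff₀ (by positivity)] at this
    rw [lt_div_iff₀ hκ]; nlinarith
  have e3 := (h.uniqueNearest hκ).inner_le (h.isCompact hκ) (x := b + σ • n) hb
    (by rw [e1, dist_eq_norm]; simp) (by rw [e1, hσn]; exact e2) hc
  rw [add_sub_cancel_left, hσn, real_inner_smul_right] at e3
  have e4 : σ * (2 * (1 / κ) * inner ℝ (c - b) n) ≤ σ * (‖n‖ * ‖c - b‖ ^ 2) := by linarith
  have e5 := le_of_mul_le_mul_left e4 hσ0
  have e6 : inner ℝ (c - b) n = κ / 2 * (2 * (1 / κ) * inner ℝ (c - b) n) := by field_simp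
  rw [e6]
  calc _ ≤ κ / 2 * (‖n‖ * ‖c - b‖ ^ 2) := by gcongr
    _ = _ := by ring

/-- The spaces are chosen pointwise; only the step property must be uniform, and compactness of S
patches the local step radii. -/
lemma IsSurface.exists_tangentField (h : IsSurface d κ S) (hκ : 0 < κ) :
    ∃ T : Amb D → Submodule ℝ (Amb D), TangentField S κ T ∧
      ∀ a ∈ S, Module.finrank ℝ (T a) = d := by
  have hex : ∀ a, ∃ U, a ∈ S → IsTangentSpace d κ S a U := by
    intro a
    by_cases ha : a ∈ S
    · obtain ⟨r, hr, C, hC, h1⟩ := h.exists_uniform_tangent hκ ha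
      obtain ⟨U, hU, -⟩ := h1 a ha (by simpa using hr)
      exact ⟨U, fun _ => hU⟩
    · exact ⟨⊥, fun h => absurd h ha⟩
  choose T hT using hex
  refine ⟨T, ⟨fun a ha => (hT a ha).inner_normal_le, fun θ hθ => ?_⟩,
    fun a ha => (hT a ha).finrank_eq⟩
  have key : ∃ h₀ > 0, ∀ t, 0 < t → t ≤ h₀ → ∀ a ∈ S, a ∈ S → ∀ v ∈ T a, ‖v‖ ≤ 1 →
      ∃ b ∈ S, ‖b - a - t • v‖ ≤ θ * t := by
    refine (h.isCompact hκ).induction_on (p := fun s => ∃ h₀ > 0, ∀ t, 0 < t → t ≤ h₀ →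
      ∀ a ∈ s, a ∈ S → ∀ v ∈ T a, ‖v‖ ≤ 1 → ∃ b ∈ S, ‖b - a - t • v‖ ≤ θ * t) ?_ ?_ ?_ ?_
    · exact ⟨1, one_pos, fun t _ _ a ha => absurd ha (Set.notMem_empty a)⟩
    · rintro s t hst ⟨h₀, h0, h1⟩
      exact ⟨h₀, h0, fun t ht0 ht a ha => h1 t ht0 ht a (hst ha)⟩
    · rintro s t ⟨h₁, h1, h1'⟩ ⟨h₂, h2, h2'⟩
      refine ⟨min h₁ h₂, lt_min h1 h2, fun t ht0 ht a ha => ?_⟩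
      rcases ha with ha | ha
      · exact h1' t ht0 (ht.trans (min_le_left _ _)) a ha
      · exact h2' t ht0 (ht.trans (min_le_right _ _)) a ha
    · intro p hp
      obtain ⟨r, hr, C, hC, h1⟩ := h.exists_uniform_tangent hκ hp
      refine ⟨Metric.ball p r, mem_nhdsWithin_of_mem_nhds (Metric.ball_mem_nhds p hr),
        min r (θ / (C + 1)), by positivity, fun t ht0 ht a ha haS v hv hv1 => ?_⟩
      obtain ⟨U, hU, hstep⟩ := h1 a haS ha
      obtain ⟨s, hs, h2⟩ := hstep v (hU.le hκ.le (hT a haS) hv) hv1 t ht0.le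
        (ht.trans (min_le_left _ _))
      refine ⟨s, hs, h2.trans ?_⟩
      have h3 : t ≤ θ / (C + 1) := ht.trans (min_le_right _ _)
      rw [le_div_iff₀ (by positivity)] at h3
      nlinarith
  obtain ⟨h₀, h0, h1⟩ := key
  exact ⟨h₀, h0, fun t ht0 ht a ha => h1 t ht0 ht a ha ha⟩

end Surface
end HOSC
end

noncomputable section
namespace HOSC

/-! ### Boxes along a subspace and their volume. -/

section Box

variable {D d : ℕ}

/-- The points whose displacement from `y₀` has component along `U` shorter than `α` and component
normal to `U` shorter than `β`. -/
def box (U : Submodule ℝ (Amb D)) (y₀ : Amb D) (α β : ℝ) : Set (Amb D) :=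
  {y | ‖U.starProjection (y - y₀)‖ < α ∧ ‖y - y₀ - U.starProjection (y - y₀)‖ < β}

lemma mem_box {U : Submodule ℝ (Amb D)} {y₀ y : Amb D} {α β : ℝ} : y ∈ box U y₀ α β ↔
    ‖U.starProjection (y - y₀)‖ < α ∧ ‖y - y₀ - U.starProjection (y - y₀)‖ < β := Iff.rfl

/-- The volume of the unit ball of dimension `k`. -/
def unitBallVolume (k : ℕ) : ℝ := √Real.pi ^ k / Real.Gamma (k / 2 + 1)

lemma unitBallVolume_pos (k : ℕ) : 0 < unitBallVolume k := by
  unfold unitBallVolume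
  have := Real.Gamma_pos_of_pos (s := (k : ℝ) / 2 + 1) (by positivity)
  have := Real.pi_pos
  positivity

lemma volume_real_ball {V : Type*} [NormedAddCommGroup V] [InnerProductSpace ℝ V]
    [FiniteDimensional ℝ V] [MeasurableSpace V] [BorelSpace V] [Nontrivial V] (x : V) {r : ℝ}
    (hr : 0 ≤ r) : volume.real (Metric.ball x r)
      = unitBallVolume (Module.finrank ℝ V) * r ^ Module.finrank ℝ V := by
  have h := (unitBallVolume_pos (Module.finrank ℝ V)).le
  unfold unitBallVolume at h ⊢
  rw [Measure.real, InnerProductSpace.volume_ball, ENNReal.toReal_mul, ENNReal.toReal_pow,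
    ENNReal.toReal_ofReal hr, ENNReal.toReal_ofReal h, mul_comm]

lemma isOpen_box (U : Submodule ℝ (Amb D)) (y₀ : Amb D) (α β : ℝ) : IsOpen (box U y₀ α β) :=
  IsOpen.inter (s := {y | ‖U.starProjection (y - y₀)‖ < α})
    (t := {y | ‖y - y₀ - U.starProjection (y - y₀)‖ < β})
    (isOpen_lt (by fun_prop) continuous_const) (isOpen_lt (by fun_prop) continuous_const)

lemma norm_sub_lt_of_mem_box {U : Submodule ℝ (Amb D)} {y₀ y : Amb D} {α β : ℝ}
    (h : y ∈ box U y₀ α β) : ‖y - y₀‖ < α + β := by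
  have : y - y₀ = U.starProjection (y - y₀) + (y - y₀ - U.starProjection (y - y₀)) := by abel
  rw [this]
  exact (norm_add_le _ _).trans_lt (add_lt_add h.1 h.2)

/-- The orthogonal decomposition preserves volume and turns the box into a product of two balls. -/
lemma volume_real_box (hd : 1 ≤ d) (hdD : d + 1 ≤ D) {U : Submodule ℝ (Amb D)}
    (hU : Module.finrank ℝ U = d) (y₀ : Amb D) {α β : ℝ} (hα : 0 ≤ α) (hβ : 0 ≤ β) :
    volume.real (box U y₀ α β)
      = unitBallVolume d * unitBallVolume (D - d) * α ^ d * β ^ (D - d) := by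
  have hU' : Module.finrank ℝ Uᗮ = D - d := by
    have := U.finrank_add_finrank_orthogonal
    rw [hU, finrank_euclideanSpace_fin] at this
    omega
  have : Nontrivial U := Module.nontrivial_of_finrank_pos (R := ℝ) (by omega)
  have : Nontrivial Uᗮ := Module.nontrivial_of_finrank_pos (R := ℝ) (by omega)
  have hmp : MeasurePreserving
      (fun y : Amb D => WithLp.ofLp (U.orthogonalDecomposition (y - y₀))) volume volume :=
    (WithLp.volume_preserving_ofLp _ _).comp
      (U.orthogonalDecomposition.measurePreserving.comp (measurePreserving_sub_right volume y₀))
  have hpre : box U y₀ α β = (fun y : Amb D => WithLp.ofLp (U.orthogonalDecomposition (y - y₀))) ⁻¹'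
      (Metric.ball (0 : U) α ×ˢ Metric.ball (0 : Uᗮ) β) := by
    ext y
    have e : y - y₀ - U.starProjection (y - y₀) = Uᗮ.starProjection (y - y₀) := by
      rw [Submodule.starProjection_orthogonal_val]
    simp only [mem_box, Set.mem_preimage, Set.mem_prod, mem_ball_zero_iff,
      Submodule.orthogonalDecomposition_apply, e]
    rfl
  rw [hpre, Measure.real, hmp.measure_preimage
    (measurableSet_ball.prod measurableSet_ball).nullMeasurableSet, Measure.volume_eq_prod,
    Measure.prod_prod, ENNReal.toReal_mul]
  have h1 := volume_real_ball (0 : U) hα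
  have h2 := volume_real_ball (0 : Uᗮ) hβ
  rw [hU] at h1
  rw [hU'] at h2
  rw [Measure.real] at h1 h2
  rw [h1, h2]; ring

end Box

/-! ### Maximal separated sets. -/

section Packing

variable {X : Type*} [PseudoMetricSpace X]

/-- A finite set of points at mutual distance at least `t`. -/
def Separated (t : ℝ) (P : Finset X) : Prop := ∀ x ∈ P, ∀ y ∈ P, x ≠ y → t ≤ dist x y

/-- If separated subsets of `A` have bounded cardinality, then a maximal one covers `A`. -/
lemma exists_separated_cover {A : Set X} {t : ℝ} {M : ℕ} (ht : 0 < t)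
    (hM : ∀ P : Finset X, ↑P ⊆ A → Separated t P → P.card ≤ M) :
    ∃ P : Finset X, ↑P ⊆ A ∧ Separated t P ∧ ∀ a ∈ A, ∃ p ∈ P, dist a p < t := by
  classical
  set Q : ℕ → Prop := fun n => ∃ P : Finset X, ↑P ⊆ A ∧ Separated t P ∧ P.card = n with hQ
  have hQ0 : Q 0 := ⟨∅, by simp, by simp [Separated], rfl⟩
  obtain ⟨P, hPA, hPs, hPc⟩ := Nat.findGreatest_spec (P := Q) (Nat.zero_le M) hQ0
  refine ⟨P, hPA, hPs, ?_⟩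
  by_contra! hcon
  obtain ⟨a, ha, hfar⟩ := hcon
  have haP : a ∉ P := fun haP => by
    have := hfar a haP
    rw [dist_self] at this
    linarith
  have hs : Separated t (insert a P) := by
    intro x hx y hy hxy
    rcases Finset.mem_insert.1 hx with hx | hx <;> rcases Finset.mem_insert.1 hy with hy | hy
    · exact absurd (hx.trans hy.symm) hxy
    · rw [hx]; exact hfar y hy
    · rw [hy, dist_comm]; exact hfar x hx
    · exact hPs x hx y hy hxy
  have hsub : (↑(insert a P) : Set X) ⊆ A := by
    rw [Finset.coe_insert]; exact Set.insert_subset ha hPA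
  have hle := hM _ hsub hs
  rw [Finset.card_insert_of_notMem haP] at hle
  have hlt : Nat.findGreatest Q M < P.card + 1 := by omega
  exact Nat.findGreatest_is_greatest hlt hle ⟨insert a P, hsub, hs, Finset.card_insert_of_notMem haP⟩

end Packing
end HOSC
end

noncomputable section
namespace HOSC

/-! ### Packing numbers of the surface and volume of its tube. -/

section TangentSurface

variable {D d : ℕ} {κ : ℝ} {S : Set (Amb D)} {T : Amb D → Submodule ℝ (Amb D)}

/-- A compact subset of the unit cube with reach at least `1 / κ` and a field of `d`-dimensional
tangent spaces. -/
structure TangentSurface (d : ℕ) (κ : ℝ) (S : Set (Amb D)) (T : Amb D → Submodule ℝ (Amb D)) :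
    Prop extends TangentField S κ T where
  one_le : 1 ≤ κ
  isCompact : IsCompact S
  nonempty : S.Nonempty
  subset_cube : S ⊆ unitCube D
  uniqueNearest : UniqueNearest S (1 / κ)
  finrank_eq : ∀ a ∈ S, Module.finrank ℝ (T a) = d

lemma IsSurface.exists_tangentSurface (h : IsSurface d κ S) (hκ : 1 ≤ κ) :
    ∃ T, TangentSurface d κ S T := by
  have h0 : 0 < κ := one_pos.trans_le hκ
  obtain ⟨T, hT, hd⟩ := h.exists_tangentField h0
  exact ⟨T, hT, hκ, h.isCompact h0, h.connected.nonempty, h.subset_cube, h.uniqueNearest h0, hd⟩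

namespace TangentSurface

lemma pos (h : TangentSurface d κ S T) : 0 < κ := one_pos.trans_le h.one_le

/-- If n is the normal part of y - s, then s is nearest to s + n, and y differs from s + n by a
tangential vector shorter than α; the projection is 2-Lipschitz. -/
lemma norm_nearest_sub_le (h : TangentSurface d κ S T) {s y a : Amb D} {α : ℝ} (hs : s ∈ S)
    (hα : α ≤ 1 / (4 * κ)) (hy : y ∈ box (T s) s α (1 / (4 * κ))) (ha : a ∈ S)
    (hya : dist y a = Metric.infDist y S) :
    Metric.infDist y S ≤ 1 / (2 * κ) ∧ ‖a - s‖ ≤ 2 * α := by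
  have hκ := h.pos
  have hlt := norm_sub_lt_of_mem_box hy
  have hq : 1 / (4 * κ) = 1 / κ / 4 := by field_simp
  have hq2 : 1 / (2 * κ) = 1 / κ / 2 := by field_simp
  have hy' : Metric.infDist y S ≤ 1 / (2 * κ) := by
    have := Metric.infDist_le_dist_of_mem (x := y) hs
    rw [dist_eq_norm] at this
    linarith
  refine ⟨hy', ?_⟩
  set n := y - s - (T s).starProjection (y - s) with hn
  have hnT : n ∈ (T s)ᗮ := (T s).sub_starProjection_mem_orthogonal _
  have hnn : ‖n‖ < 1 / (4 * κ) := hy.2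
  have hκ1 : κ * (1 / κ) = 1 := by field_simp
  have e1 : Metric.infDist (s + n) S = ‖n‖ :=
    infDist_add_eq_norm hs (fun b hb => h.inner_normal_le s hs b hb n hnT) (by nlinarith)
  have e2 := h.uniqueNearest.dist_nearest_le h.isCompact (by positivity) (x := s + n) hs
    (by rw [e1, dist_eq_norm]; simp) (by rw [e1]; linarith [norm_nonneg n]) ha hya (by linarith)
  have e3 : y - (s + n) = (T s).starProjection (y - s) := by rw [hn]; abel
  rw [e3] at e2
  linarith [hy.1]

/-- Boxes of tangential radius t / 8 at the points of P are disjoint: the nearest point of a common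
element would be within t / 4 of both centres. Their total volume is bounded. -/
lemma card_mul_le (h : TangentSurface d κ S T) (hd : 1 ≤ d) (hdD : d + 1 ≤ D) {t : ℝ}
    (ht : 0 < t) (htκ : t ≤ 1 / κ) {P : Finset (Amb D)} (hP : ↑P ⊆ S) (hsep : Separated t P) :
    P.card * (unitBallVolume d * unitBallVolume (D - d) * (t / 8) ^ d
      * (1 / (4 * κ)) ^ (D - d)) ≤ volume.real (Metric.closedBall (0 : Amb D) (D + 1)) := by
  have hκ := h.pos
  have hα : t / 8 ≤ 1 / (4 * κ) := by
    have hq : 1 / (4 * κ) = 1 / κ / 4 := by field_simp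
    have : 0 < 1 / κ := by positivity
    linarith
  have hdisj : (↑P : Set (Amb D)).PairwiseDisjoint
      fun s => box (T s) s (t / 8) (1 / (4 * κ)) := by
    intro s hs s' hs' hne
    rw [Function.onFun, Set.disjoint_left]
    intro y hy hy'
    obtain ⟨a, ha, hya⟩ := h.isCompact.exists_infDist_eq_dist h.nonempty y
    have e1 := (h.norm_nearest_sub_le (hP hs) hα hy ha hya.symm).2
    have e2 := (h.norm_nearest_sub_le (hP hs') hα hy' ha hya.symm).2
    have e3 := hsep s hs s' hs' hne
    have e4 := dist_triangle_left s s' a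
    rw [dist_eq_norm a s, dist_eq_norm a s'] at e4
    linarith
  have hsub : (⋃ s ∈ P, box (T s) s (t / 8) (1 / (4 * κ))) ⊆ Metric.closedBall 0 (D + 1) := by
    refine Set.iUnion₂_subset fun s hs y hy => ?_
    have e1 := norm_sub_lt_of_mem_box hy
    have e2 := norm_le_of_mem_unitCube (h.subset_cube (hP hs))
    have e3 : ‖y‖ ≤ ‖y - s‖ + ‖s‖ := by simpa using norm_add_le (y - s) s
    have e4 : 1 / (4 * κ) ≤ 1 / 4 := by
      apply one_div_le_one_div_of_le (by norm_num); linarith [h.one_le]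
    rw [mem_closedBall_zero_iff]; linarith
  have := measureReal_mono (μ := (volume : Measure (Amb D))) hsub
    (isCompact_closedBall _ _).measure_lt_top.ne
  rw [measureReal_biUnion_finset hdisj (fun s _ => (isOpen_box _ _ _ _).measurableSet)
    (fun s _ => ((measure_mono (Set.subset_iUnion₂_of_subset s ‹_› subset_rfl)).trans
      (measure_mono hsub)).trans_lt (isCompact_closedBall _ _).measure_lt_top |>.ne)] at this
  rw [Finset.sum_congr rfl fun s hs => volume_real_box hd hdD (h.finrank_eq s (hP hs)) s
    (by positivity : 0 ≤ t / 8) (by positivity : 0 ≤ 1 / (4 * κ))] at this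
  simpa using this

lemma exists_cover (h : TangentSurface d κ S T) (hd : 1 ≤ d) (hdD : d + 1 ≤ D) {t : ℝ}
    (ht : 0 < t) (htκ : t ≤ 1 / κ) {A : Set (Amb D)} (hA : A ⊆ S) :
    ∃ P : Finset (Amb D), ↑P ⊆ A ∧ Separated t P ∧ ∀ a ∈ A, ∃ p ∈ P, dist a p < t := by
  have hκ := h.pos
  set c := unitBallVolume d * unitBallVolume (D - d) * (t / 8) ^ d * (1 / (4 * κ)) ^ (D - d)
    with hc
  have hc0 : 0 < c := by
    have := unitBallVolume_pos d
    have := unitBallVolume_pos (D - d)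
    positivity
  refine exists_separated_cover
    (M := ⌊volume.real (Metric.closedBall (0 : Amb D) (D + 1)) / c⌋₊) ht fun P hP hsep => ?_
  refine Nat.le_floor ?_
  rw [le_div_iff₀ hc0]
  exact h.card_mul_le hd hdD ht htκ (hP.trans hA) hsep

/-- Volume comparison for a maximal separated set. A point y of the box at a has its nearest point b
within t of some s in P. Since y - b is normal at b, its tangential part at s is at most 10 t, so y
lies in the box of tangential radius 12 t at s. -/
lemma exists_card_ge (h : TangentSurface d κ S T) (hd : 1 ≤ d) (hdD : d + 1 ≤ D) {a : Amb D}
    (ha : a ∈ S) {t ρ : ℝ} (ht : 0 < t) (htκ : 40 * κ * t ≤ 1) (hρ : 0 < ρ)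
    (hρκ : ρ ≤ 1 / (4 * κ)) : ∃ P : Finset (Amb D), ↑P ⊆ S ∩ Metric.closedBall a ρ ∧
      Separated t P ∧ (ρ / (24 * t)) ^ d / 4 ^ (D - d) ≤ P.card := by
  have hκ := h.pos
  have hq : 1 / (4 * κ) = 1 / κ / 4 := by field_simp
  have hq2 : 1 / (2 * κ) = 1 / κ / 2 := by field_simp
  have htκ' : t ≤ 1 / κ / 40 := by
    rw [div_div, le_div_iff₀ (by positivity)]; linarith
  have hκ0 : 0 < 1 / κ := by positivity
  obtain ⟨P, hPA, hsep, hcov⟩ := h.exists_cover hd hdD ht (by linarith)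
    (Set.inter_subset_left : S ∩ Metric.closedBall a ρ ⊆ S)
  refine ⟨P, hPA, hsep, ?_⟩
  have hsub : box (T a) a (ρ / 2) (1 / (4 * κ)) ⊆ ⋃ s ∈ P, box (T s) s (12 * t) (1 / κ) := by
    intro y hy
    obtain ⟨b, hb, hyb⟩ := h.isCompact.exists_infDist_eq_dist h.nonempty y
    obtain ⟨e1, e2⟩ := h.norm_nearest_sub_le ha (by linarith) hy hb hyb.symm
    obtain ⟨s, hs, hbs⟩ := hcov b ⟨hb, by rw [Metric.mem_closedBall, dist_eq_norm]; linarith⟩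
    rw [dist_eq_norm] at hbs
    have hsS := (hPA hs).1
    have hn : y - b ∈ (T b)ᗮ := h.toTangentField.sub_nearest_mem_orthogonal hκ h.isCompact
      (by positivity) h.uniqueNearest hb hyb.symm (by linarith)
    have hnn : ‖y - b‖ ≤ 1 / (2 * κ) := by rw [← dist_eq_norm, ← hyb]; exact e1
    have e3 := h.toTangentField.norm_proj_normal_le' hκ ht htκ hsS hb
      (by rw [norm_sub_rev]; exact hbs.le) hn
    have e4 : 20 * κ * t * ‖y - b‖ ≤ 10 * t := by
      calc _ ≤ 20 * κ * t * (1 / (2 * κ)) := by gcongr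
        _ = _ := by field_simp; norm_num
    have e5 : y - s = (b - s) + (y - b) := by abel
    have e6 := (T s).norm_starProjection_apply_le (b - s)
    refine Set.mem_iUnion₂.2 ⟨s, hs, mem_box.2 ⟨?_, ?_⟩⟩
    · rw [e5, map_add]
      refine (norm_add_le _ _).trans_lt ?_
      linarith
    · have e7 : ‖y - s - (T s).starProjection (y - s)‖ ≤ ‖y - s‖ := by
        rw [← Submodule.starProjection_orthogonal_val]
        exact (T s)ᗮ.norm_starProjection_apply_le _
      refine e7.trans_lt ?_
      rw [e5]
      refine (norm_add_le _ _).trans_lt ?_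
      linarith
  have hfin : volume (⋃ s ∈ P, box (T s) s (12 * t) (1 / κ)) ≠ ⊤ := by
    refine ((measure_biUnion_finset_le P _).trans_lt (ENNReal.sum_lt_top.2 fun s _ => ?_)).ne
    refine (measure_mono (t := Metric.ball s (12 * t + 1 / κ)) fun y hy => ?_).trans_lt
      measure_ball_lt_top
    rw [Metric.mem_ball, dist_eq_norm]
    exact norm_sub_lt_of_mem_box hy
  have h1 := (measureReal_mono hsub hfin).trans (measureReal_biUnion_finset_le P _)
  rw [volume_real_box hd hdD (h.finrank_eq a ha) a (by positivity) (by positivity),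
    Finset.sum_congr rfl fun s hs => volume_real_box hd hdD (h.finrank_eq s (hPA hs).1) s
    (by positivity : 0 ≤ 12 * t) (by positivity : 0 ≤ 1 / κ), Finset.sum_const, nsmul_eq_mul] at h1
  have hω : 0 < unitBallVolume d * unitBallVolume (D - d) :=
    mul_pos (unitBallVolume_pos _) (unitBallVolume_pos _)
  set ω := unitBallVolume d * unitBallVolume (D - d)
  have h2 : ω * (ρ / 2) ^ d * (1 / (4 * κ)) ^ (D - d)
      = (ω * (12 * t) ^ d * (1 / κ) ^ (D - d)) * ((ρ / (24 * t)) ^ d / 4 ^ (D - d)) := by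
    rw [hq, div_pow (1 / κ) 4]
    have : (ρ / 2) ^ d = (12 * t) ^ d * (ρ / (24 * t)) ^ d := by
      rw [← mul_pow]; congr 1; field_simp; norm_num
    rw [this]; ring
  rw [h2, mul_comm] at h1
  exact le_of_mul_le_mul_right h1 (by positivity)

end TangentSurface

/-- A maximal τ-separated subset of S has O(τ^(-d)) points, and the balls of radius 2τ around them
cover the tube. -/
lemma exists_volume_tube_le (d D : ℕ) (hd : 1 ≤ d) (hdD : d + 1 ≤ D) (κ : ℝ) (hκ : 1 ≤ κ) :
    ∃ C > 0, ∀ (S : Set (Amb D)) (T : Amb D → Submodule ℝ (Amb D)), TangentSurface d κ S T →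
      ∀ τ, 0 < τ → τ ≤ 1 / κ → volume.real (tube S τ) ≤ C * τ ^ (D - d) := by
  have hκ0 : 0 < κ := one_pos.trans_le hκ
  set V := volume.real (Metric.closedBall (0 : Amb D) (D + 1)) with hV
  set ω := unitBallVolume d * unitBallVolume (D - d) with hω
  have hω0 : 0 < ω := mul_pos (unitBallVolume_pos _) (unitBallVolume_pos _)
  set c := ω * (1 / 8) ^ d * (1 / (4 * κ)) ^ (D - d) with hc
  have hc0 : 0 < c := by positivity
  have hD := unitBallVolume_pos D
  refine ⟨(V + 1) / c * (unitBallVolume D * 2 ^ D), by positivity, fun S T h τ hτ hτκ => ?_⟩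
  obtain ⟨P, hPS, hsep, hcov⟩ := h.exists_cover hd hdD hτ hτκ (subset_refl S)
  have h1 := h.card_mul_le hd hdD hτ hτκ hPS hsep
  have h2 : tube S τ ⊆ ⋃ s ∈ P, Metric.ball s (2 * τ) := by
    rintro y ⟨-, hy⟩
    obtain ⟨a, ha, hya⟩ := (Metric.infDist_lt_iff h.nonempty).1 hy
    obtain ⟨s, hs, has⟩ := hcov a ha
    refine Set.mem_iUnion₂.2 ⟨s, hs, ?_⟩
    have := dist_triangle y a s
    rw [Metric.mem_ball]; linarith
  have hfin : volume (⋃ s ∈ P, Metric.ball s (2 * τ)) ≠ ⊤ :=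
    ((measure_biUnion_finset_le P _).trans_lt
      (ENNReal.sum_lt_top.2 fun s _ => measure_ball_lt_top)).ne
  have : Nonempty (Fin D) := ⟨⟨0, by omega⟩⟩
  have h3 := (measureReal_mono h2 hfin).trans (measureReal_biUnion_finset_le P _)
  rw [Finset.sum_congr rfl fun s _ => volume_real_ball s (by positivity : 0 ≤ 2 * τ),
    Finset.sum_const, nsmul_eq_mul, finrank_euclideanSpace_fin] at h3
  have h4 : (P.card : ℝ) * τ ^ d ≤ (V + 1) / c := by
    rw [le_div_iff₀ hc0]
    have : (P.card : ℝ) * (ω * (τ / 8) ^ d * (1 / (4 * κ)) ^ (D - d)) = P.card * τ ^ d * c := by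
      rw [hc, div_pow, div_pow 1 8]; ring
    linarith
  have hpow : τ ^ D = τ ^ d * τ ^ (D - d) := by rw [← pow_add]; congr 1; omega
  calc volume.real (tube S τ) ≤ P.card * (unitBallVolume D * (2 * τ) ^ D) := h3
    _ = (P.card * τ ^ d) * (unitBallVolume D * 2 ^ D * τ ^ (D - d)) := by
        rw [mul_pow, hpow]; ring
    _ ≤ (V + 1) / c * (unitBallVolume D * 2 ^ D * τ ^ (D - d)) := by gcongr
    _ = _ := by ring

end TangentSurface
end HOSC
end

noncomputable section
namespace HOSC

/-! ### Large nearly flat regions inside a tube, in three regimes of τ. -/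

section LocalRegion

variable {D d : ℕ} {κ : ℝ} {S : Set (Amb D)} {T : Amb D → Submodule ℝ (Amb D)}

/-- A point near `s` that is far from the boundary of the unit cube. -/
def inward (s : Amb D) (τ : ℝ) : Amb D :=
  s + WithLp.toLp 2 fun j => if s j < 1 / 2 then τ / (4 * D) else -(τ / (4 * D))

lemma norm_inward_sub_le (s : Amb D) {τ : ℝ} (hτ : 0 ≤ τ) : ‖inward s τ - s‖ ≤ τ / 4 := by
  have e : inward s τ - s
      = WithLp.toLp 2 fun j => if s j < 1 / 2 then τ / (4 * D) else -(τ / (4 * D)) := by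
    simp [inward]
  have h1 : ‖inward s τ - s‖ ^ 2 ≤ D * (τ / (4 * D)) ^ 2 := by
    rw [e, EuclideanSpace.norm_sq_eq]
    calc _ ≤ ∑ _i : Fin D, (τ / (4 * D)) ^ 2 := by
          refine Finset.sum_le_sum fun i _ => ?_
          rw [Real.norm_eq_abs, sq_abs]
          dsimp only
          split_ifs <;> simp
      _ = _ := by simp
  rcases Nat.eq_zero_or_pos D with h0 | h0
  · subst h0
    have : ‖inward s τ - s‖ ^ 2 ≤ 0 := by simpa using h1
    have h2 : ‖inward s τ - s‖ = 0 := by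
      have := le_antisymm this (sq_nonneg _)
      simpa using this
    rw [h2]; positivity
  · have hD : (1 : ℝ) ≤ D := by exact_mod_cast h0
    have h2 : D * (τ / (4 * D)) ^ 2 ≤ (τ / 4) ^ 2 := by
      have : D * (τ / (4 * D)) ^ 2 = (τ / 4) ^ 2 / D := by field_simp
      rw [this]
      exact div_le_self (by positivity) hD
    exact le_of_sq_le_sq (h1.trans h2) (by positivity)

/-- In each coordinate, the face nearer to s is kept away by s' in the cube together with the inward
shift τ / (4D), which beats e + e'. The opposite face is at distance at least 1/2 from s, beyond the
reach of all displacements. -/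
lemma mem_unitCube_of_near_inward (hD : 2 ≤ D) {s s' t y : Amb D} {τ e e' : ℝ}
    (hτ : τ ≤ 1) (hs' : s' ∈ unitCube D) (ht : ‖t‖ ≤ 1 / 8)
    (he : ‖s' - s - t‖ ≤ e) (he' : ‖y - (inward s τ + t)‖ ≤ e') (hlt : e + e' < τ / (4 * D)) :
    y ∈ unitCube D := by
  intro j
  have hD' : (2 : ℝ) ≤ D := by exact_mod_cast hD
  have hσ : τ / (4 * D) ≤ 1 / 8 := by
    rw [div_le_iff₀ (by positivity)]; linarith
  have h1 := abs_le.1 ((PiLp.norm_apply_le (s' - s - t) j).trans he)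
  have h2 := abs_le.1 ((PiLp.norm_apply_le (y - (inward s τ + t)) j).trans he')
  have h3 := abs_le.1 ((PiLp.norm_apply_le t j).trans ht)
  have h4 := hs' j
  have h5 : 0 ≤ e := (norm_nonneg _).trans he
  have h6 : 0 ≤ e' := (norm_nonneg _).trans he'
  simp only [inward, PiLp.sub_apply, PiLp.add_apply] at h1 h2
  constructor <;> split_ifs at h2 <;> linarith [h4.1, h4.2]

lemma convex_unitCube : Convex ℝ (unitCube D) := by
  intro x hx y hy a b ha hb hab j
  have := (convex_Ioo (0 : ℝ) 1) (hx j) (hy j) ha hb hab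
  simpa using this

lemma isOpen_unitCube : IsOpen (unitCube D) := by
  have : unitCube D = ⋂ j, (fun x : Amb D => x j) ⁻¹' Set.Ioo 0 1 := by
    ext x; simp [unitCube]
  rw [this]
  exact isOpen_iInter_of_finite fun j => isOpen_Ioo.preimage (by fun_prop)

lemma isOpen_tube (S : Set (Amb D)) (t : ℝ) : IsOpen (tube S t) :=
  IsOpen.inter (s := unitCube D) (t := {x | Metric.infDist x S < t}) isOpen_unitCube
    (isOpen_lt (Metric.continuous_infDist_pt S) continuous_const)

/-- A region of volume at least `v` inside `tube S τ` which, together with `x`, is within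
`ε / 4` of `x` and within `ε ^ 2 / 2` of a `d`-dimensional affine subspace. -/
def HasLocalRegion (d : ℕ) (S : Set (Amb D)) (τ ε : ℝ) (x : Amb D) (v : ℝ) : Prop :=
  ∃ (R : Set (Amb D)) (U : Submodule ℝ (Amb D)) (y₀ : Amb D), Module.finrank ℝ U = d ∧
    MeasurableSet R ∧ R ⊆ tube S τ ∧
    (∀ y ∈ R, ‖y - x‖ ≤ ε / 4 ∧ ‖y - y₀ - U.starProjection (y - y₀)‖ ≤ ε ^ 2 / 2) ∧
    ‖x - y₀ - U.starProjection (x - y₀)‖ ≤ ε ^ 2 / 2 ∧ v ≤ volume.real R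

lemma volume_tube_ne_top (S : Set (Amb D)) (t : ℝ) : volume (tube S t) ≠ ⊤ := by
  refine ((measure_mono (t := Metric.closedBall (0 : Amb D) D) fun y hy => ?_).trans_lt
    (isCompact_closedBall _ _).measure_lt_top).ne
  simpa using norm_le_of_mem_unitCube hy.1

namespace TangentSurface

/-- For τ ≤ ε² / 4 the part of the tube near s is already thin around the tangent plane at s. The
region is a union of disjoint balls of radius of order τ next to order (ε/τ)^d separated points of
S, with centres shifted inward to stay in the cube. -/
lemma hasLocalRegion_of_thin (h : TangentSurface d κ S T) (hd : 1 ≤ d) (hdD : d + 1 ≤ D)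
    {τ ε : ℝ} (hτ : 0 < τ) (hε : 0 < ε) (hεκ : 10 * κ * ε ≤ 1) (hτε : τ ≤ ε ^ 2 / 4)
    {x : Amb D} (hx : x ∈ tube S τ) :
    HasLocalRegion d S τ ε x ((1 / (2400 * κ * D)) ^ d / 4 ^ (D - d) * unitBallVolume D
      * (1 / (8 * D)) ^ D * (ε ^ d * τ ^ (D - d))) := by
  have hκ := h.pos
  have hκ1 := h.one_le
  have hD : 2 ≤ D := by omega
  have hD' : (2 : ℝ) ≤ D := by exact_mod_cast hD
  have hε1 : ε ≤ 1 / 10 := by nlinarith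
  have hτ1 : τ ≤ ε / 40 := by nlinarith
  have hκD : (2 : ℝ) ≤ κ * D := by nlinarith
  obtain ⟨s, hs, hxs⟩ := (Metric.infDist_lt_iff h.nonempty).1 hx.2
  rw [dist_eq_norm] at hxs
  set ρ := ε / (100 * κ * D) with hρ
  have hρε : ρ ≤ ε / 200 := by
    rw [hρ]; gcongr; linarith
  have hρκ : ρ * κ ≤ ε / 200 := by
    have : ρ * κ = ε / (100 * D) := by rw [hρ]; field_simp
    rw [this]; gcongr; linarith
  have hρ0 : 0 < ρ := by positivity
  obtain ⟨P, hPA, hsep, hcard⟩ := h.exists_card_ge hd hdD hs hτ (t := τ) (ρ := ρ) (by nlinarith)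
    hρ0 (by rw [le_div_iff₀ (by positivity)]; nlinarith)
  set σ := τ / (4 * D) with hσ
  have hσ0 : 0 < σ := by positivity
  have hστ : σ ≤ τ / 8 := by
    rw [hσ]; gcongr; linarith
  have hball : ∀ p ∈ P, ∀ y ∈ Metric.ball (inward p τ) (σ / 2),
      ‖y - p‖ < τ / 2 ∧ y ∈ unitCube D := by
    intro p hp y hy
    rw [Metric.mem_ball, dist_eq_norm] at hy
    constructor
    · have : y - p = (y - inward p τ) + (inward p τ - p) := by abel
      rw [this]
      refine (norm_add_le _ _).trans_lt ?_
      have := norm_inward_sub_le p hτ.le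
      linarith
    · exact mem_unitCube_of_near_inward hD (s := p) (s' := p) (t := 0) (τ := τ) (e := 0)
        (e' := σ / 2) (by linarith) (h.subset_cube (hPA hp).1) (by simp) (by simp) (by simpa using hy.le)
        (by linarith)
  have hdisj : (↑P : Set (Amb D)).PairwiseDisjoint
      fun p => Metric.ball (inward p τ) (σ / 2) := by
    intro p hp p' hp' hne
    rw [Function.onFun, Set.disjoint_left]
    intro y hy hy'
    have e1 := (hball p hp y hy).1
    have e2 := (hball p' hp' y hy').1
    have e3 := hsep p hp p' hp' hne
    have e4 := dist_triangle_left p p' y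
    rw [dist_eq_norm y p, dist_eq_norm y p'] at e4
    linarith
  have hsub : (⋃ p ∈ P, Metric.ball (inward p τ) (σ / 2)) ⊆ tube S τ := by
    refine Set.iUnion₂_subset fun p hp y hy => ⟨(hball p hp y hy).2, ?_⟩
    have := Metric.infDist_le_dist_of_mem (x := y) (hPA hp).1
    rw [dist_eq_norm] at this
    linarith [(hball p hp y hy).1]
  have hNle : ∀ z : Amb D, ‖z - (T s).starProjection z‖ ≤ ‖z‖ := fun z => by
    rw [← Submodule.starProjection_orthogonal_val]
    exact (T s)ᗮ.norm_starProjection_apply_le _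
  refine ⟨⋃ p ∈ P, Metric.ball (inward p τ) (σ / 2), T s, s, h.finrank_eq s hs,
    Finset.measurableSet_biUnion _ fun p _ => measurableSet_ball, hsub, ?_, ?_, ?_⟩
  · intro y hy
    obtain ⟨p, hp, hyp⟩ := Set.mem_iUnion₂.1 hy
    have e1 := (hball p hp y hyp).1
    have e2 : ‖p - s‖ ≤ ρ := by
      rw [← dist_eq_norm]; exact (hPA hp).2
    constructor
    · have : y - x = (y - p) + (p - s) - (x - s) := by abel
      rw [this]
      have f1 := norm_sub_le ((y - p) + (p - s)) (x - s)
      have f2 := norm_add_le (y - p) (p - s)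
      linarith
    · have e3 := h.toTangentField.norm_sub_proj_le hκ.le hs (hPA hp).1
      have e4 : y - s - (T s).starProjection (y - s)
          = (y - p - (T s).starProjection (y - p)) + (p - s - (T s).starProjection (p - s)) := by
        have : y - s = (y - p) + (p - s) := by abel
        rw [this, map_add]; abel
      rw [e4]
      refine (norm_add_le _ _).trans ?_
      have e5 := hNle (y - p)
      have e6 : κ / 2 * ‖p - s‖ ^ 2 ≤ κ / 2 * ρ ^ 2 := by gcongr
      nlinarith
  · exact (hNle _).trans (by linarith)
  · have : Nonempty (Fin D) := ⟨⟨0, by omega⟩⟩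
    rw [measureReal_biUnion_finset hdisj (fun p _ => measurableSet_ball)
      (fun p _ => measure_ball_lt_top.ne),
      Finset.sum_congr rfl fun p _ => volume_real_ball (inward p τ) (by positivity : 0 ≤ σ / 2),
      Finset.sum_const, nsmul_eq_mul, finrank_euclideanSpace_fin]
    have hω := unitBallVolume_pos D
    have e1 : (1 / (2400 * κ * D)) ^ d / 4 ^ (D - d) * unitBallVolume D * (1 / (8 * D)) ^ D
        * (ε ^ d * τ ^ (D - d))
        = (ρ / (24 * τ)) ^ d / 4 ^ (D - d) * (unitBallVolume D * (σ / 2) ^ D) := by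
      have f1 : (ρ / (24 * τ)) ^ d * τ ^ d = (1 / (2400 * κ * D)) ^ d * ε ^ d := by
        rw [← mul_pow, ← mul_pow]; congr 1; rw [hρ]; field_simp; norm_num
      have f2 : (σ / 2) ^ D = (1 / (8 * D)) ^ D * (τ ^ d * τ ^ (D - d)) := by
        rw [← pow_add, show d + (D - d) = D by omega, ← mul_pow]; congr 1; rw [hσ]
        field_simp; norm_num
      rw [f2]
      calc _ = ((1 / (2400 * κ * D)) ^ d * ε ^ d) / 4 ^ (D - d) * unitBallVolume D
            * (1 / (8 * D)) ^ D * τ ^ (D - d) := by ring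
        _ = _ := by rw [← f1]; ring
    rw [e1]
    gcongr

/-- Curvature is irrelevant here: the cube and the ball of radius τ about s are convex and contain x
as well as a small ball about the inward point q. Contracting the latter towards x gives a ball at
scale ε, which contains an ε by ε² box. -/
lemma hasLocalRegion_of_thick (h : TangentSurface d κ S T) (hd : 1 ≤ d) (hdD : d + 1 ≤ D)
    {τ ε : ℝ} (hτ : 0 < τ) (hτκ : τ ≤ 1) (hε : 0 < ε) (hε1 : ε ≤ 1)
    (hτε : ε / (400 * κ * D) ≤ τ) {x : Amb D} (hx : x ∈ tube S τ) :
    HasLocalRegion d S τ ε x (unitBallVolume d * unitBallVolume (D - d)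
      * (1 / (51200 * κ * D ^ 2)) ^ d * (1 / (51200 * κ * D ^ 2)) ^ (D - d)
      * (ε ^ d * (ε ^ 2) ^ (D - d))) := by
  have hκ := h.pos
  have hκ1 := h.one_le
  have hD : 2 ≤ D := by omega
  have hD' : (2 : ℝ) ≤ D := by exact_mod_cast hD
  have hκD : (2 : ℝ) ≤ κ * D := by nlinarith
  obtain ⟨s, hs, hxs⟩ := (Metric.infDist_lt_iff h.nonempty).1 hx.2
  rw [dist_eq_norm] at hxs
  set c := 1 / (400 * κ * D) with hc
  have hc0 : 0 < c := by positivity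
  have hcs : c ≤ 1 / 800 := by
    rw [hc]; gcongr; linarith
  have hcτ : c * ε ≤ τ := by rw [hc, one_div_mul_eq_div]; exact hτε
  have hcε : 0 < c * ε := by positivity
  set q := inward s τ with hq
  have hqs : ‖q - s‖ ≤ τ / 4 := norm_inward_sub_le s hτ.le
  have hqx : ‖q - x‖ ≤ 2 * τ := by
    have : q - x = (q - s) - (x - s) := by abel
    rw [this]
    refine (norm_sub_le _ _).trans ?_
    linarith
  -- Any d-dimensional U containing q - x will do, as it puts x on the flat through q'. It is
  -- produced by reflecting a vector of T s of the right length onto q - x.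
  obtain ⟨U, hU, hUq⟩ : ∃ U : Submodule ℝ (Amb D), Module.finrank ℝ U = d ∧ q - x ∈ U := by
    have : Nontrivial (T s) :=
      Module.nontrivial_of_finrank_pos (R := ℝ) (by rw [h.finrank_eq s hs]; omega)
    obtain ⟨v, hv⟩ := exists_norm_eq (T s) (norm_nonneg (q - x))
    set e := ((ℝ ∙ ((v : Amb D) - (q - x)))ᗮ).reflection
    refine ⟨(T s).map (e.toLinearEquiv : Amb D →ₗ[ℝ] Amb D), ?_, ?_⟩
    · rw [LinearEquiv.finrank_map_eq, h.finrank_eq s hs]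
    · refine ⟨v, v.2, ?_⟩
      exact Submodule.reflection_sub (by simpa using hv)
  -- The contraction ratio is such that l τ is of order ε; it maps the ball of radius σ about q to
  -- the one of radius 2α about q', which contains the box.
  set l := c * ε / (16 * τ) with hl
  have hl0 : 0 < l := by positivity
  have hl1 : l ≤ 1 := by
    rw [hl, div_le_one (by positivity)]; linarith
  have hlτ : l * τ = c * ε / 16 := by rw [hl]; field_simp
  set q' := x + l • (q - x) with hq'
  set α := c * ε / (128 * D) with hα
  set β := c * ε ^ 2 / (128 * D) with hβ
  have hβα : β ≤ α := by
    rw [hα, hβ]; gcongr; nlinarith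
  set σ := τ / (4 * D) with hσ
  have hστ : σ ≤ τ / 8 := by rw [hσ]; gcongr; linarith
  have hlσ : l * σ = 2 * α := by
    rw [hσ, hα, ← mul_div_assoc, hlτ]; field_simp; norm_num
  have hβε : β ≤ ε ^ 2 / 2 := by
    rw [hβ, div_le_div_iff₀ (by positivity) (by positivity)]
    have : 0 < ε ^ 2 := by positivity
    nlinarith
  have hbox : ∀ y ∈ box U q' α β, y ∈ unitCube D ∧ ‖y - s‖ < τ ∧ ‖y - x‖ ≤ ε / 4 := by
    intro y hy
    have hyq := norm_sub_lt_of_mem_box hy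
    set z := q + (1 / l) • (y - q') with hz
    have hzq : ‖z - q‖ < σ := by
      rw [hz, add_sub_cancel_left, norm_smul, Real.norm_of_nonneg (by positivity),
        one_div_mul_eq_div, div_lt_iff₀ hl0]
      linarith
    have hzc : z ∈ unitCube D :=
      mem_unitCube_of_near_inward hD (s := s) (s' := s) (t := 0) (e := 0)
        hτκ (h.subset_cube hs) (by simp) (by simp) (by rw [add_zero]) (by rwa [zero_add])
    have hzs : ‖z - s‖ < τ := by
      have : z - s = (z - q) + (q - s) := by abel
      rw [this]
      refine (norm_add_le _ _).trans_lt ?_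
      linarith
    have hy' : y = (1 - l) • x + l • z := by
      rw [hz, hq', smul_add, smul_smul, mul_one_div_cancel hl0.ne', one_smul, sub_smul, one_smul,
        smul_sub]
      abel
    refine ⟨?_, ?_, ?_⟩
    · rw [hy']
      exact convex_unitCube hx.1 hzc (by linarith) hl0.le (by ring)
    · have hxb : x ∈ Metric.ball s τ := by rwa [Metric.mem_ball, dist_eq_norm]
      have hzb : z ∈ Metric.ball s τ := by rwa [Metric.mem_ball, dist_eq_norm]
      have := convex_ball s τ hxb hzb (by linarith : 0 ≤ 1 - l) hl0.le (by ring)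
      rwa [← hy', Metric.mem_ball, dist_eq_norm] at this
    · have : y - x = (y - q') + l • (q - x) := by rw [hq']; abel
      rw [this]
      refine (norm_add_le _ _).trans ?_
      rw [norm_smul, Real.norm_of_nonneg hl0.le]
      have f1 : l * ‖q - x‖ ≤ l * (2 * τ) := by gcongr
      have f2 : α ≤ c * ε := by
        rw [hα]; exact div_le_self hcε.le (by linarith)
      nlinarith
  refine ⟨box U q' α β, U, q', hU, (isOpen_box _ _ _ _).measurableSet, fun y hy => ?_,
    fun y hy => ⟨(hbox y hy).2.2, (hy.2.le).trans hβε⟩, ?_, ?_⟩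
  · refine ⟨(hbox y hy).1, ?_⟩
    have := Metric.infDist_le_dist_of_mem (x := y) hs
    rw [dist_eq_norm] at this
    linarith [(hbox y hy).2.1]
  · have hm : x - q' ∈ U := by
      have : x - q' = -(l • (q - x)) := by rw [hq']; abel
      rw [this]
      exact U.neg_mem (U.smul_mem _ hUq)
    rw [U.starProjection_eq_self_iff.2 hm, sub_self, norm_zero]; positivity
  · rw [volume_real_box hd hdD hU q' (by positivity) (by positivity)]
    have e1 : α = 1 / (51200 * κ * D ^ 2) * ε := by rw [hα, hc]; field_simp; norm_num
    have e2 : β = 1 / (51200 * κ * D ^ 2) * ε ^ 2 := by rw [hβ, hc]; field_simp; norm_num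
    rw [e1, e2, mul_pow _ ε, mul_pow _ (ε ^ 2)]
    exact le_of_eq (by ring)

/-- The flat must pass through x, possibly near the edge of the tube or of the cube, while an ε by
ε² box around it must stay inside. The tangent plane is therefore tilted so that going a tangential
distance ρ also leads from x to the inward point q. -/
lemma hasLocalRegion_of_medium (h : TangentSurface d κ S T) (hd : 1 ≤ d) (hdD : d + 1 ≤ D)
    {τ ε : ℝ} (hε : 0 < ε) (hε1 : ε ≤ 1) (hτ1 : ε ^ 2 / 4 ≤ τ)
    (hτε : τ ≤ ε / (400 * κ * D)) {x : Amb D} (hx : x ∈ tube S τ) :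
    HasLocalRegion d S τ ε x (unitBallVolume d * unitBallVolume (D - d)
      * (1 / (12800 * κ * D ^ 2)) ^ d * (1 / (128 * D)) ^ (D - d)
      * (ε ^ d * (ε ^ 2) ^ (D - d))) := by
  have hκ := h.pos
  have hκ1 := h.one_le
  have hD : 2 ≤ D := by omega
  have hD' : (2 : ℝ) ≤ D := by exact_mod_cast hD
  have hκD : (2 : ℝ) ≤ κ * D := by nlinarith
  have hτ : 0 < τ := lt_of_lt_of_le (by positivity) hτ1
  obtain ⟨s, hs, hxs⟩ := (Metric.infDist_lt_iff h.nonempty).1 hx.2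
  rw [dist_eq_norm] at hxs
  set ρ := ε / (100 * κ * D) with hρ
  have hρ0 : 0 < ρ := by positivity
  have hρε : ρ ≤ ε / 200 := by
    rw [hρ]; gcongr; linarith
  have hτρ : τ ≤ ρ / 4 := by
    have : ε / (400 * κ * D) = ρ / 4 := by rw [hρ]; field_simp; norm_num
    linarith
  set q := inward s τ with hq
  have hqs : ‖q - s‖ ≤ τ / 4 := norm_inward_sub_le s hτ.le
  have hqx : ‖q - x‖ ≤ 2 * τ := by
    have : q - x = (q - s) - (x - s) := by abel
    rw [this]
    refine (norm_sub_le _ _).trans ?_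
    linarith
  obtain ⟨t₀, ht₀T, ht₀⟩ : ∃ t₀ ∈ T s, ‖t₀‖ = ρ := by
    have : Nontrivial (T s) :=
      Module.nontrivial_of_finrank_pos (R := ℝ) (by rw [h.finrank_eq s hs]; omega)
    obtain ⟨v, hv⟩ := exists_norm_eq (T s) hρ0.le
    exact ⟨v, v.2, by simpa using hv⟩
  set f : Amb D → ℝ := fun t => inner ℝ t₀ t / ρ ^ 2 with hf
  have hf0 : f t₀ = 1 := by
    simp only [hf, real_inner_self_eq_norm_sq, ht₀]; field_simp
  have hfle : ∀ t, |f t| ≤ ‖t‖ / ρ := by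
    intro t
    simp only [hf, abs_div, abs_of_pos (by positivity : 0 < ρ ^ 2)]
    rw [div_le_div_iff₀ (by positivity) (by positivity)]
    have := abs_real_inner_le_norm t₀ t
    rw [ht₀] at this
    nlinarith
  -- The tilt: A t₀ = t₀ + (q - x), so x + A t₀ = q + t₀. Since ‖q - x‖ ≤ ρ / 2, A is close enough
  -- to the identity to be injective.
  set A : Amb D →ₗ[ℝ] Amb D := LinearMap.id
    + ((1 / ρ ^ 2) • (innerₛₗ ℝ t₀)).smulRight (q - x) with hA
  have hAt : ∀ t, A t = t + f t • (q - x) := by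
    intro t
    simp [hA, hf, div_eq_inv_mul]
  have hAle : ∀ t, ‖t‖ ≤ 2 * ‖A t‖ := by
    intro t
    have e1 : t = A t - f t • (q - x) := by rw [hAt]; abel
    have e2 : ‖f t • (q - x)‖ ≤ ‖t‖ / 2 := by
      rw [norm_smul, Real.norm_eq_abs]
      calc |f t| * ‖q - x‖ ≤ ‖t‖ / ρ * (2 * τ) := by gcongr; exact hfle t
        _ ≤ ‖t‖ / ρ * (2 * (ρ / 4)) := by gcongr
        _ = ‖t‖ / 2 := by field_simp; norm_num
    have e3 : ‖t‖ ≤ ‖A t‖ + ‖f t • (q - x)‖ := by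
      calc ‖t‖ = ‖A t - f t • (q - x)‖ := by rw [← e1]
        _ ≤ _ := norm_sub_le _ _
    linarith
  set B : T s →ₗ[ℝ] Amb D := A.comp (T s).subtype with hB
  have hBinj : Function.Injective B := by
    rw [injective_iff_map_eq_zero]
    intro t ht
    have := hAle t
    have h0 : A (t : Amb D) = 0 := ht
    rw [h0, norm_zero, mul_zero] at this
    exact Subtype.ext (norm_le_zero_iff.1 this)
  set U := LinearMap.range B with hU
  have hUd : Module.finrank ℝ U = d := by
    rw [hU, LinearMap.finrank_range_of_inj hBinj, h.finrank_eq s hs]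
  set y₀ := x + A t₀ with hy₀
  set α := ρ / (128 * D) with hα
  set β := ε ^ 2 / (128 * D) with hβ
  have hα0 : 0 < α := by positivity
  have hαρ : 2 * α ≤ ρ := by
    rw [hα, ← mul_div_assoc, div_le_iff₀ (by positivity)]; nlinarith
  have hβτ : β ≤ τ / (32 * D) := by
    rw [hβ, div_le_div_iff₀ (by positivity) (by positivity)]; nlinarith
  have hbox : ∀ y ∈ box U y₀ α β, ∃ t ∈ T s, ‖t‖ ≤ 2 * ρ ∧
      ‖y - (q + t)‖ ≤ τ / (16 * D) := by
    intro y hy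
    obtain ⟨t', ht'⟩ : U.starProjection (y - y₀) ∈ LinearMap.range B :=
      U.starProjection_apply_mem _
    have ht'A : A t' = U.starProjection (y - y₀) := ht'
    have h1 : ‖(t' : Amb D)‖ ≤ 2 * α := by
      refine (hAle t').trans ?_
      rw [ht'A]; linarith [hy.1]
    refine ⟨t₀ + t', (T s).add_mem ht₀T t'.2, (norm_add_le _ _).trans (by linarith), ?_⟩
    set w := y - y₀ - U.starProjection (y - y₀) with hw
    have e1 : y - (q + (t₀ + t')) = f t' • (q - x) + w := by
      have : y = w + y₀ + A t' := by rw [hw, ht'A]; abel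
      rw [this, hy₀, hAt, hAt, hf0, one_smul]; abel
    rw [e1]
    refine (norm_add_le _ _).trans ?_
    have e2 : ‖f t' • (q - x)‖ ≤ τ / (32 * D) := by
      rw [norm_smul, Real.norm_eq_abs]
      calc |f t'| * ‖q - x‖ ≤ (2 * α) / ρ * (2 * τ) := by
            gcongr
            exact (hfle t').trans (by gcongr)
        _ = τ / (32 * D) := by rw [hα]; field_simp; norm_num
    have e3 : ‖w‖ < β := hy.2
    have e4 : τ / (16 * D) = τ / (32 * D) + τ / (32 * D) := by field_simp; norm_num
    linarith
  have hτD : τ / (16 * D) ≤ τ / 32 := by gcongr; linarith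
  -- The lower bound on τ enters here: the deviation of S from its tangent plane at scale ρ is of
  -- order ε², small compared with the inward shift τ / (4D).
  have hcurv : ∀ t : Amb D, ‖t‖ ≤ 2 * ρ → 20 * κ * ‖t‖ ^ 2 ≤ τ / (16 * D) := by
    intro t ht
    calc 20 * κ * ‖t‖ ^ 2 ≤ 20 * κ * (2 * ρ) ^ 2 := by gcongr
      _ = ε ^ 2 / (125 * κ * D ^ 2) := by rw [hρ]; field_simp; norm_num
      _ ≤ (4 * τ) / (125 * κ * D ^ 2) := by gcongr; linarith
      _ ≤ τ / (16 * D) := by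
          rw [div_le_div_iff₀ (by positivity) (by positivity)]
          have : τ * D * 2 ≤ τ * D * (κ * D) := by gcongr
          nlinarith [mul_pos hτ (by positivity : (0 : ℝ) < D)]
  have hfin : ∀ y ∈ box U y₀ α β, y ∈ tube S τ ∧ ‖y - x‖ ≤ ε / 4 := by
    intro y hy
    obtain ⟨t, htT, ht, hyt⟩ := hbox y hy
    obtain ⟨s', hs', hst⟩ := h.toTangentField.exists_near hκ hs htT (by
      calc 40 * κ * ‖t‖ ≤ 40 * κ * (2 * ρ) := by gcongr
        _ = 4 * ε / (5 * D) := by rw [hρ]; field_simp; norm_num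
        _ ≤ 1 := by rw [div_le_one (by positivity)]; nlinarith)
    have hst' := hst.trans (hcurv t ht)
    refine ⟨⟨?_, ?_⟩, ?_⟩
    · refine mem_unitCube_of_near_inward hD (by linarith) (h.subset_cube hs') (by linarith)
        hst' hyt ?_
      have e4 : τ / (4 * D) = 2 * (τ / (16 * D) + τ / (16 * D)) := by field_simp; norm_num
      have : 0 < τ / (16 * D) := by positivity
      linarith
    · refine (Metric.infDist_le_dist_of_mem hs').trans_lt ?_
      rw [dist_eq_norm]
      have : y - s' = (y - (q + t)) + (q - s) - (s' - s - t) := by abel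
      rw [this]
      have f1 := norm_sub_le ((y - (q + t)) + (q - s)) (s' - s - t)
      have f2 := norm_add_le (y - (q + t)) (q - s)
      linarith
    · have : y - x = (y - (q + t)) + (q - x) + t := by abel
      rw [this]
      have f1 := norm_add_le ((y - (q + t)) + (q - x)) t
      have f2 := norm_add_le (y - (q + t)) (q - x)
      linarith
  refine ⟨box U y₀ α β, U, y₀, hUd, (isOpen_box _ _ _ _).measurableSet, fun y hy => (hfin y hy).1,
    fun y hy => ⟨(hfin y hy).2, hy.2.le.trans ?_⟩, ?_, ?_⟩
  · rw [hβ]; gcongr; linarith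
  · have hm : x - y₀ ∈ U := by
      have : x - y₀ = -A t₀ := by rw [hy₀]; abel
      rw [this]
      exact U.neg_mem ⟨⟨t₀, ht₀T⟩, rfl⟩
    rw [U.starProjection_eq_self_iff.2 hm, sub_self, norm_zero]; positivity
  · rw [volume_real_box hd hdD hUd y₀ hα0.le (by positivity)]
    have e1 : α = 1 / (12800 * κ * D ^ 2) * ε := by rw [hα, hρ]; field_simp; norm_num
    have e2 : β = 1 / (128 * D) * ε ^ 2 := by rw [hβ]; field_simp
    rw [e1, e2, mul_pow _ ε, mul_pow _ (ε ^ 2)]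
    exact le_of_eq (by ring)

end TangentSurface

lemma HasLocalRegion.mono {τ ε v w : ℝ} {x : Amb D} (h : HasLocalRegion d S τ ε x v)
    (hw : w ≤ v) : HasLocalRegion d S τ ε x w := by
  obtain ⟨R, U, y₀, h1, h2, h3, h4, h5, h6⟩ := h
  exact ⟨R, U, y₀, h1, h2, h3, h4, h5, hw.trans h6⟩

lemma exists_hasLocalRegion (d D : ℕ) (hd : 1 ≤ d) (hdD : d + 1 ≤ D) (κ : ℝ) (hκ : 1 ≤ κ) :
    ∃ c > 0, ∀ (S : Set (Amb D)) (T : Amb D → Submodule ℝ (Amb D)), TangentSurface d κ S T →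
      ∀ τ ε, 0 < τ → τ ≤ 1 → 0 < ε → 10 * κ * ε ≤ 1 → ∀ x ∈ tube S τ,
        HasLocalRegion d S τ ε x (c * (ε ^ d * min τ (ε ^ 2) ^ (D - d))) := by
  have hκ0 : 0 < κ := one_pos.trans_le hκ
  have hD0 : (0 : ℝ) < D := by exact_mod_cast (by omega : 0 < D)
  have hωd := unitBallVolume_pos d
  have hωe := unitBallVolume_pos (D - d)
  have hωD := unitBallVolume_pos D
  set c₁ := (1 / (2400 * κ * D)) ^ d / 4 ^ (D - d) * unitBallVolume D * (1 / (8 * D)) ^ D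
  set c₂ := unitBallVolume d * unitBallVolume (D - d)
      * (1 / (51200 * κ * D ^ 2)) ^ d * (1 / (51200 * κ * D ^ 2)) ^ (D - d)
  set c₃ := unitBallVolume d * unitBallVolume (D - d)
      * (1 / (12800 * κ * D ^ 2)) ^ d * (1 / (128 * D)) ^ (D - d)
  have h1 : 0 < c₁ := by positivity
  have h2 : 0 < c₂ := by positivity
  have h3 : 0 < c₃ := by positivity
  refine ⟨min c₁ (min c₂ c₃), by positivity, fun S T h τ ε hτ hτ1 hε hεκ x hx => ?_⟩
  have hε1 : ε ≤ 1 := by nlinarith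
  have hm0 : 0 < min τ (ε ^ 2) := by positivity
  rcases le_total τ (ε ^ 2 / 4) with ha | ha
  · refine (h.hasLocalRegion_of_thin hd hdD hτ hε hεκ ha hx).mono ?_
    gcongr
    · exact min_le_left _ _
    · exact min_le_left _ _
  rcases le_total τ (ε / (400 * κ * D)) with hb | hb
  · refine (h.hasLocalRegion_of_medium hd hdD hε hε1 ha hb hx).mono ?_
    gcongr
    · exact (min_le_right _ _).trans (min_le_right _ _)
    · exact min_le_right _ _
  · refine (h.hasLocalRegion_of_thick hd hdD hτ hτ1 hε hε1 hb hx).mono ?_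
    gcongr
    · exact (min_le_right _ _).trans (min_le_left _ _)
    · exact min_le_right _ _

end LocalRegion
end HOSC
end

noncomputable section
namespace HOSC

/-! ### Chernoff bounds for counts of independent points. -/

section Count

variable {ι E : Type*} [Fintype ι]

open Classical in
/-- The number of indices `j ∈ J` with `x j ∈ A`. -/
def count (J : Finset ι) (A : Set E) (x : ι → E) : ℕ := (J.filter fun j => x j ∈ A).card

open Classical in
lemma exp_mul_count (s : ℝ) (J : Finset ι) (A : Set E) (x : ι → E) :
    Real.exp (s * count J A x)
      = ∏ i, (if i ∈ J then 1 + A.indicator (fun _ => Real.exp s - 1) (x i) else 1) := by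
  rw [Finset.prod_ite_mem, Finset.univ_inter, count, Finset.card_filter, Nat.cast_sum,
    Finset.mul_sum, Real.exp_sum]
  refine Finset.prod_congr rfl fun j _ => ?_
  by_cases h : x j ∈ A <;> simp [h]

variable [MeasurableSpace E] (μ : ι → Measure E) [∀ i, IsProbabilityMeasure (μ i)] {A : Set E}

lemma integrable_exp_mul_count (s : ℝ) (J : Finset ι) (hA : MeasurableSet A) :
    Integrable (fun x => Real.exp (s * count J A x)) (Measure.pi μ) := by
  classical
  simp_rw [exp_mul_count]
  refine Integrable.fintype_prod (μ := μ)
    (f := fun i y => if i ∈ J then 1 + A.indicator (fun _ => Real.exp s - 1) y else 1) fun i => ?_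
  split_ifs
  · exact (integrable_const _).add ((integrable_const _).indicator hA)
  · exact integrable_const _

lemma mgf_count (s : ℝ) (J : Finset ι) (hA : MeasurableSet A) :
    ProbabilityTheory.mgf (fun x => (count J A x : ℝ)) (Measure.pi μ) s
      = ∏ j ∈ J, (1 + (Real.exp s - 1) * (μ j).real A) := by
  classical
  unfold ProbabilityTheory.mgf
  simp_rw [exp_mul_count]
  rw [integral_fintype_prod_eq_prod
    (f := fun i y => if i ∈ J then 1 + A.indicator (fun _ => Real.exp s - 1) y else 1)]
  rw [← Finset.univ_inter J, ← Finset.prod_ite_mem]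
  refine Finset.prod_congr rfl fun i _ => ?_
  by_cases h : i ∈ J
  · simp only [h, if_true, Finset.univ_inter]
    rw [integral_add (integrable_const _) ((integrable_const _).indicator hA),
      integral_indicator hA]
    simp [mul_comm]
  · simp [h]

/-- Chernoff with parameter 1, using e - 1 ≤ 2. -/
lemma measure_count_ge_le (hA : MeasurableSet A) (J : Finset ι) {p : ℝ}
    (hp : ∀ j ∈ J, (μ j).real A ≤ p) (k : ℝ) :
    (Measure.pi μ).real {x | k ≤ count J A x} ≤ Real.exp (2 * (J.card * p) - k) := by
  have h1 := ProbabilityTheory.measure_ge_le_exp_mul_mgf (μ := Measure.pi μ)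
    (X := fun x => (count J A x : ℝ)) k zero_le_one (integrable_exp_mul_count μ 1 J hA)
  refine h1.trans ?_
  rw [mgf_count μ 1 J hA, show 2 * (J.card * p) - k = -1 * k + J.card * (2 * p) by ring,
    Real.exp_add]
  gcongr
  rw [Real.exp_nat_mul]
  have he : Real.exp 1 - 1 ≤ 2 := by
    have := Real.exp_one_lt_d9
    norm_num at this ⊢
    linarith
  have he0 : 0 ≤ Real.exp 1 - 1 := by
    have := Real.add_one_le_exp (1 : ℝ)
    linarith
  calc ∏ j ∈ J, (1 + (Real.exp 1 - 1) * (μ j).real A) ≤ ∏ _j ∈ J, Real.exp (2 * p) := by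
        refine Finset.prod_le_prod (fun j _ => by positivity) fun j hj => ?_
        have h2 := hp j hj
        have h3 : (0 : ℝ) ≤ (μ j).real A := measureReal_nonneg
        have h4 : (Real.exp 1 - 1) * (μ j).real A ≤ 2 * p := by nlinarith
        have := Real.add_one_le_exp (2 * p)
        linarith
    _ = Real.exp (2 * p) ^ J.card := by rw [Finset.prod_const]

/-- Chernoff with parameter -1, using 1 - 1/e ≥ 1/2. -/
lemma measure_count_le_le (hA : MeasurableSet A) (J : Finset ι) {p : ℝ} (hp0 : 0 ≤ p)
    (hp : ∀ j ∈ J, p ≤ (μ j).real A) (k : ℝ) :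
    (Measure.pi μ).real {x | (count J A x : ℝ) ≤ k} ≤ Real.exp (k - J.card * p / 2) := by
  have h1 := ProbabilityTheory.measure_le_le_exp_mul_mgf (μ := Measure.pi μ)
    (X := fun x => (count J A x : ℝ)) k (by norm_num : (-1 : ℝ) ≤ 0)
    (integrable_exp_mul_count μ (-1) J hA)
  refine h1.trans ?_
  rw [mgf_count μ (-1) J hA, show k - J.card * p / 2 = - -1 * k + J.card * (-(p / 2)) by ring,
    Real.exp_add]
  gcongr
  rw [Real.exp_nat_mul]
  have he : Real.exp (-1) ≤ 1 / 2 := by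
    rw [Real.exp_neg, ← one_div]
    apply one_div_le_one_div_of_le two_pos
    have := Real.add_one_le_exp (1 : ℝ)
    linarith
  calc ∏ j ∈ J, (1 + (Real.exp (-1) - 1) * (μ j).real A) ≤ ∏ _j ∈ J, Real.exp (-(p / 2)) := by
        refine Finset.prod_le_prod (fun j _ => ?_) fun j hj => ?_
        · have h3 : (μ j).real A ≤ 1 := measureReal_le_one
          have h4 : (0 : ℝ) ≤ (μ j).real A := measureReal_nonneg
          have := Real.exp_pos (-1)
          nlinarith
        · have h2 := hp j hj
          have := Real.add_one_le_exp (-(p / 2))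
          nlinarith
    _ = Real.exp (-(p / 2)) ^ J.card := by rw [Finset.prod_const]

lemma ae_pi_ne [MeasurableEq E] {i j : ι} (hij : i ≠ j) (hμ : ∀ y, μ j {y} = 0) :
    ∀ᵐ x ∂Measure.pi μ, x i ≠ x j := by
  have hind : ProbabilityTheory.IndepFun (fun x : ι → E => x i) (fun x => x j) (Measure.pi μ) :=
    (ProbabilityTheory.iIndepFun_pi (X := fun _ => id) fun i => aemeasurable_id).indepFun hij
  have hmap := (ProbabilityTheory.indepFun_iff_map_prod_eq_prod_map_map
    (measurable_pi_apply i).aemeasurable (measurable_pi_apply j).aemeasurable).1 hind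
  rw [(measurePreserving_eval μ i).map_eq, (measurePreserving_eval μ j).map_eq] at hmap
  have hmeas : MeasurableSet {p : E × E | p.1 = p.2} :=
    measurableSet_eq_fun measurable_fst measurable_snd
  have h0 : (μ i).prod (μ j) {p : E × E | p.1 = p.2} = 0 := by
    rw [Measure.measure_prod_null hmeas]
    refine Eventually.of_forall fun y => ?_
    have : Prod.mk y ⁻¹' {p : E × E | p.1 = p.2} = {y} := by
      ext z; simp [eq_comm]
    change μ j (Prod.mk y ⁻¹' {p : E × E | p.1 = p.2}) = 0
    rw [this, hμ]
  rw [← hmap, Measure.map_apply ((measurable_pi_apply i).prodMk (measurable_pi_apply j)) hmeas]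
    at h0
  rw [ae_iff]
  simpa using h0

lemma ae_pi_mem {r : ι → Set E} (h : ∀ i, ∀ᵐ y ∂μ i, y ∈ r i) :
    ∀ᵐ x ∂Measure.pi μ, ∀ i, x i ∈ r i := by
  rw [eventually_countable_forall]
  exact fun i => (measurePreserving_eval μ i).quasiMeasurePreserving.ae (h i)

end Count
end HOSC
end

noncomputable section
namespace HOSC

/-! ### Nets by rounding coordinates. -/

section Net

/-- A bounded set with `Fintype.card ι` real coordinates has a net of mesh `δ` with polynomially
many points. -/
lemma exists_net {X ι : Type*} [Fintype ι] (c : X → ι → ℝ) {Q : Set X} {B δ : ℝ} (hδ : 0 < δ)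
    (hQ : ∀ q ∈ Q, ∀ i, |c q i| ≤ B) {M : ℕ} (hM : 2 * B / δ < M) :
    ∃ F : Finset X, ↑F ⊆ Q ∧ F.card ≤ M ^ Fintype.card ι ∧
      ∀ q ∈ Q, ∃ f ∈ F, ∀ i, |c q i - c f i| ≤ δ := by
  classical
  have hlt : ∀ q ∈ Q, ∀ i, ⌊(c q i + B) / δ⌋₊ < M := by
    intro q hq i
    have h1 := abs_le.1 (hQ q hq i)
    rw [Nat.floor_lt (div_nonneg (by linarith) hδ.le)]
    refine lt_of_le_of_lt ?_ hM
    gcongr; linarith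
  set cell : Q → ι → Fin M := fun q i => ⟨⌊(c q i + B) / δ⌋₊, hlt q q.2 i⟩ with hcell
  rcases isEmpty_or_nonempty Q with hemp | hne
  · exact ⟨∅, by simp, by simp, fun q hq => (hemp.false ⟨q, hq⟩).elim⟩
  -- One representative per cell; for an empty cell `invFun` returns an arbitrary element of Q,
  -- which is harmless.
  set F : Finset X := Finset.univ.image fun g : ι → Fin M => ((Function.invFun cell g : Q) : X) with hF
  refine ⟨F, ?_, ?_, ?_⟩
  · intro f hf
    obtain ⟨g, -, rfl⟩ := Finset.mem_image.1 hf
    exact (Function.invFun cell g : Q).2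
  · refine Finset.card_image_le.trans ?_
    simp
  · intro q hq
    refine ⟨((Function.invFun cell (cell ⟨q, hq⟩) : Q) : X), Finset.mem_image.2 ⟨_, Finset.mem_univ _, rfl⟩,
      fun i => ?_⟩
    set f : Q := Function.invFun cell (cell ⟨q, hq⟩) with hf
    have h1 : cell f = cell ⟨q, hq⟩ := Function.invFun_eq ⟨⟨q, hq⟩, rfl⟩
    have h2 : ⌊(c f i + B) / δ⌋₊ = ⌊(c q i + B) / δ⌋₊ := congrArg Fin.val (congrFun h1 i)
    have hq1 := abs_le.1 (hQ q hq i)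
    have hf1 := abs_le.1 (hQ f f.2 i)
    have h3 := Nat.floor_le (div_nonneg (by linarith : 0 ≤ c q i + B) hδ.le)
    have h4 := Nat.lt_floor_add_one ((c q i + B) / δ)
    have h5 := Nat.floor_le (div_nonneg (by linarith : 0 ≤ c f i + B) hδ.le)
    have h6 := Nat.lt_floor_add_one ((c f i + B) / δ)
    rw [h2] at h5 h6
    have h7 : |(c q i + B) / δ - (c f i + B) / δ| ≤ 1 := by
      rw [abs_le]; constructor <;> linarith
    rw [← sub_div, abs_div, abs_of_pos hδ, div_le_one hδ] at h7
    have : c q i + B - (c f i + B) = c q i - c f i := by ring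
    rwa [this] at h7

lemma norm_le_of_forall_abs_le {D : ℕ} {v : Amb D} {δ : ℝ} (hδ : 0 ≤ δ) (h : ∀ j, |v j| ≤ δ) :
    ‖v‖ ≤ D * δ := by
  have h1 : ‖v‖ ^ 2 ≤ D * δ ^ 2 := by
    rw [EuclideanSpace.norm_sq_eq]
    calc _ ≤ ∑ _i : Fin D, δ ^ 2 := by
          refine Finset.sum_le_sum fun i _ => ?_
          have := h i
          rw [Real.norm_eq_abs]; gcongr
      _ = _ := by simp
  have h2 : (D : ℝ) * δ ^ 2 ≤ (D * δ) ^ 2 := by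
    rcases Nat.eq_zero_or_pos D with h0 | h0
    · simp [h0]
    · have : (1 : ℝ) ≤ D := by exact_mod_cast h0
      rw [mul_pow]; gcongr; nlinarith
  exact le_of_sq_le_sq (h1.trans h2) (by positivity)

end Net

/-! ### Flats, frames and a net of boxes. -/

section Flatness

variable {D d : ℕ}

lemma norm_sub_starProjection_le_of_mem {U : Submodule ℝ (Amb D)} {z w : Amb D} (hw : w ∈ U) :
    ‖z - U.starProjection z‖ ≤ ‖z - w‖ := by
  have e : z - U.starProjection z = Uᗮ.starProjection (z - w) := by
    rw [Submodule.starProjection_orthogonal_val, map_sub, U.starProjection_eq_self_iff.2 hw]; abel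
  rw [e]
  exact Uᗮ.norm_starProjection_apply_le _

lemma flatness_nonneg {n : ℕ} (x : Fin n → Amb D) : 0 ≤ flatness d x :=
  Real.iInf_nonneg fun _ => Real.iSup_nonneg fun _ => Metric.infDist_nonneg

lemma flatness_le {n : ℕ} [Nonempty (Fin n)] {x : Fin n → Amb D} {U : Submodule ℝ (Amb D)}
    (hU : Module.finrank ℝ U = d) (y₀ : Amb D) {c : ℝ}
    (h : ∀ j, ‖x j - y₀ - U.starProjection (x j - y₀)‖ ≤ c) : flatness d x ≤ c := by
  have hmem : ((AffineSubspace.mk' y₀ U : AffineSubspace ℝ (Amb D)) : Set (Amb D)).Nonempty ∧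
      Module.finrank ℝ (AffineSubspace.mk' y₀ U).direction = d :=
    ⟨⟨y₀, AffineSubspace.self_mem_mk' y₀ U⟩, by rw [AffineSubspace.direction_mk', hU]⟩
  refine (ciInf_le ⟨0, ?_⟩ (⟨AffineSubspace.mk' y₀ U, hmem⟩ : {L : AffineSubspace ℝ (Amb D) //
      (L : Set (Amb D)).Nonempty ∧ Module.finrank ℝ L.direction = d})).trans ?_
  · rintro _ ⟨L, rfl⟩
    exact Real.iSup_nonneg fun _ => Metric.infDist_nonneg
  · refine ciSup_le fun j => ?_
    refine (Metric.infDist_le_dist_of_mem (y := U.starProjection (x j - y₀) +ᵥ y₀) ?_).trans ?_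
    · exact AffineSubspace.vadd_mem_mk' y₀ (U.starProjection_apply_mem _)
    · rw [dist_eq_norm, vadd_eq_add, sub_add_eq_sub_sub_swap]
      exact h j

lemma exists_frame_of_flatness_lt (hdD : d ≤ D) {n : ℕ} {x : Fin n → Amb D} {η : ℝ}
    (h : flatness d x < η) (i : Fin n) : ∃ (a : Amb D) (e : Fin d → Amb D), Orthonormal ℝ e ∧
      ‖x i - a‖ < η ∧ ∀ j, ∃ t : Fin d → ℝ, (∀ k, |t k| ≤ ‖x j - a‖) ∧
        ‖x j - a - ∑ k, t k • e k‖ < η := by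
  -- An infimum over an empty family would be 0 and yield no flat; d ≤ D excludes this.
  have hne : Nonempty {L : AffineSubspace ℝ (Amb D) //
      (L : Set (Amb D)).Nonempty ∧ Module.finrank ℝ L.direction = d} := by
    obtain ⟨U, hU⟩ : ∃ U : Submodule ℝ (Amb D), Module.finrank ℝ U = d := by
      have hb := (EuclideanSpace.basisFun (Fin D) ℝ).orthonormal.comp (Fin.castLE hdD)
        (Fin.castLE_injective hdD)
      exact ⟨Submodule.span ℝ (Set.range ((EuclideanSpace.basisFun (Fin D) ℝ) ∘ Fin.castLE hdD)),
        by rw [finrank_span_eq_card hb.linearIndependent, Fintype.card_fin]⟩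
    exact ⟨AffineSubspace.mk' 0 U, ⟨0, AffineSubspace.self_mem_mk' 0 U⟩,
      by rw [AffineSubspace.direction_mk', hU]⟩
  obtain ⟨⟨L, hL, hLd⟩, hlt⟩ := exists_lt_of_ciInf_lt h
  have hj : ∀ j, Metric.infDist (x j) (L : Set (Amb D)) < η := fun j =>
    (le_ciSup (Set.finite_range fun j => Metric.infDist (x j) (L : Set (Amb D))).bddAbove j).trans_lt
      hlt
  obtain ⟨a, ha, hai⟩ := (Metric.infDist_lt_iff hL).1 (hj i)
  set b := (stdOrthonormalBasis ℝ L.direction).reindex (finCongr hLd) with hb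
  set e : Fin d → Amb D := fun k => (b k : Amb D) with he
  refine ⟨a, e, ?_, by rwa [← dist_eq_norm], fun j => ?_⟩
  · exact b.orthonormal.comp_linearIsometry L.direction.subtypeₗᵢ
  · obtain ⟨y, hy, hjy⟩ := (Metric.infDist_lt_iff hL).1 (hj j)
    refine ⟨fun k => inner ℝ (e k) (x j - a), fun k => ?_, ?_⟩
    · have h1 := abs_real_inner_le_norm (e k) (x j - a)
      have h2 : ‖e k‖ = 1 := b.norm_eq_one k
      rwa [h2, one_mul] at h1
    · have h3 : ∑ k, inner ℝ (e k) (x j - a) • e k = L.direction.starProjection (x j - a) := by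
        have h4 := b.sum_repr (L.direction.orthogonalProjectionOnto (x j - a))
        have h5 := congrArg (Submodule.subtype L.direction) h4
        rw [map_sum] at h5
        rw [Submodule.starProjection_apply, ← Submodule.subtype_apply, ← h5]
        refine Finset.sum_congr rfl fun k _ => ?_
        rw [map_smul, b.repr_apply_apply, Submodule.coe_inner,
          Submodule.coe_orthogonalProjectionOnto_apply,
          ← inner_eq_inner_starProjection (b k).2]
        rfl
      rw [h3]
      refine (norm_sub_starProjection_le_of_mem
        (AffineSubspace.vsub_mem_direction hy ha)).trans_lt ?_
      rw [vsub_eq_sub, sub_sub_sub_cancel_right, ← dist_eq_norm]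
      exact hjy

/-- The box around a base point along the span of a frame. -/
def frameBox (f : Amb D × (Fin d → Amb D)) (α β : ℝ) : Set (Amb D) :=
  box (Submodule.span ℝ (Set.range f.2)) f.1 α β

/-- Polynomially many boxes around flats contain all thin clouds of points. -/
lemma exists_flat_net (hdD : d ≤ D) {ε η : ℝ} (hη : 0 < η) (hηε : η ≤ ε) (hε : ε ≤ 1 / 4) {M : ℕ}
    (hM : 2 * (D + 1) * (D * (d + 1) + 1) / η < M) :
    ∃ F : Finset (Amb D × (Fin d → Amb D)), F.card ≤ M ^ ((d + 1) * D) ∧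
      (∀ f ∈ F, Orthonormal ℝ f.2) ∧
      ∀ (n : ℕ) (x : Fin n → Amb D) (i : Fin n), x i ∈ unitCube D → flatness d x < η →
        (∀ j, ‖x j - x i‖ ≤ ε) → ∃ f ∈ F, ∀ j, x j ∈ frameBox f (4 * ε) (3 * η) := by
  set c : Amb D × (Fin d → Amb D) → Option (Fin d) × Fin D → ℝ :=
    fun f p => (p.1.elim f.1 f.2 : Amb D) p.2 with hc
  -- Rounding moves the base point and each of the d frame vectors by at most D δ. As the frame
  -- coefficients are at most 1, the total normal error is at most D (d + 1) δ ≤ η.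
  set δ := η / (D * (d + 1) + 1) with hδ
  have hδ0 : 0 < δ := by positivity
  have hDδ : D * δ * (d + 1) ≤ η := by
    rw [hδ, mul_div_assoc', div_mul_eq_mul_div, div_le_iff₀ (by positivity)]
    nlinarith
  have hDδ1 : (D : ℝ) * δ ≤ η := by
    have : (0 : ℝ) ≤ D * δ * d := by positivity
    nlinarith
  obtain ⟨F, hFQ, hFc, hF⟩ := exists_net c
    (Q := {f | ‖f.1‖ ≤ D + 1 ∧ Orthonormal ℝ f.2}) (B := D + 1) hδ0 (by
      rintro ⟨a, e⟩ ⟨ha, he⟩ ⟨k, j⟩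
      cases k with
      | none => exact (PiLp.norm_apply_le a j).trans ha
      | some k =>
        refine (PiLp.norm_apply_le (e k) j).trans ?_
        rw [he.1 k]
        have : (0 : ℝ) ≤ D := by positivity
        linarith) (M := M) (by
      refine lt_of_le_of_lt (le_of_eq ?_) hM
      rw [hδ]; field_simp)
  refine ⟨F, ?_, fun f hf => (hFQ hf).2, fun n x i hxi hflat hx => ?_⟩
  · have : Fintype.card (Option (Fin d) × Fin D) = (d + 1) * D := by simp
    rwa [this] at hFc
  obtain ⟨a, e, he, hai, ht⟩ := exists_frame_of_flatness_lt hdD hflat i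
  obtain ⟨f, hfF, hf⟩ := hF (a, e) ⟨by
    have h1 := norm_le_of_mem_unitCube hxi
    have h2 : ‖a‖ ≤ ‖x i‖ + ‖x i - a‖ := by
      have := norm_sub_le (x i) (x i - a)
      rwa [sub_sub_cancel] at this
    linarith, he⟩
  refine ⟨f, hfF, fun j => ?_⟩
  have ha : ‖a - f.1‖ ≤ D * δ :=
    norm_le_of_forall_abs_le hδ0.le fun l => hf (none, l)
  have hek : ∀ k, ‖e k - f.2 k‖ ≤ D * δ := fun k =>
    norm_le_of_forall_abs_le hδ0.le fun l => hf (some k, l)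
  obtain ⟨t, ht1, ht2⟩ := ht j
  have hja : ‖x j - a‖ ≤ 2 * ε := by
    have : x j - a = (x j - x i) + (x i - a) := by abel
    rw [this]
    refine (norm_add_le _ _).trans ?_
    linarith [hx j]
  have hjf : x j - f.1 = (x j - a) + (a - f.1) := by abel
  refine mem_box.2 ⟨?_, ?_⟩
  · refine (Submodule.norm_starProjection_apply_le _ _).trans_lt ?_
    rw [hjf]
    refine (norm_add_le _ _).trans_lt ?_
    linarith
  · have hw : ∑ k, t k • f.2 k ∈ Submodule.span ℝ (Set.range f.2) :=
      Submodule.sum_mem _ fun k _ => Submodule.smul_mem _ _ (Submodule.subset_span ⟨k, rfl⟩)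
    refine (norm_sub_starProjection_le_of_mem hw).trans_lt ?_
    have h1 : x j - f.1 - ∑ k, t k • f.2 k
        = (x j - a - ∑ k, t k • e k) + (a - f.1) + ∑ k, t k • (e k - f.2 k) := by
      simp only [smul_sub, Finset.sum_sub_distrib]; abel
    have h2 : ‖∑ k, t k • (e k - f.2 k)‖ ≤ d * (D * δ) := by
      calc _ ≤ ∑ k : Fin d, ‖t k • (e k - f.2 k)‖ := norm_sum_le _ _
        _ ≤ ∑ _k : Fin d, D * δ := by
            refine Finset.sum_le_sum fun k _ => ?_
            rw [norm_smul, Real.norm_eq_abs]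
            have : |t k| ≤ 1 := (ht1 k).trans (by linarith)
            calc |t k| * ‖e k - f.2 k‖ ≤ 1 * (D * δ) := by gcongr; exact hek k
              _ = _ := one_mul _
        _ = _ := by simp
    rw [h1]
    have h3 := norm_add_le ((x j - a - ∑ k, t k • e k) + (a - f.1)) (∑ k, t k • (e k - f.2 k))
    have h4 := norm_add_le (x j - a - ∑ k, t k • e k) (a - f.1)
    linarith

end Flatness
end HOSC
end

noncomputable section
namespace HOSC

/-! ### Combinatorial bounds for the degree. -/

section Degree

variable {D d : ℕ} {ε η : ℝ}

lemma simpleKernel_of_lt {s : ℝ} (h : |s| < 1) : simpleKernel s = 1 := if_pos h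

lemma simpleKernel_eq_zero {s : ℝ} (h : ¬ |s| < 1) : simpleKernel s = 0 := if_neg h

lemma simpleKernel_mem (s : ℝ) : simpleKernel s = 0 ∨ simpleKernel s = 1 := by
  unfold simpleKernel; split_ifs <;> simp

lemma affinity_mem {n : ℕ} (x : Fin n → Amb D) :
    affinity d ε η x = 0 ∨ affinity d ε η x = 1 := by
  unfold affinity
  split_ifs
  · rcases simpleKernel_mem (Metric.diam (Set.range x) / ε) with h | h <;>
      rcases simpleKernel_mem (flatness d x / η) with h' | h' <;> simp [h, h']
  · simp

lemma affinity_nonneg {n : ℕ} (x : Fin n → Amb D) : 0 ≤ affinity d ε η x := by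
  rcases affinity_mem (d := d) (ε := ε) (η := η) x with h | h <;> simp [h]

lemma affinity_le_one {n : ℕ} (x : Fin n → Amb D) : affinity d ε η x ≤ 1 := by
  rcases affinity_mem (d := d) (ε := ε) (η := η) x with h | h <;> simp [h]

lemma of_affinity_ne_zero (hε : 0 < ε) (hη : 0 < η) {n : ℕ} {x : Fin n → Amb D}
    (h : affinity d ε η x ≠ 0) : (∀ i j, ‖x i - x j‖ < ε) ∧ flatness d x < η := by
  have hinj : Function.Injective x := by
    by_contra hc
    exact h (if_neg hc)
  unfold affinity at h
  rw [if_pos hinj] at h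
  obtain ⟨h1, h2⟩ := mul_ne_zero_iff.1 h
  have h1' : |Metric.diam (Set.range x) / ε| < 1 := by
    by_contra hc; exact h1 (simpleKernel_eq_zero hc)
  have h2' : |flatness d x / η| < 1 := by
    by_contra hc; exact h2 (simpleKernel_eq_zero hc)
  rw [abs_div, abs_of_pos hε, div_lt_one hε] at h1'
  rw [abs_div, abs_of_pos hη, div_lt_one hη] at h2'
  refine ⟨fun i j => ?_, (le_abs_self _).trans_lt h2'⟩
  rw [← dist_eq_norm]
  exact (Metric.dist_le_diam_of_mem (Set.finite_range x).isBounded ⟨i, rfl⟩ ⟨j, rfl⟩).trans_lt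
    ((le_abs_self _).trans_lt h1')

lemma affinity_eq_one (hε : 0 < ε) (hη : 0 < η) {n : ℕ} [Nonempty (Fin n)] {x : Fin n → Amb D}
    (hinj : Function.Injective x) {c : ℝ} (hc0 : 0 ≤ c) (hc : c < ε)
    (hx : ∀ i j, ‖x i - x j‖ ≤ c) {U : Submodule ℝ (Amb D)} (hU : Module.finrank ℝ U = d)
    (y₀ : Amb D) {c' : ℝ} (hc' : c' < η)
    (h : ∀ j, ‖x j - y₀ - U.starProjection (x j - y₀)‖ ≤ c') : affinity d ε η x = 1 := by
  have h1 : Metric.diam (Set.range x) ≤ c := by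
    refine Metric.diam_le_of_forall_dist_le hc0 ?_
    rintro _ ⟨i, rfl⟩ _ ⟨j, rfl⟩
    rw [dist_eq_norm]; exact hx i j
  have h2 := flatness_le hU y₀ h
  unfold affinity
  rw [if_pos hinj, simpleKernel_of_lt, simpleKernel_of_lt, one_mul]
  · rw [abs_of_nonneg (div_nonneg (flatness_nonneg x) hη.le), div_lt_one hη]; linarith
  · rw [abs_of_nonneg (div_nonneg Metric.diam_nonneg hε.le), div_lt_one hε]; linarith

/-- The sum over j is merged with the others. With truncated subtraction m - 2 + 1 equals m - 1 once
m ≥ 2. -/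
lemma degree_eq_sum {N m : ℕ} (x : Fin N → Amb D) (i : Fin N) :
    degree d m ε η x i = ∑ p : Fin (m - 2 + 1) → Fin N,
      affinity d ε η (Matrix.vecCons (x i) fun t => x (p t)) := by
  rw [← (Fin.consEquiv fun _ : Fin (m - 2 + 1) => Fin N).sum_comp, Fintype.sum_prod_type]
  unfold degree similarity
  refine Finset.sum_congr rfl fun j _ => Finset.sum_congr rfl fun q _ => ?_
  congr 1
  funext t
  refine Fin.cases rfl (fun t => ?_) t
  refine Fin.cases rfl (fun t => ?_) t
  rfl

lemma degree_nonneg {N m : ℕ} (x : Fin N → Amb D) (i : Fin N) : 0 ≤ degree d m ε η x i := by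
  rw [degree_eq_sum]
  exact Finset.sum_nonneg fun p _ => affinity_nonneg _

lemma degree_le_of_cover {N m : ℕ} {x : Fin N → Amb D} {i : Fin N} {α : Type*} {F : Finset α}
    {C : α → Finset (Fin N)} {B : ℝ} (hC : ∀ f ∈ F, ((C f).card : ℝ) ≤ B)
    (h : ∀ p : Fin (m - 2 + 1) → Fin N,
      affinity d ε η (Matrix.vecCons (x i) fun t => x (p t)) ≠ 0 → ∃ f ∈ F, ∀ t, p t ∈ C f) :
    degree d m ε η x i ≤ F.card * B ^ (m - 2 + 1) := by
  classical
  rw [degree_eq_sum]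
  calc _ ≤ ∑ p : Fin (m - 2 + 1) → Fin N,
        if p ∈ F.biUnion (fun f => Fintype.piFinset fun _ => C f) then (1 : ℝ) else 0 := by
        refine Finset.sum_le_sum fun p _ => ?_
        split_ifs with hp
        · exact affinity_le_one _
        · by_contra! hne
          refine hp ?_
          obtain ⟨f, hf, hpf⟩ := h p hne.ne'
          exact Finset.mem_biUnion.2 ⟨f, hf, Fintype.mem_piFinset.2 hpf⟩
    _ = ((F.biUnion (fun f => Fintype.piFinset fun _ : Fin (m - 2 + 1) => C f)).card : ℝ) := by
        rw [Finset.sum_ite_mem, Finset.univ_inter]; simp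
    _ ≤ ∑ f ∈ F, ((Fintype.piFinset fun _ : Fin (m - 2 + 1) => C f).card : ℝ) := by
        exact_mod_cast Finset.card_biUnion_le
    _ ≤ ∑ _f ∈ F, B ^ (m - 2 + 1) := by
        refine Finset.sum_le_sum fun f hf => ?_
        rw [Fintype.card_piFinset_const]
        push_cast
        have := hC f hf
        gcongr
    _ = _ := by simp

/-- Every tuple of distinct indices from A has affinity 1. There are descending-factorially many,
which is at least the stated power. -/
lemma le_degree {N m : ℕ} {x : Fin N → Amb D} (hx : Function.Injective x) {i : Fin N}
    (hε : 0 < ε) (hη : 0 < η) {A : Finset (Fin N)} (hiA : i ∉ A) {c : ℝ} (hc : c < ε)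
    (hA : ∀ j ∈ insert i A, ∀ k ∈ insert i A, ‖x j - x k‖ ≤ c) {U : Submodule ℝ (Amb D)}
    (hU : Module.finrank ℝ U = d) (y₀ : Amb D) {c' : ℝ} (hc' : c' < η)
    (h : ∀ j ∈ insert i A, ‖x j - y₀ - U.starProjection (x j - y₀)‖ ≤ c') :
    (((A.card + 1 - (m - 2 + 1)) ^ (m - 2 + 1) : ℕ) : ℝ) ≤ degree d m ε η x i := by
  classical
  rw [degree_eq_sum]
  have hc0 : 0 ≤ c := by
    have := hA i (Finset.mem_insert_self _ _) i (Finset.mem_insert_self _ _)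
    simpa using this
  set G : Finset (Fin (m - 2 + 1) → Fin N) :=
    (Finset.univ : Finset (Fin (m - 2 + 1) ↪ A)).image fun g t => (g t : Fin N) with hG
  have hGc : G.card = A.card.descFactorial (m - 2 + 1) := by
    rw [hG, Finset.card_image_of_injective, Finset.card_univ, Fintype.card_embedding_eq]
    · simp
    · intro g g' hgg
      ext t
      exact congrArg Fin.val (congrFun hgg t)
  have hone : ∀ p ∈ G, affinity d ε η (Matrix.vecCons (x i) fun t => x (p t)) = 1 := by
    intro p hp
    obtain ⟨g, -, rfl⟩ := Finset.mem_image.1 hp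
    set idx : Fin (m - 2 + 1 + 1) → Fin N := Matrix.vecCons i fun t => (g t : Fin N) with hidx
    have hvec : (Matrix.vecCons (x i) fun t => x (g t)) = x ∘ idx := by
      funext t
      refine Fin.cases rfl (fun t => rfl) t
    have hmem : ∀ t, idx t ∈ insert i A := by
      intro t
      refine Fin.cases (Finset.mem_insert_self _ _) (fun t => ?_) t
      exact Finset.mem_insert_of_mem (g t).2
    have hidxinj : Function.Injective idx := by
      intro s t hst
      induction s using Fin.cases with
      | zero =>
        induction t using Fin.cases with
        | zero => rfl
        | succ t =>
          have : i = (g t : Fin N) := hst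
          exact absurd (this ▸ (g t).2) hiA
      | succ s =>
        induction t using Fin.cases with
        | zero =>
          have : (g s : Fin N) = i := hst
          exact absurd (this ▸ (g s).2) hiA
        | succ t =>
          have : (g s : Fin N) = g t := hst
          rw [g.injective (Subtype.ext this)]
    change affinity d ε η (Matrix.vecCons (x i) fun t => x (g t)) = 1
    rw [hvec]
    exact affinity_eq_one hε hη (hx.comp hidxinj) hc0 hc (fun s t => hA _ (hmem s) _ (hmem t)) hU y₀
      hc' fun t => h _ (hmem t)
  calc (((A.card + 1 - (m - 2 + 1)) ^ (m - 2 + 1) : ℕ) : ℝ) ≤ (G.card : ℝ) := by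
        rw [hGc]
        exact_mod_cast Nat.pow_sub_le_descFactorial _ _
    _ = ∑ p ∈ G, affinity d ε η (Matrix.vecCons (x i) fun t => x (p t)) := by
        rw [Finset.sum_congr rfl hone]; simp
    _ ≤ _ := Finset.sum_le_sum_of_subset_of_nonneg (Finset.subset_univ _)
        fun p _ _ => affinity_nonneg _

end Degree
end HOSC
end

noncomputable section
namespace HOSC

/-! ### Consequences of the slow growth of ρ, and the scales. -/

section Asymptotics

lemma tendsto_log_natCast : Tendsto (fun N : ℕ => Real.log N) atTop atTop :=
  Real.tendsto_log_atTop.comp tendsto_natCast_atTop_atTop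

/-- A sequence that is `o((log N)^q)` times `log N` is `o(N)`. -/
lemma eventually_scale_le {ρ : ℕ → ℝ} (hρ : Tendsto ρ atTop atTop) {q : ℝ}
    (hρ_slow : Asymptotics.IsLittleO atTop ρ fun N : ℕ => Real.log N ^ q) {s e : ℝ} (hs : 0 < s)
    (he : 0 < e) : ∀ᶠ N : ℕ in atTop, (ρ N * Real.log N / N) ^ e ≤ s := by
  have h1 : (fun N : ℕ => Real.log N ^ (q + 1)) =o[atTop] fun N : ℕ => (N : ℝ) := by
    have := (isLittleO_log_rpow_rpow_atTop (q + 1) (zero_lt_one)).comp_tendsto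
      tendsto_natCast_atTop_atTop
    refine this.congr (fun _ => rfl) fun N => ?_
    simp
  have h2 := h1.def (c := s ^ (1 / e)) (by positivity)
  filter_upwards [h2, hρ_slow.def zero_lt_one, tendsto_log_natCast.eventually_ge_atTop 1,
    hρ.eventually_ge_atTop 1, eventually_gt_atTop 0] with N h2 h3 h4 h5 h6
  have hN : (0 : ℝ) < N := by exact_mod_cast h6
  rw [Real.norm_of_nonneg (by positivity), Real.norm_of_nonneg (by positivity)] at h2
  rw [Real.norm_of_nonneg (by positivity), Real.norm_of_nonneg (by positivity), one_mul] at h3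
  have h7 : ρ N * Real.log N / N ≤ s ^ (1 / e) := by
    rw [div_le_iff₀ hN]
    refine le_trans ?_ h2
    rw [Real.rpow_add (by positivity), Real.rpow_one]
    gcongr
  calc _ ≤ (s ^ (1 / e)) ^ e := by
        refine Real.rpow_le_rpow (by positivity) h7 he.le
    _ = s := by rw [← Real.rpow_mul hs.le, one_div_mul_cancel he.ne', Real.rpow_one]

/-- After taking powers the claim reads const · ρ^(b/a) ≤ log N. With a = d and b = 2(D - d) this is
exactly what the growth condition on ρ provides. -/
lemma eventually_mul_le_rpow {ρ : ℕ → ℝ} (hρ : Tendsto ρ atTop atTop) {a b : ℝ} (ha : 0 < a)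
    (hb : 0 < b)
    (hρ_slow : Asymptotics.IsLittleO atTop ρ fun N : ℕ => Real.log N ^ (a / b)) (A : ℝ)
    (hA : 0 < A) :
    ∀ᶠ N : ℕ in atTop, A * ρ N ≤ (ρ N * Real.log N) ^ (a / (a + b)) := by
  set θ := a / (a + b) with hθ
  have hθ0 : 0 < θ := by positivity
  have hc : 0 < (A ^ (1 / θ)) ^ (-(a / b)) := by positivity
  filter_upwards [hρ_slow.def hc, tendsto_log_natCast.eventually_ge_atTop 1,
    hρ.eventually_ge_atTop 1] with N h3 h4 h5
  rw [Real.norm_of_nonneg (by positivity), Real.norm_of_nonneg (by positivity)] at h3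
  set ℓ := Real.log N
  have h6 : A ^ (1 / θ) * ρ N ^ (b / a) ≤ ℓ := by
    have h7 : ρ N ^ (b / a) ≤ ((A ^ (1 / θ)) ^ (-(a / b)) * ℓ ^ (a / b)) ^ (b / a) :=
      Real.rpow_le_rpow (by positivity) h3 (by positivity)
    have hab : a / b * (b / a) = 1 := by field_simp
    rw [Real.mul_rpow (by positivity) (by positivity), ← Real.rpow_mul (by positivity : 0 ≤ ℓ),
      hab, Real.rpow_one, ← Real.rpow_mul (by positivity), neg_mul, hab, Real.rpow_neg_one] at h7
    rw [inv_mul_eq_div, le_div_iff₀ (by positivity)] at h7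
    linarith
  have h8 : A ^ (1 / θ) * ρ N ^ (1 / θ) ≤ ρ N * ℓ := by
    have h9 : (1 / θ) = b / a + 1 := by rw [hθ]; field_simp; ring
    have : ρ N ^ (1 / θ) = ρ N ^ (b / a) * ρ N := by
      rw [h9, Real.rpow_add (by positivity), Real.rpow_one]
    rw [this, ← mul_assoc, mul_comm (ρ N)]
    gcongr
  calc A * ρ N = (A ^ (1 / θ) * ρ N ^ (1 / θ)) ^ θ := by
        rw [← Real.mul_rpow hA.le (by positivity), ← Real.rpow_mul (by positivity),
          one_div_mul_cancel hθ0.ne', Real.rpow_one]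
    _ ≤ _ := Real.rpow_le_rpow (by positivity) h8 hθ0.le

lemma eventually_sqrt_log_le {ρ : ℕ → ℝ} (hρ : Tendsto ρ atTop atTop) {q : ℝ} (hq : 0 ≤ q)
    (hρ_slow : Asymptotics.IsLittleO atTop ρ fun N : ℕ => Real.log N ^ q) :
    ∀ᶠ N : ℕ in atTop, 2 * √(Real.log (ρ N)) ≤ Real.log N := by
  filter_upwards [hρ_slow.def zero_lt_one, tendsto_log_natCast.eventually_ge_atTop (4 * q + 1),
    hρ.eventually_ge_atTop 1] with N h3 h4 h5
  set ℓ := Real.log N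
  have hℓ : 0 < ℓ := by linarith
  rw [Real.norm_of_nonneg (by positivity), Real.norm_of_nonneg (by positivity), one_mul] at h3
  have h6 : Real.log (ρ N) ≤ q * ℓ := by
    calc _ ≤ Real.log (ℓ ^ q) := Real.log_le_log (by positivity) h3
      _ = q * Real.log ℓ := Real.log_rpow hℓ _
      _ ≤ q * ℓ := by
        gcongr
        linarith [Real.log_le_sub_one_of_pos hℓ]
  have h7 : √(Real.log (ρ N)) ≤ ℓ / 2 := by
    rw [Real.sqrt_le_left (by positivity)]
    nlinarith
  linarith

/-- Multiplying the bound on m by log r gives m log r ≥ ℓ √(log r) ≥ 2 A ℓ, and m - 1 ≥ m / 2. In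
effect N^A ≤ r^(m-1): polynomial factors become negligible after the root. -/
lemma mul_log_le_of_div_sqrt_le {ℓ r m A : ℝ} (hA : 0 ≤ A) (hr : 1 < r)
    (h2 : 2 * √(Real.log r) ≤ ℓ) (hAr : 2 * A ≤ √(Real.log r)) (hm : ℓ / √(Real.log r) ≤ m) :
    2 ≤ m ∧ A * ℓ ≤ (m - 1) * Real.log r := by
  have hlog : 0 < Real.log r := Real.log_pos hr
  have hs : 0 < √(Real.log r) := Real.sqrt_pos.2 hlog
  have hm2 : 2 ≤ m := le_trans (by rwa [le_div_iff₀ hs]) hm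
  refine ⟨hm2, ?_⟩
  rw [div_le_iff₀ hs] at hm
  have hsq := Real.mul_self_sqrt hlog.le
  have hℓ : 0 ≤ ℓ := by linarith
  have h1 : m * √(Real.log r) * √(Real.log r) ≤ 2 * ((m - 1) * Real.log r) := by
    rw [mul_assoc, hsq]
    nlinarith
  have h3 : ℓ * (2 * A) ≤ m * √(Real.log r) * √(Real.log r) := by gcongr
  linarith

/-- The two scales `ε` and `η = ε²` of the proposition. -/
lemma scales {D d : ℕ} (hdD : d + 1 ≤ D) {N s ε η : ℝ} (hN : 0 < N) (hs : 1 ≤ s) (hsN : s ≤ N)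
    (hd : 1 ≤ d) (hε : ε = (s / N) ^ (1 / (2 * (D : ℝ) - d)))
    (hη : η = (s / N) ^ (2 / (2 * (D : ℝ) - d))) :
    0 < ε ∧ η = ε ^ 2 ∧ N * ε ^ d * η ^ (D - d) = s ∧ 1 / N ≤ η ∧
      N ^ ((d : ℝ) / (2 * (D : ℝ) - d)) * ε ^ d = s ^ ((d : ℝ) / (2 * (D : ℝ) - d)) := by
  have hdD' : (d : ℝ) + 1 ≤ D := by exact_mod_cast hdD
  have hd' : (1 : ℝ) ≤ d := by exact_mod_cast hd
  have hq : 0 < 2 * (D : ℝ) - d := by linarith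
  have ht : 0 < s / N := by positivity
  have ht1 : s / N ≤ 1 := by rwa [div_le_one hN]
  have hε0 : 0 < ε := by rw [hε]; positivity
  have hη2 : η = ε ^ 2 := by
    rw [hε, hη, ← Real.rpow_natCast, ← Real.rpow_mul ht.le]; congr 1; push_cast; ring
  have hεd : ε ^ d = (s / N) ^ ((d : ℝ) / (2 * (D : ℝ) - d)) := by
    rw [hε, ← Real.rpow_natCast, ← Real.rpow_mul ht.le]; congr 1; ring
  refine ⟨hε0, hη2, ?_, ?_, ?_⟩
  · have : ε ^ d * η ^ (D - d) = s / N := by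
      rw [hεd, hη, ← Real.rpow_natCast (_ ^ _) (D - d), ← Real.rpow_mul ht.le,
        ← Real.rpow_add ht, Nat.cast_sub (by omega)]
      have : (d : ℝ) / (2 * (D : ℝ) - d) + 2 / (2 * (D : ℝ) - d) * ((D : ℝ) - d) = 1 := by
        field_simp; ring
      rw [this, Real.rpow_one]
    rw [mul_assoc, this]; field_simp
  · rw [hη]
    calc 1 / N ≤ s / N := by gcongr
      _ = (s / N) ^ (1 : ℝ) := (Real.rpow_one _).symm
      _ ≤ _ := by
        refine Real.rpow_le_rpow_of_exponent_ge ht ht1 ?_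
        rw [div_le_one hq]; linarith
  · rw [hεd, ← Real.mul_rpow hN.le ht.le, mul_div_cancel₀ _ hN.ne']

end Asymptotics
end HOSC
end

noncomputable section
namespace HOSC

/-! ### Degrees of outliers and inliers for a given sample. -/

section Deterministic

variable {D d K N m : ℕ} {ε η τ δ₀ : ℝ} {S : Fin K → Set (Amb D)} {label : Fin N → Option (Fin K)}
  {x : Fin N → Amb D}

open Classical in
-- An inlier within ε of an outlier would put the outlier at distance less than τ + ε < δ₀ from a
-- surface, so only outliers need to be counted.
lemma degree_le_of_outlier (hε : 0 < ε) (hη : 0 < η) (hδ : ε < δ₀ - τ)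
    (hx : ∀ j, x j ∈ samplingRegion S τ δ₀ (label j)) {i : Fin N} (hi : label i = none)
    {F : Finset (Amb D × (Fin d → Amb D))}
    (hF : ∀ (n : ℕ) (y : Fin n → Amb D) (i : Fin n), y i ∈ unitCube D → flatness d y < η →
      (∀ j, ‖y j - y i‖ ≤ ε) → ∃ f ∈ F, ∀ j, y j ∈ frameBox f (4 * ε) (3 * η))
    {B : ℝ} (hB : ∀ f ∈ F, (count (Finset.univ.filter fun j => label j = none)
      (frameBox f (4 * ε) (3 * η)) x : ℝ) ≤ B) :
    degree d m ε η x i ≤ F.card * B ^ (m - 2 + 1) := by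
  have hxi : x i ∈ outlierRegion S δ₀ := by
    have := hx i
    rwa [hi] at this
  refine degree_le_of_cover hB fun p hp => ?_
  obtain ⟨h1, h2⟩ := of_affinity_ne_zero hε hη hp
  obtain ⟨f, hf, hfx⟩ := hF _ _ 0 hxi.1 h2 fun j => (h1 j 0).le
  refine ⟨f, hf, fun t => ?_⟩
  have h3 : ‖x i - x (p t)‖ < ε := h1 0 t.succ
  refine Finset.mem_filter.2 ⟨Finset.mem_filter.2 ⟨Finset.mem_univ _, ?_⟩, hfx t.succ⟩
  cases hl : label (p t) with
  | none => rfl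
  | some k =>
    exfalso
    have h4 := hx (p t)
    rw [hl] at h4
    refine hxi.2 (Set.mem_iUnion.2 ⟨k, hxi.1, ?_⟩)
    have h5 : Metric.infDist (x i) (S k) ≤ Metric.infDist (x (p t)) (S k) + dist (x i) (x (p t)) :=
      Metric.infDist_le_infDist_add_dist
    have h6 : Metric.infDist (x (p t)) (S k) < τ := h4.2
    rw [dist_eq_norm] at h5
    linarith

lemma le_degree_of_region (hε : 0 < ε) (hε1 : ε ≤ 1) (hx : Function.Injective x) {i : Fin N}
    {z y₀ : Amb D} {R : Set (Amb D)} {U : Submodule ℝ (Amb D)} (hU : Module.finrank ℝ U = d)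
    (hR : ∀ y ∈ R, ‖y - z‖ ≤ ε / 4 ∧ ‖y - y₀ - U.starProjection (y - y₀)‖ ≤ ε ^ 2 / 2)
    (hz : ‖z - y₀ - U.starProjection (z - y₀)‖ ≤ ε ^ 2 / 2) (hi : ‖x i - z‖ ≤ ε ^ 2 / 4)
    (J : Finset (Fin N)) :
    (((count J R x - (m - 2 + 1)) ^ (m - 2 + 1) : ℕ) : ℝ) ≤ degree d m ε (ε ^ 2) x i := by
  classical
  -- The index i may itself be counted in R. Erasing it costs one, which the summand 1 in
  -- `le_degree` restores.
  set A := (J.filter fun j => x j ∈ R).erase i with hA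
  have hcard : count J R x ≤ A.card + 1 := by
    have h1 := Finset.pred_card_le_card_erase (s := J.filter fun j => x j ∈ R) (a := i)
    have h2 : count J R x = (J.filter fun j => x j ∈ R).card := by
      unfold count; congr!
    rw [← hA] at h1; omega
  have hAR : ∀ j ∈ A, x j ∈ R := fun j hj => (Finset.mem_filter.1 (Finset.mem_of_mem_erase hj)).2
  have hε2 : ε ^ 2 ≤ ε := by nlinarith
  have hclose : ∀ j ∈ insert i A, ‖x j - z‖ ≤ ε / 4 := by
    intro j hj
    rcases Finset.mem_insert.1 hj with rfl | hj
    · linarith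
    · exact (hR _ (hAR j hj)).1
  have hflat : ∀ j ∈ insert i A,
      ‖x j - y₀ - U.starProjection (x j - y₀)‖ ≤ 3 / 4 * ε ^ 2 := by
    intro j hj
    rcases Finset.mem_insert.1 hj with rfl | hj
    · have e : x j - y₀ - U.starProjection (x j - y₀) = (x j - z - U.starProjection (x j - z))
          + (z - y₀ - U.starProjection (z - y₀)) := by
        rw [← sub_add_sub_cancel (x j) z y₀, map_add]; abel
      rw [e]
      have h1 := norm_sub_starProjection_le_of_mem (z := x j - z) U.zero_mem
      rw [sub_zero] at h1
      refine (norm_add_le _ _).trans ?_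
      linarith
    · have := (hR _ (hAR j hj)).2
      nlinarith [sq_nonneg ε]
  have h := le_degree (m := m) hx hε (pow_pos hε 2) (A := A) (Finset.notMem_erase i _)
    (c := ε / 2) (by linarith) (fun j hj k hk => by
      have e : x j - x k = (x j - z) - (x k - z) := by abel
      rw [e]
      refine (norm_sub_le _ _).trans ?_
      linarith [hclose j hj, hclose k hk]) hU y₀ (c' := 3 / 4 * ε ^ 2)
    (by nlinarith [pow_pos hε 2]) hflat
  refine le_trans ?_ h
  gcongr

end Deterministic

/-! ### Sampling measures and union bounds. -/

section Sampling

variable {D K N : ℕ} {τ δ₀ : ℝ} {S : Fin K → Set (Amb D)}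

lemma measurableSet_samplingRegion (l : Option (Fin K)) :
    MeasurableSet (samplingRegion S τ δ₀ l) := by
  cases l with
  | none =>
    exact isOpen_unitCube.measurableSet.diff
      (MeasurableSet.iUnion fun k => (isOpen_tube (S k) δ₀).measurableSet)
  | some k => exact (isOpen_tube (S k) τ).measurableSet

lemma volume_unitCube_ne_top : volume (unitCube D) ≠ ⊤ := by
  refine ((measure_mono (t := Metric.closedBall (0 : Amb D) D) fun y hy => ?_).trans_lt
    (isCompact_closedBall _ _).measure_lt_top).ne
  simpa using norm_le_of_mem_unitCube hy

lemma volume_samplingRegion_ne_top (l : Option (Fin K)) :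
    volume (samplingRegion S τ δ₀ l) ≠ ⊤ := by
  cases l with
  | none => exact ((measure_mono Set.sdiff_subset).trans_lt volume_unitCube_ne_top.lt_top).ne
  | some k => exact volume_tube_ne_top (S k) τ

lemma volume_tube_pos {S : Set (Amb D)} (hS : S ⊆ unitCube D) (hne : S.Nonempty) (hτ : 0 < τ) :
    0 < volume (tube S τ) := by
  obtain ⟨s, hs⟩ := hne
  refine (isOpen_tube S τ).measure_pos volume ⟨s, hS hs, ?_⟩
  rwa [Metric.infDist_zero_of_mem hs]

lemma measureReal_cond_eq {A r : Set (Amb D)} (hr : MeasurableSet r) :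
    (ProbabilityTheory.cond volume r).real A = volume.real (r ∩ A) / volume.real r := by
  rw [measureReal_def, ProbabilityTheory.cond_apply hr, ENNReal.toReal_mul, ENNReal.toReal_inv,
    measureReal_def, measureReal_def, inv_mul_eq_div]

lemma cond_singleton [Nonempty (Fin D)] (r : Set (Amb D)) (y : Amb D) :
    ProbabilityTheory.cond volume r {y} = 0 :=
  ProbabilityTheory.cond_absolutelyContinuous (measure_singleton y)

variable {ι E α : Type*} [Fintype ι] [MeasurableSpace E] (μ : ι → Measure E)
  [∀ i, IsProbabilityMeasure (μ i)]

lemma measure_exists_count_ge_le {F : Finset α} {A : α → Set E} (hA : ∀ f ∈ F, MeasurableSet (A f))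
    (J : Finset ι) {p : ℝ} (hp : ∀ f ∈ F, ∀ j ∈ J, (μ j).real (A f) ≤ p) (k : ℝ) :
    (Measure.pi μ).real {x | ∃ f ∈ F, k ≤ count J (A f) x}
      ≤ F.card * Real.exp (2 * (J.card * p) - k) := by
  have e : {x | ∃ f ∈ F, k ≤ count J (A f) x} = ⋃ f ∈ F, {x | k ≤ count J (A f) x} := by
    ext x; simp
  rw [e]
  refine (measureReal_biUnion_finset_le _ _).trans ?_
  calc _ ≤ ∑ _f ∈ F, Real.exp (2 * (J.card * p) - k) :=
        Finset.sum_le_sum fun f hf => measure_count_ge_le μ (hA f hf) J (hp f hf) k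
    _ = _ := by simp

lemma measure_exists_count_le_le {F : Finset α} {A : α → Set E} (hA : ∀ f ∈ F, MeasurableSet (A f))
    (J : Finset ι) {p : ℝ} (hp0 : 0 ≤ p) (hp : ∀ f ∈ F, ∀ j ∈ J, p ≤ (μ j).real (A f)) (k : ℝ) :
    (Measure.pi μ).real {x | ∃ f ∈ F, (count J (A f) x : ℝ) ≤ k}
      ≤ F.card * Real.exp (k - J.card * p / 2) := by
  have e : {x | ∃ f ∈ F, (count J (A f) x : ℝ) ≤ k} = ⋃ f ∈ F, {x | (count J (A f) x : ℝ) ≤ k} := by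
    ext x; simp
  rw [e]
  refine (measureReal_biUnion_finset_le _ _).trans ?_
  calc _ ≤ ∑ _f ∈ F, Real.exp (k - J.card * p / 2) :=
        Finset.sum_le_sum fun f hf => measure_count_le_le μ (hA f hf) J hp0 (hp f hf) k
    _ = _ := by simp

end Sampling
end HOSC
end

noncomputable section
namespace HOSC

/-! ### Tail events for outliers and for one cluster. -/

section Tails

variable {D d K N : ℕ} {ε η τ δ₀ : ℝ} {S : Fin K → Set (Amb D)} {label : Fin N → Option (Fin K)}

lemma measure_outlier_count_le (hd : 1 ≤ d) (hdD : d + 1 ≤ D) {v₀ : ℝ} (hv₀ : 0 < v₀)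
    (hε : 0 < ε) (hη : 0 < η)
    (hprob : ∀ i, IsProbabilityMeasure
      (ProbabilityTheory.cond volume (samplingRegion S τ δ₀ (label i))))
    (hv : (∃ i, label i = none) → v₀ ≤ volume.real (outlierRegion S δ₀))
    {F : Finset (Amb D × (Fin d → Amb D))} (hF : ∀ f ∈ F, Orthonormal ℝ f.2) (k : ℝ) :
    (sampleLaw S τ δ₀ label).real {x | ∃ f ∈ F,
        k ≤ count (Finset.univ.filter fun j => label j = none) (frameBox f (4 * ε) (3 * η)) x}
      ≤ F.card * Real.exp (2 * (unitBallVolume d * unitBallVolume (D - d) * 4 ^ d * 3 ^ (D - d) / v₀)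
          * (N * ε ^ d * η ^ (D - d)) - k) := by
  have hωd := unitBallVolume_pos d
  have hωe := unitBallVolume_pos (D - d)
  set C := unitBallVolume d * unitBallVolume (D - d) * 4 ^ d * 3 ^ (D - d) / v₀ with hC
  have hC0 : 0 ≤ C := by positivity
  refine (measure_exists_count_ge_le _ (p := C * (ε ^ d * η ^ (D - d))) (fun f _ => ?_) _
    (fun f hf j hj => ?_) k).trans ?_
  · exact (isOpen_box _ _ _ _).measurableSet
  · have hj' : label j = none := (Finset.mem_filter.1 hj).2
    rw [measureReal_cond_eq (measurableSet_samplingRegion _), hj']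
    have h1 := hv ⟨j, hj'⟩
    have hU : Module.finrank ℝ (Submodule.span ℝ (Set.range f.2)) = d := by
      rw [finrank_span_eq_card (hF f hf).linearIndependent, Fintype.card_fin]
    have h2 := volume_real_box hd hdD hU f.1 (α := 4 * ε) (β := 3 * η) (by positivity) (by positivity)
    have h3 : volume.real (samplingRegion S τ δ₀ none ∩ frameBox f (4 * ε) (3 * η))
        ≤ volume.real (frameBox f (4 * ε) (3 * η)) := by
      refine measureReal_mono Set.inter_subset_right ?_
      intro htop
      have h4 : (0 : ℝ) < volume.real (frameBox f (4 * ε) (3 * η)) := by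
        unfold frameBox; rw [h2]; positivity
      rw [measureReal_def, htop] at h4
      simp at h4
    calc _ ≤ volume.real (frameBox f (4 * ε) (3 * η)) / v₀ := by
          gcongr
          exact h1
      _ = _ := by
          unfold frameBox; rw [h2, mul_pow, mul_pow, hC]; ring
  · rw [show 2 * C * (N * ε ^ d * η ^ (D - d)) = 2 * (N * (C * (ε ^ d * η ^ (D - d)))) by ring]
    gcongr
    exact (Finset.card_filter_le _ _).trans (by simp)

/-- A region depending on the random point x i would spoil independence. Regions are fixed at the
points of a net of the tube instead, and x i borrows that of a net point within ε² / 4. -/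
lemma exists_inlier_event {c v : ℝ} {k : Fin K} (hε : 0 < ε) (hε1 : ε ≤ 1)
    (hD : 0 < D)
    (hprob : ∀ i, IsProbabilityMeasure
      (ProbabilityTheory.cond volume (samplingRegion S τ δ₀ (label i))))
    (hloc : ∀ z ∈ tube (S k) τ, HasLocalRegion d (S k) τ ε z c) (hc : 0 ≤ c)
    (hv0 : 0 < v) (hv : volume.real (tube (S k) τ) ≤ v) {M : ℕ} (hM : 8 * D / ε ^ 2 < M) (b : ℝ) :
    ∃ Bad : Set (Fin N → Amb D),
      (sampleLaw S τ δ₀ label).real Bad ≤ (M : ℝ) ^ D * Real.exp (b - clusterSize label k * (c / v) / 2) ∧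
      ∀ x ∉ Bad, Function.Injective x → ∀ i, x i ∈ tube (S k) τ → ∀ m, ∃ n : ℕ, b < n ∧
        (((n - (m - 2 + 1)) ^ (m - 2 + 1) : ℕ) : ℝ) ≤ degree d m ε (ε ^ 2) x i := by
  classical
  have hD' : (0 : ℝ) < D := by exact_mod_cast hD
  obtain ⟨F, hFs, hFc, hF⟩ := exists_net (fun (q : Amb D) (j : Fin D) => q j) (Q := tube (S k) τ)
    (B := 1) (δ := ε ^ 2 / (4 * D)) (by positivity) (fun q hq j => by
      have h1 := hq.1 j
      rw [abs_le]; constructor <;> linarith [h1.1, h1.2]) (M := M) (by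
      refine lt_of_le_of_lt (le_of_eq ?_) hM
      field_simp; norm_num)
  rw [Fintype.card_fin] at hFc
  choose! R U y₀ hU hRm hRs hR hz hvol using hloc
  set J := Finset.univ.filter fun i => label i = some k with hJ
  refine ⟨{x | ∃ f ∈ F, (count J (R f) x : ℝ) ≤ b}, ?_, fun x hx hinj i hi m => ?_⟩
  · refine (measure_exists_count_le_le _ (p := c / v) (fun f hf => hRm f (hFs hf)) J (by positivity)
      (fun f hf j hj => ?_) b).trans ?_
    · have hj' : label j = some k := (Finset.mem_filter.1 hj).2
      rw [measureReal_cond_eq (measurableSet_samplingRegion _), hj']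
      change _ ≤ volume.real (tube (S k) τ ∩ R f) / volume.real (tube (S k) τ)
      rw [Set.inter_eq_right.2 (hRs f (hFs hf))]
      have hpos : 0 < volume.real (tube (S k) τ) := by
        have h1 := (isOpen_tube (S k) τ).measure_pos volume ⟨f, hFs hf⟩
        exact ENNReal.toReal_pos h1.ne' (volume_tube_ne_top _ _)
      gcongr
      exact hvol f (hFs hf)
    · have e : J.card = clusterSize label k := by
        unfold clusterSize; congr!
      rw [e]
      gcongr
      exact_mod_cast hFc
  · obtain ⟨f, hf, hfi⟩ := hF (x i) hi
    refine ⟨count J (R f) x, ?_, ?_⟩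
    · by_contra! hcon
      exact hx ⟨f, hf, hcon⟩
    · refine le_degree_of_region hε hε1 hinj (hU f (hFs hf)) (hR f (hFs hf)) (hz f (hFs hf)) ?_ J
      refine (norm_le_of_forall_abs_le (by positivity) hfi).trans (le_of_eq ?_)
      field_simp

end Tails

/-! ### Numerical inequalities. -/

section Numeric

lemma rpow_le_of_le_pow {s t a : ℝ} {n m : ℕ} (hs : 0 ≤ s) (ht : 0 ≤ t) (hn : 0 < n)
    (hm : (m : ℝ) - 1 = n) (h : s ≤ a * t ^ n) {r : ℝ} (hr : 0 ≤ r) (ha : a ≤ r ^ n) :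
    s ^ (1 / ((m : ℝ) - 1)) ≤ r * t := by
  have h1 : s ≤ (r * t) ^ n := by rw [mul_pow]; exact h.trans (by gcongr)
  rw [hm]
  calc s ^ (1 / (n : ℝ)) ≤ ((r * t) ^ n) ^ (1 / (n : ℝ)) := by gcongr
    _ = _ := by
      rw [one_div, Real.pow_rpow_inv_natCast (by positivity) hn.ne']

lemma lt_rpow_of_pow_le {s t : ℝ} {n m k : ℕ} (hn : 0 < n)
    (hm : (m : ℝ) - 1 = n) (h : ((k ^ n : ℕ) : ℝ) ≤ s) (hk : t < k) :
    t < s ^ (1 / ((m : ℝ) - 1)) := by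
  refine hk.trans_le ?_
  rw [hm]
  push_cast at h
  calc (k : ℝ) = ((k : ℝ) ^ n) ^ (1 / (n : ℝ)) := by
        rw [one_div, Real.pow_rpow_inv_natCast (by positivity) hn.ne']
    _ ≤ _ := by gcongr

lemma le_sqrt_pow_of_le {a r ℓ : ℝ} {n : ℕ} (hr : 0 < r) (h : 2 * a * ℓ ≤ n * Real.log r) :
    Real.exp (a * ℓ) ≤ √r ^ n := by
  have : √r = Real.exp (Real.log r / 2) := by
    rw [← Real.log_sqrt hr.le, Real.exp_log (Real.sqrt_pos.2 hr)]
  rw [this, ← Real.exp_nat_mul]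
  rw [Real.exp_le_exp]
  linarith

/-- The two cases of the jitter level in the mass of a local region. -/
lemma mul_mass_ge {Nk ρ ℓ N ε τ c C q : ℝ} {d e : ℕ} (hC : 0 < C) (hc : 0 < c) (hε : 0 < ε)
    (hτ : 0 < τ) (hρ : 1 ≤ ρ) (hscale : N * ε ^ d * (ε ^ 2) ^ e = ρ * ℓ)
    (hℓ : 16 * C / c ≤ ℓ)
    (hq : 16 * C / c * ρ ≤ N ^ q * ε ^ d)
    (hNk : ρ * ℓ * max (N ^ q) (N * τ ^ e) ≤ Nk) :
    16 * ρ ^ 2 * ℓ ≤ Nk * (c * (ε ^ d * min τ (ε ^ 2) ^ e) / (C * τ ^ e)) := by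
  have hℓ0 : 0 < ℓ := lt_of_lt_of_le (by positivity) hℓ
  rw [div_mul_eq_mul_div, div_le_iff₀ hc] at hq
  rw [div_le_iff₀ hc] at hℓ
  rw [mul_div_assoc', le_div_iff₀ (by positivity)]
  -- If τ ≤ ε², the powers of τ cancel and the first term of the maximum suffices. Otherwise N τ^e
  -- compensates the tube volume and `hscale` gives the rest.
  rcases le_total τ (ε ^ 2) with h | h
  · rw [min_eq_left h]
    have h1 : ρ * ℓ * N ^ q ≤ Nk := le_trans (by gcongr; exact le_max_left _ _) hNk
    calc 16 * ρ ^ 2 * ℓ * (C * τ ^ e) = ρ * ℓ * (16 * C * ρ) * τ ^ e := by ring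
      _ ≤ ρ * ℓ * (N ^ q * ε ^ d * c) * τ ^ e := by gcongr
      _ = (ρ * ℓ * N ^ q) * (c * (ε ^ d * τ ^ e)) := by ring
      _ ≤ _ := by gcongr
  · rw [min_eq_right h]
    have h1 : ρ * ℓ * (N * τ ^ e) ≤ Nk := le_trans (by gcongr; exact le_max_right _ _) hNk
    calc 16 * ρ ^ 2 * ℓ * (C * τ ^ e) = ρ * ρ * ℓ * (16 * C) * τ ^ e := by ring
      _ ≤ ρ * ρ * ℓ * (ℓ * c) * τ ^ e := by gcongr
      _ = ρ * ℓ * τ ^ e * c * (ρ * ℓ) := by ring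
      _ = (ρ * ℓ * (N * τ ^ e)) * (c * (ε ^ d * (ε ^ 2) ^ e)) := by rw [← hscale]; ring
      _ ≤ _ := by gcongr

lemma half_exp_le {s t : ℝ} (h : s + 1 ≤ t) : Real.exp s ≤ Real.exp t / 2 := by
  have h1 : (2 : ℝ) ≤ Real.exp 1 := by linarith [Real.add_one_le_exp (1 : ℝ)]
  have h2 : Real.exp s * Real.exp 1 ≤ Real.exp t := by rw [← Real.exp_add]; gcongr
  nlinarith [Real.exp_pos s]

end Numeric
end HOSC
end

/-! ### The main theorem. -/

theorem mainTheorem2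
    (D d K : ℕ) (hd : 1 ≤ d) (hdD : d + 1 ≤ D)
    (κ v₀ : ℝ) (hκ : 1 ≤ κ) (hv₀ : 0 < v₀)
    (ρ : ℕ → ℝ) (hρ : Tendsto ρ atTop atTop)
    (hρ_slow : Asymptotics.IsLittleO atTop ρ
      (fun N : ℕ => Real.log N ^ ((d : ℝ) / (2 * ((D : ℝ) - d))))) :
    ∀ᶠ N : ℕ in atTop,
      ∀ (m : ℕ) (ε η τ δ₀ : ℝ) (S : Fin K → Set (HOSC.Amb D))
        (label : Fin N → Option (Fin K)),
        (∀ k, HOSC.IsSurface d κ (S k)) →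
        0 < τ → τ < 1 / κ →
        ((∃ i, label i = none) → v₀ ≤ volume.real (HOSC.outlierRegion S δ₀)) →
        (m : ℝ) ≤ Real.log N →
        Real.log N / Real.sqrt (Real.log (ρ N)) ≤ (m : ℝ) →
        ε = (ρ N * Real.log N / N) ^ (1 / (2 * (D : ℝ) - d)) →
        η = (ρ N * Real.log N / N) ^ (2 / (2 * (D : ℝ) - d)) →
        ε < δ₀ - τ →
        (∀ k, ρ N * Real.log N *
            max ((N : ℝ) ^ ((d : ℝ) / (2 * (D : ℝ) - d))) ((N : ℝ) * τ ^ (D - d))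
          ≤ (HOSC.clusterSize label k : ℝ)) →
        1 - (N : ℝ) ^ (-ρ N) ≤
          (HOSC.sampleLaw S τ δ₀ label).real
            {x | ∀ i, HOSC.degree d m ε η x i ^ (1 / ((m : ℝ) - 1))
                  ≤ ρ N * (N * ε ^ d * η ^ (D - d)) ↔ label i = none} := by
  have hd' : (1 : ℝ) ≤ d := by exact_mod_cast hd
  have hdD' : (d : ℝ) + 1 ≤ D := by exact_mod_cast hdD
  have hq : 0 < 2 * (D : ℝ) - d := by linarith
  have hκ0 : 0 < κ := by linarith
  have hD0 : (0 : ℝ) < D := by linarith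
  obtain ⟨c, hc, hloc⟩ := HOSC.exists_hasLocalRegion d D hd hdD κ hκ
  obtain ⟨C, hC, htube⟩ := HOSC.exists_volume_tube_le d D hd hdD κ hκ
  have hωd := HOSC.unitBallVolume_pos d
  have hωe := HOSC.unitBallVolume_pos (D - d)
  set C₁ := HOSC.unitBallVolume d * HOSC.unitBallVolume (D - d) * 4 ^ d * 3 ^ (D - d) / v₀ with hC₁
  have hC₁0 : 0 < C₁ := by positivity
  -- This dominates the mesh constants of both nets. As 1 / η ≤ N, N² cells per coordinate then
  -- suffice for N > A₀.
  set A₀ : ℝ := 2 * (D + 1) * (D * (d + 1) + 1) + 8 * D with hA₀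
  have hA₀0 : 0 < A₀ := by positivity
  set a₁ : ℝ := 2 * ((d + 1) * D) with ha₁
  have ha₁0 : 0 < a₁ := by positivity
  have hq0 : 0 ≤ (d : ℝ) / (2 * ((D : ℝ) - d)) := div_nonneg (by linarith) (by linarith)
  filter_upwards [hρ.eventually_ge_atTop (max 4 ((2 * C₁ + a₁ + 3) ^ 2)),
    hρ.eventually_ge_atTop (K + 2 * D + 2),
    (Real.tendsto_sqrt_atTop.comp (Real.tendsto_log_atTop.comp hρ)).eventually_ge_atTop
      (2 * (2 * a₁)),
    HOSC.eventually_sqrt_log_le hρ hq0 hρ_slow,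
    HOSC.eventually_mul_le_rpow hρ (by linarith : (0 : ℝ) < d)
      (by linarith : 0 < 2 * ((D : ℝ) - d)) hρ_slow (16 * C / c) (by positivity),
    HOSC.eventually_scale_le hρ hρ_slow (s := 1 / (10 * κ)) (e := 1 / (2 * (D : ℝ) - d))
      (by positivity) (by positivity),
    HOSC.eventually_scale_le hρ hρ_slow (s := 1) (e := 1) one_pos one_pos,
    HOSC.tendsto_log_natCast.eventually_ge_atTop (max 1 (16 * C / c)),
    tendsto_natCast_atTop_atTop.eventually_gt_atTop A₀]
    with N hρ1 hρ2 hρ3 hsl hρℓ hεs htN hℓ hNA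
  intro m ε η τ δ₀ S label hS hτ hτκ hv hm1 hm2 hε hη hδ hNk
  have hN : (0 : ℝ) < N := hA₀0.trans hNA
  set ℓ := Real.log N with hℓdef
  set r := ρ N with hr
  have hℓ1 : 1 ≤ ℓ := (le_max_left _ _).trans hℓ
  have hr4 : 4 ≤ r := (le_max_left _ _).trans hρ1
  have hrs : 2 * C₁ + a₁ + 3 ≤ √r := Real.le_sqrt_of_sq_le ((le_max_right _ _).trans hρ1)
  have hsq : √r * √r = r := Real.mul_self_sqrt (by linarith)
  have hs1 : 1 ≤ r * ℓ := one_le_mul_of_one_le_of_one_le (by linarith) hℓ1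
  have hsN : r * ℓ ≤ N := by
    rwa [Real.rpow_one, div_le_one hN] at htN
  obtain ⟨hε0, hηε, hscale, hηN, hNε⟩ := HOSC.scales hdD hN hs1 hsN hd hε hη
  have hℓr : ℓ ≤ r * ℓ := le_mul_of_one_le_left (by linarith) (by linarith)
  have hη0 : 0 < η := by rw [hηε]; positivity
  have hε10 : 10 * κ * ε ≤ 1 := by
    rw [← hε, le_div_iff₀ (by positivity)] at hεs
    linarith
  have hε4 : ε ≤ 1 / 4 := by
    have : 10 * 1 * ε ≤ 10 * κ * ε := by gcongr
    linarith
  have hηleε : η ≤ ε := by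
    rw [hηε, sq]; exact mul_le_of_le_one_left hε0.le (by linarith)
  obtain ⟨hm2', hmlog⟩ := HOSC.mul_log_le_of_div_sqrt_le (by positivity) (by linarith) hsl hρ3 hm2
  have hmN : 2 ≤ m := by exact_mod_cast hm2'
  set n := m - 2 + 1 with hn
  have hn0 : 0 < n := by omega
  have hmn : (m : ℝ) - 1 = n := by
    have : m = n + 1 := by omega
    rw [this]; push_cast; ring
  have hexpN : (N : ℝ) = Real.exp ℓ := (Real.exp_log hN).symm
  have hNinv : 1 / η ≤ N := by
    rw [div_le_iff₀ hη0]; rw [div_le_iff₀ hN] at hηN; linarith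
  have hMη : A₀ / η < ((N ^ 2 : ℕ) : ℝ) := by
    rw [div_eq_mul_one_div]; push_cast
    calc A₀ * (1 / η) ≤ A₀ * N := by gcongr
      _ < N ^ 2 := by rw [sq]; gcongr
  choose T hT using fun k => (hS k).exists_tangentSurface hκ
  have hDne : Nonempty (Fin D) := ⟨⟨0, by omega⟩⟩
  have hprob : ∀ i, IsProbabilityMeasure
      (ProbabilityTheory.cond volume (HOSC.samplingRegion S τ δ₀ (label i))) := by
    intro i
    refine ProbabilityTheory.cond_isProbabilityMeasure_of_finite ?_
      (HOSC.volume_samplingRegion_ne_top _)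
    cases hl : label i with
    | none =>
      have h1 : 0 < volume.real (HOSC.outlierRegion S δ₀) := hv₀.trans_le (hv ⟨i, hl⟩)
      exact (ENNReal.toReal_pos_iff.1 h1).1.ne'
    | some k => exact (HOSC.volume_tube_pos (hS k).subset_cube (hT k).nonempty hτ).ne'
  set μ := HOSC.sampleLaw S τ δ₀ label with hμ
  have hμp : IsProbabilityMeasure μ := by rw [hμ]; unfold HOSC.sampleLaw; infer_instance
  have hae1 : ∀ᵐ x ∂μ, ∀ i, x i ∈ HOSC.samplingRegion S τ δ₀ (label i) :=
    HOSC.ae_pi_mem _ fun i =>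
      ProbabilityTheory.ae_cond_mem (HOSC.measurableSet_samplingRegion _)
  have hae2 : ∀ᵐ x ∂μ, Function.Injective x := by
    have : ∀ᵐ x ∂μ, ∀ p : Fin N × Fin N, p.1 ≠ p.2 → x p.1 ≠ x p.2 := by
      rw [eventually_countable_forall]
      intro p
      rw [eventually_imp_distrib_left]
      intro hp
      exact HOSC.ae_pi_ne _ hp fun y => HOSC.cond_singleton _ y
    filter_upwards [this] with x hx i j hij
    by_contra hne
    exact hx (i, j) hne hij
  have hae := hae1.and hae2
  -- outliers
  obtain ⟨F, hFc, hFo, hF⟩ := HOSC.exists_flat_net (by omega : d ≤ D) hη0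
    hηleε hε4 (M := N ^ 2) (by
      refine lt_of_le_of_lt ?_ hMη
      gcongr
      rw [hA₀]
      have : (0 : ℝ) ≤ 8 * D := by positivity
      linarith)
  have hFc' : (F.card : ℝ) ≤ Real.exp (a₁ * ℓ) := by
    have h1 : (F.card : ℝ) ≤ (((N ^ 2) ^ ((d + 1) * D) : ℕ) : ℝ) := by exact_mod_cast hFc
    refine h1.trans (le_of_eq ?_)
    push_cast
    rw [← pow_mul, hexpN, ← Real.exp_nat_mul, ha₁]
    push_cast; ring_nf
  -- The level lies between the mean, O(r ℓ), and the threshold r² ℓ. One factor √r pays for the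
  -- deviation and the union bound; the other is left for the root of the number of boxes.
  set Bad₀ : Set (Fin N → HOSC.Amb D) := {x | ∃ f ∈ F, √r * r * ℓ ≤ HOSC.count
    (Finset.univ.filter fun j => label j = none) (HOSC.frameBox f (4 * ε) (3 * η)) x} with hBad₀
  have hp0 : μ.real Bad₀ ≤ Real.exp (-r * ℓ) / 2 := by
    refine (HOSC.measure_outlier_count_le hd hdD hv₀ hε0 hη0 hprob hv hFo _).trans ?_
    rw [hscale, ← hC₁]
    calc _ ≤ Real.exp (a₁ * ℓ) * Real.exp (2 * C₁ * (r * ℓ) - √r * r * ℓ) := by gcongr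
      _ = Real.exp (a₁ * ℓ + (2 * C₁ * (r * ℓ) - √r * r * ℓ)) := (Real.exp_add _ _).symm
      _ ≤ _ := by
        refine HOSC.half_exp_le ?_
        have h1 : (2 * C₁ + a₁ + 3) * (r * ℓ) ≤ √r * (r * ℓ) := by gcongr
        have h2 : a₁ * ℓ ≤ a₁ * (r * ℓ) := by gcongr
        linarith
  -- inliers
  have hin : ∀ k, ∃ Bad : Set (Fin N → HOSC.Amb D),
      μ.real Bad ≤ ((N ^ 2 : ℕ) : ℝ) ^ D * Real.exp (4 * r ^ 2 * ℓ - HOSC.clusterSize label k *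
        (c * (ε ^ d * min τ (ε ^ 2) ^ (D - d)) / (C * τ ^ (D - d))) / 2) ∧
      ∀ x ∉ Bad, Function.Injective x → ∀ i, x i ∈ HOSC.tube (S k) τ → ∀ m, ∃ n : ℕ,
        4 * r ^ 2 * ℓ < n ∧
        (((n - (m - 2 + 1)) ^ (m - 2 + 1) : ℕ) : ℝ) ≤ HOSC.degree d m ε (ε ^ 2) x i := by
    intro k
    have hτ1 : τ ≤ 1 := hτκ.le.trans (by rw [div_le_one hκ0]; exact hκ)
    refine HOSC.exists_inlier_event hε0 (by linarith) (by omega) hprob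
      (hloc (S k) (T k) (hT k) τ ε hτ hτ1 hε0 hε10) (by positivity) (by positivity)
      (htube (S k) (T k) (hT k) τ hτ hτκ.le) ?_ _
    refine lt_of_le_of_lt ?_ hMη
    rw [← hηε]
    gcongr
    rw [hA₀]
    have : (0 : ℝ) ≤ 2 * (D + 1) * (D * (d + 1) + 1) := by positivity
    linarith
  choose Bad hBadμ hBad using hin
  have hp1 : μ.real (⋃ k, Bad k) ≤ Real.exp (-r * ℓ) / 2 := by
    -- Expected mass at least 16 r² ℓ against the level 4 r² ℓ leaves the exponent 4 - 16 / 2 = -4;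
    -- the net contributes N^(2D).
    have h1 : ∀ k, μ.real (Bad k) ≤ Real.exp (2 * D * ℓ - 4 * r ^ 2 * ℓ) := by
      intro k
      refine (hBadμ k).trans ?_
      have h2 := HOSC.mul_mass_ge (d := d) (q := (d : ℝ) / (2 * (D : ℝ) - d)) hC hc hε0 hτ (by linarith)
        (by rw [← hηε]; exact hscale) ((le_max_right _ _).trans hℓ) (by
          rw [hNε]
          refine hρℓ.trans (le_of_eq ?_)
          congr 2; ring) (hNk k)
      push_cast
      rw [← pow_mul, hexpN, ← Real.exp_nat_mul, ← Real.exp_add, Real.exp_le_exp]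
      push_cast
      linarith
    calc μ.real (⋃ k, Bad k) ≤ ∑ k, μ.real (Bad k) := measureReal_iUnion_fintype_le _
      _ ≤ ∑ _k : Fin K, Real.exp (2 * D * ℓ - 4 * r ^ 2 * ℓ) := Finset.sum_le_sum fun k _ => h1 k
      _ = K * Real.exp (2 * D * ℓ - 4 * r ^ 2 * ℓ) := by simp
      _ ≤ Real.exp (K * ℓ) * Real.exp (2 * D * ℓ - 4 * r ^ 2 * ℓ) := by
        gcongr
        have h2 := Real.add_one_le_exp (K * ℓ)
        have h3 : (K : ℝ) ≤ K * ℓ := le_mul_of_one_le_right (by positivity) hℓ1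
        linarith
      _ = Real.exp (K * ℓ + (2 * D * ℓ - 4 * r ^ 2 * ℓ)) := (Real.exp_add _ _).symm
      _ ≤ _ := by
        refine HOSC.half_exp_le ?_
        have h2 : (K + 2 * D + 2) * ℓ ≤ r * ℓ := by gcongr
        have h3 : r * ℓ * 4 ≤ r * ℓ * r := by gcongr
        linarith
  set good : Set (Fin N → HOSC.Amb D) := {x | ∀ i, HOSC.degree d m ε η x i ^ (1 / ((m : ℝ) - 1))
      ≤ r * (N * ε ^ d * η ^ (D - d)) ↔ label i = none} with hgood
  set null : Set (Fin N → HOSC.Amb D) := {x | ¬ ((∀ i, x i ∈ HOSC.samplingRegion S τ δ₀ (label i)) ∧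
    Function.Injective x)} with hnull
  have hnull0 : μ.real null = 0 := by
    rw [measureReal_def, show μ null = 0 from hae, ENNReal.toReal_zero]
  -- Only subadditivity is applied to this covering, so the good event need not be shown measurable.
  have hcover : (Set.univ : Set (Fin N → HOSC.Amb D)) ⊆ good ∪ (null ∪ (Bad₀ ∪ ⋃ k, Bad k)) := by
    intro x _
    by_cases hx0 : x ∈ null
    · exact Or.inr (Or.inl hx0)
    by_cases hx1 : x ∈ Bad₀
    · exact Or.inr (Or.inr (Or.inl hx1))
    by_cases hx2 : x ∈ ⋃ k, Bad k
    · exact Or.inr (Or.inr (Or.inr hx2))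
    refine Or.inl fun i => ?_
    obtain ⟨hxr, hxi⟩ := not_not.1 hx0
    have hdeg0 := HOSC.degree_nonneg (d := d) (m := m) (ε := ε) (η := η) x i
    rw [hscale]
    cases hl : label i with
    | none =>
      refine iff_of_true ?_ rfl
      have h1 := HOSC.degree_le_of_outlier (m := m) hε0 hη0 hδ hxr hl hF (B := √r * r * ℓ)
        fun f hf => by
          by_contra! hcon
          exact hx1 ⟨f, hf, by convert hcon.le⟩
      have h2 := HOSC.le_sqrt_pow_of_le (a := a₁) (r := r) (ℓ := ℓ) (n := n) (by linarith)
        (by rw [← hmn]; linarith)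
      refine (HOSC.rpow_le_of_le_pow hdeg0 (by positivity) hn0 hmn h1 (Real.sqrt_nonneg r)
        (hFc'.trans h2)).trans (le_of_eq ?_)
      rw [← mul_assoc, ← mul_assoc, hsq, mul_assoc]
    | some k =>
      refine iff_of_false ?_ (by simp)
      rw [not_le]
      have hxt : x i ∈ HOSC.tube (S k) τ := by
        have := hxr i
        rwa [hl] at this
      obtain ⟨n', hn', hdeg⟩ := hBad k x (fun h => hx2 (Set.mem_iUnion.2 ⟨k, h⟩)) hxi i hxt m
      rw [← hηε] at hdeg
      refine HOSC.lt_rpow_of_pow_le hn0 hmn hdeg ?_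
      -- Truncated subtraction is safe here: n' > 4 r² ℓ and n ≤ ℓ ≤ r² ℓ, so n' - n exceeds the
      -- threshold r² ℓ.
      have h3 : (n' : ℝ) ≤ ((n' - n : ℕ) : ℝ) + n := by
        rw [← Nat.cast_add, Nat.cast_le]
        exact le_tsub_add
      have h4 : ℓ ≤ r ^ 2 * ℓ := le_mul_of_one_le_left (by linarith) (one_le_pow₀ (by linarith))
      have h5 : (n : ℝ) ≤ ℓ := by rw [← hmn]; linarith
      have h6 : r * (r * ℓ) = r ^ 2 * ℓ := by ring
      linarith
  have hfin : (1 : ℝ) ≤ μ.real good + (0 + (Real.exp (-r * ℓ) / 2 + Real.exp (-r * ℓ) / 2)) := by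
    calc (1 : ℝ) = μ.real Set.univ := by simp
      _ ≤ μ.real (good ∪ (null ∪ (Bad₀ ∪ ⋃ k, Bad k))) := measureReal_mono hcover
      _ ≤ μ.real good + μ.real (null ∪ (Bad₀ ∪ ⋃ k, Bad k)) := measureReal_union_le _ _
      _ ≤ μ.real good + (μ.real null + μ.real (Bad₀ ∪ ⋃ k, Bad k)) := by
        gcongr; exact measureReal_union_le _ _
      _ ≤ μ.real good + (μ.real null + (μ.real Bad₀ + μ.real (⋃ k, Bad k))) := by
        gcongr; exact measureReal_union_le _ _
      _ ≤ _ := by rw [hnull0]; gcongr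
  have hpow : (N : ℝ) ^ (-r) = Real.exp (-r * ℓ) := by
    rw [Real.rpow_def_of_pos hN, mul_comm]
  rw [hpow]
  linarith
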